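/- Let $0<\alpha<1$ and $\theta>0$. A Thorin measure is a sigma-finite measure $\nu$ on $(0,\infty)$ with $\vartheta_\nu(\lambda):=\int_0^\infty\log(1+\lambda x)\,\nu(dx)<\infty$ for all $\lambda>0$. Products of random variables below are products of independent random variables, and $G_a$ denotes a Gamma$(a)$ variable with scale $1$. * $GGC(\theta,\nu)$ is the law of a nonnegative random variable with Laplace transform $\lambda\mapsto e^{-\theta\vartheta_\nu(\lambda)}$, and $S_\alpha\ge 0$ has Laplace transform $e^{-\lambda^\alpha}$. For $b>0$, $c\ge0$, $GGC^{(b,c)}_\alpha(\theta,\nu)$ is the law of $bW$ under the probability with density $e^{-cW}/\mathbb E[e^{-cW}]$, where $W=Z^{1/\alpha}S_\alpha$ and $Z$ is $GGC(\theta,\nu)$. * $M_\theta(\nu)$ is a nonnegative random variable whose law is characterized by $\mathbb E[(1+\lambda M_\theta(\nu))^{-\theta}]=e^{-\theta\vartheta_\nu(\lambda)}$, $\lambda>0$, when such a variable exists. * $\varrho_\alpha(y)=\frac{\sin(\pi\alpha)}{\pi}\frac{y^{\alpha-1}}{y^{2\alpha}+2y^\alpha\cos(\pi\alpha)+1}$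 and $\varrho_{\alpha,\nu}(x)=\frac{\sin(\pi\alpha)}{\pi}\int_0^\infty\frac{x^{\alpha-1}r}{x^{2\alpha}+2x^\alpha r\cos(\pi\alpha)+r^2}\,\nu(dr)$ are densities on $(0,\infty)$, identified with the corresponding measures. * $\Lambda_{\alpha,\nu}(dx)=\int_0^\infty\Lambda_{\alpha,r/(1+r)}(dx)\,\nu(dr)$, where, with $q=1-p$, $\Lambda_{\alpha,p}$ has on $(0,1)$ the density $\frac{pq\sin(\pi\alpha)x^{\alpha-1}(1-x)^{\alpha-1}}{\pi[q^2x^{2\alpha}+p^2(1-x)^{2\alpha}+2pqx^\alpha(1-x)^\alpha\cos(\pi\alpha)]}$. * For a nonnegative $M$, $\tau>0$ and $c>0$, $Y_{\tau,c}$ has the law of $Y=cM/(cM+1)$ reweighted by $(1-Y)^\tau/\mathbb E[(1+cM)^{-\tau}]$. * For $p\in[0,1]$, $A^{(\alpha,\alpha\theta)}_{\alpha,p}$ has the law of $\sum_kP_k\mathbf 1\{U_k\le p\}$, where $(P_k)$ is a $PD(\alpha,\alpha\theta)$ sequence, independent of the iid uniform$[0,1]$ variables $U_k$ (the occupation time of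 the $p$-skewed generalized Bessel bridge). For a $[0,1]$-valued random variable $\xi$, $A^{(\alpha,\alpha\theta)}_{\alpha,\xi}$ is, given $\xi=p$, distributed as $A^{(\alpha,\alpha\theta)}_{\alpha,p}$. When $M_\theta(\nu)$ exists, $\xi_\theta$ denotes a variable with the law of $Y_{\theta,1}$ formed from $M=M_\theta(\nu)$. **Proposition.** Let $\nu$ be any Thorin measure. Then $\varrho_{\alpha,\nu}$ and $\Lambda_{\alpha,\nu}$ are Thorin measures, all the laws in the next display exist and are unique, and $$GGC^{(1,0)}_\alpha(\theta,\nu)=GGC(\alpha\theta,\varrho_{\alpha,\nu}),\qquad GGC^{(1,1)}_\alpha(\theta,\nu)=GGC(\alpha\theta,\Lambda_{\alpha,\nu}).$$ The variable $M_\theta(\nu)$ exists if and only if $\nu((0,\infty))\le1$. Whenever it exists, its law is unique, the variables $M_{\alpha\theta}(\varrho_\alpha)$, $M_{\alpha\theta}(\varrho_{\alpha,\nu})$ and $M_{\alpha\theta}(\Lambda_{\alpha,\nu})$ exist with unique laws, the laws $GGC^{(1,0)}_\alpha(\theta,\nu)$ and $GGC^{(1,1)}_\alpha(\theta,\nu)$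 are those of $G_{\alpha\theta}M_{\alpha\theta}(\varrho_{\alpha,\nu})$ and $G_{\alpha\theta}M_{\alpha\theta}(\Lambda_{\alpha,\nu})$ respectively, and 1. $M_{\alpha\theta}(\varrho_{\alpha,\nu})\overset d=M_{\alpha\theta}(\varrho_\alpha)\,[M_\theta(\nu)]^{1/\alpha}$; 2. $A^{(\alpha,\alpha\theta)}_{\alpha,\xi_\theta}\overset d=M_{\alpha\theta}(\Lambda_{\alpha,\nu})\overset d=Y_{\alpha\theta,1}$, where $Y_{\alpha\theta,1}$ is formed from $M=M_{\alpha\theta}(\varrho_{\alpha,\nu})$. If $\nu$ is a probability measure, then so are $\varrho_\alpha$, $\varrho_{\alpha,\nu}$ and $\Lambda_{\alpha,\nu}$, and $M_\theta(\nu)$, $M_{\alpha\theta}(\varrho_\alpha)$, $M_{\alpha\theta}(\varrho_{\alpha,\nu})$, $M_{\alpha\theta}(\Lambda_{\alpha,\nu})$ are Dirichlet mean functionals: for each of these pairs, $M_\tau(H)\overset d=\sum_kP_kW_k$ with $(P_k)$ a $PD(0,\tau)$ sequence independent of the iid variables $W_k$ with law $H$. -/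

import Mathlib

open MeasureTheory ProbabilityTheory Set
open scoped ENNReal

noncomputable section

namespace GGCalculus

/-! Laws of nonnegative random variables are represented as measures on `ℝ`. -/

/-- A Thorin measure: a sigma-finite measure on `(0,∞)` with `∫ log (1 + l x) ν(dx) < ∞` for
all `l > 0`. It may have infinite total mass. -/
structure IsThorin (ν : Measure ℝ) : Prop where
  pos : ν (Iic 0) = 0
  sigmaFinite : SigmaFinite ν
  integrable : ∀ l : ℝ, 0 < l → Integrable (fun x => Real.log (1 + l * x)) ν

/-- `ϑ(l) = ∫ log (1 + l x) ν(dx)`. -/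
def thorinExponent (ν : Measure ℝ) (l : ℝ) : ℝ := ∫ x, Real.log (1 + l * x) ∂ν

/-- `m` is the law of a nonnegative random variable. -/
structure IsNonnegLaw (m : Measure ℝ) : Prop where
  prob : IsProbabilityMeasure m
  nonneg : m (Iio 0) = 0

/-- Law of the product `X * Y` of independent `X` with law `m` and `Y` with law `m'`. -/
def prodLaw (m m' : Measure ℝ) : Measure ℝ := (m.prod m').map (fun z => z.1 * z.2)

/-- Law of `X ^ a`, where `X` has law `m`. -/
def powLaw (a : ℝ) (m : Measure ℝ) : Measure ℝ := m.map (fun x => x ^ a)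

/-- Law of `G * X`, where `G` is Gamma(`θ`) with scale `1` and `X` is independent with law `m`. -/
def gammaMixture (θ : ℝ) (m : Measure ℝ) : Measure ℝ := prodLaw (gammaMeasure θ 1) m

/-- The class GGC(`θ`,`ν`), as the set of laws with the Laplace transform `exp (-θ ϑ(l))`
(the set has at most one element). -/
def GGC (θ : ℝ) (ν : Measure ℝ) : Set (Measure ℝ) :=
  {m | IsThorin ν ∧ IsNonnegLaw m ∧
    ∀ l : ℝ, 0 < l → ∫ x, Real.exp (-(l * x)) ∂m = Real.exp (-(θ * thorinExponent ν l))}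

/-- The law of the unilateral `α`-stable variable `S_α`, with Laplace transform `exp (-l ^ α)`. -/
def stableLaw (α : ℝ) : Set (Measure ℝ) :=
  {m | IsNonnegLaw m ∧ ∀ l : ℝ, 0 < l → ∫ x, Real.exp (-(l * x)) ∂m = Real.exp (-(l ^ α))}

/-- Exponential tilting: the law of `b W` where `W` has law `m` reweighted by `exp (-c w)`. If `m`
has density `f`, its density is `exp (-(c/b) w) b⁻¹ f(w/b) / E[exp (-c W)]`. -/
def expTilt (b c : ℝ) (m : Measure ℝ) : Measure ℝ :=
  (m.tilted (fun x => -(c * x))).map (fun x => b * x)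

/-- The class `GGC_α^{(b,c)}(θ,ν)`: the exponentially tilted law of `Z ^ (1/α) * S_α`, where
`Z` is GGC(`θ`,`ν`) and independent of the `α`-stable variable `S_α`. -/
def stableGGC (b c α θ : ℝ) (ν : Measure ℝ) : Set (Measure ℝ) :=
  {m | ∃ Z ∈ GGC θ ν, ∃ S ∈ stableLaw α, m = expTilt b c (prodLaw (powLaw (1 / α) Z) S)}

/-- The law of the mean functional `M_θ(ν)`, characterized by its Cauchy-Stieltjes transform of
order `θ`: `E[(1 + l M)^(-θ)] = exp (-θ ϑ(l))` (the set has at most one element). -/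
def meanLaw (θ : ℝ) (ν : Measure ℝ) : Set (Measure ℝ) :=
  {m | IsThorin ν ∧ IsNonnegLaw m ∧
    ∀ l : ℝ, 0 < l → ∫ x, (1 + l * x) ^ (-θ) ∂m = Real.exp (-(θ * thorinExponent ν l))}

/-- The law with density
`sin (π α) / π * y^(α-1) / (y^(2α) + 2 y^α cos (π α) + 1)` on `(0,∞)`. -/
def rho (α : ℝ) : Measure ℝ :=
  (volume.restrict (Ioi 0)).withDensity fun y =>
    ENNReal.ofReal (Real.sin (Real.pi * α) / Real.pi *
      (y ^ (α - 1) / (y ^ (2 * α) + 2 * y ^ α * Real.cos (Real.pi * α) + 1)))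

/-- The measure with density
`sin (π α) / π * ∫ x^(α-1) r / (x^(2α) + 2 x^α r cos (π α) + r^2) ν(dr)` on `(0,∞)`. -/
def rhoMixed (α : ℝ) (ν : Measure ℝ) : Measure ℝ :=
  (volume.restrict (Ioi 0)).withDensity fun x =>
    ∫⁻ r, ENNReal.ofReal (Real.sin (Real.pi * α) / Real.pi *
      (x ^ (α - 1) * r / (x ^ (2 * α) + 2 * x ^ α * r * Real.cos (Real.pi * α) + r ^ 2))) ∂ν

/-- Lamperti's density on `(0,1)` with skewness `p`: the density of the time spent positive up to
time `1` by a `p`-skew Bessel process of dimension `2 - 2α`. -/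
def lampertiDensity (α p x : ℝ) : ℝ :=
  p * (1 - p) * Real.sin (Real.pi * α) * x ^ (α - 1) * (1 - x) ^ (α - 1) /
    (Real.pi * ((1 - p) ^ 2 * x ^ (2 * α) + p ^ 2 * (1 - x) ^ (2 * α)
      + 2 * p * (1 - p) * x ^ α * (1 - x) ^ α * Real.cos (Real.pi * α)))

/-- `Λ_{α,ν}(dx) = ∫ Λ_{α,p(r)}(dx) ν(dr)`, where `Λ_{α,p}` is Lamperti's law and
`p(r) = r / (1 + r)`. -/
def lampertiMixed (α : ℝ) (ν : Measure ℝ) : Measure ℝ :=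
  (volume.restrict (Ioo 0 1)).withDensity fun x =>
    ∫⁻ r, ENNReal.ofReal (lampertiDensity α (r / (1 + r)) x) ∂ν

/-- Gamma tilt of order `θ` and parameter `c`: the law of `Y_{θ,c}`, i.e. the law of
`Y = c M / (c M + 1)`, with `M` of law `m`, reweighted by `(1 - y)^θ / E[(1 + c M)^(-θ)]`. -/
def gammaTilt (θ c : ℝ) (m : Measure ℝ) : Measure ℝ :=
  (m.map fun x => c * x / (c * x + 1)).withDensity fun y =>
    ENNReal.ofReal ((1 - y) ^ θ / ∫ x, (1 + c * x) ^ (-θ) ∂m)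

/-- The law of the stick-breaking fractions `V 0, V 1, …` of the Poisson-Dirichlet law with
parameters `(α,τ)`: independent, `V k` being Beta(`1 - α`, `τ + (k + 1) α`). -/
def stickFractions (α τ : ℝ) : Measure (ℕ → ℝ) :=
  Measure.infinitePi fun k : ℕ => betaMeasure (1 - α) (τ + (k + 1) * α)

/-- The `k`-th stick-breaking weight `V k * ∏ j < k, (1 - V j)`. Under `stickFractions α τ` the
sequence of weights is the PD(`α`,`τ`) sequence in size-biased order. -/
def stickWeight (v : ℕ → ℝ) (k : ℕ) : ℝ := v k * ∏ j ∈ Finset.range k, (1 - v j)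

/-- The law of the mean `∫ x P(dx) = ∑ P_k W_k` of a Dirichlet process `P` with shape `θ H`: the
weights `P_k` are PD(`0`,`θ`), and the `W_k` are independent of them and iid with law `H`. -/
def dirichletMean (θ : ℝ) (H : Measure ℝ) : Measure ℝ :=
  ((stickFractions 0 θ).prod (Measure.infinitePi fun _ : ℕ => H)).map fun ω =>
    (∑' k, ENNReal.ofReal (stickWeight ω.1 k * ω.2 k)).toReal

/-- The law of the occupation time `A^{(α,τ)}_{α,ξ}` of the randomly skewed generalized Bessel
bridge, where the skewness `ξ` has law `Q`. Given `ξ = p` it is the law of `P(C) = ∑ P_k 1(U_k ∈ C)`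
for the PD(`α`,`τ`) random probability measure `P = ∑ P_k δ_{U_k}` and a set `C` of probability
`p`; here the `U_k` are iid uniform on `[0,1]`, independent of the weights, and `C = [0,p]`. -/
def skewedOccupation (α τ : ℝ) (Q : Measure ℝ) : Measure ℝ :=
  (Q.prod ((stickFractions α τ).prod
    (Measure.infinitePi fun _ : ℕ => (volume : Measure ℝ).restrict (Icc 0 1)))).map fun ω =>
    (∑' k, ENNReal.ofReal (stickWeight ω.2.1 k * (if ω.2.2 k ≤ ω.1 then 1 else 0))).toReal

end GGCalculus

end

open Filter Topology

namespace GGCalculus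

/-! All the laws involved are determined by a transform: the Laplace transform for GGC laws, the
Stieltjes transform of order `τ` for the laws of mean functionals. Every identity therefore reduces
to a comparison of exponents, together with existence of the laws.

Two formulas carry the exponents. First, `logT_rho` gives `α ϑ_ρ(l) = log (1 + l ^ α)`, and mixing
over dilations by `r ^ (1/α)` gives `α ϑ_{ρ,ν}(l) = ϑ_ν(l ^ α)` (`logT_rhoMixed`). This is the
effect of subordinating to a stable variable. Second, `Λ_{α,ν}` is the image of `ϱ_{α,ν}` under `x ↦
x / (1 + x)`, and `(1 + x) (1 + l x / (1 + x)) = 1 + (1 + l) x`, so `ϑ_Λ(l) = ϑ_{ρ,ν}(1 + l) -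
ϑ_{ρ,ν}(1)` (`logT_lampertiMixed_add`). Exponential tilting of a Laplace transform and gamma tilting
of a Stieltjes transform produce exactly this shift. The formula for `rho` itself comes from a
contour integral in a strip (`lintegral_logRho`).

Existence rests on stick-breaking means. Feynman's parametrization peels off the first stick and
relates the transform at level `τ` to the one at level `τ + α` through an integral operator
(`stickTransform_eq_hardyOp`). A comparison principle shows that suitably bounded solutions of this
chain of equations are unique, so a closed form only has to be checked through an ODE. Taking `α =
0` gives the Cifarelli-Regazzini identity for Dirichlet means; a two-point base law gives the
transform of the occupation time. Means yield GGC laws by gamma randomization when `ν` is finite,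
general GGC laws follow by countable convolution, and the stable law is the GGC law of a power
measure.

The criterion `ν((0,∞)) ≤ 1` has two halves: a mass deficit can be placed at `0` without changing
the exponent, and monotonicity of `l ^ θ (1 + l M) ^ (-θ)` in `l` bounds the growth of `ϑ_ν`, hence
the mass. -/

/-- Laplace transform as a lower integral. -/
noncomputable def lap (m : Measure ℝ) (l : ℝ) : ℝ≥0∞ := ∫⁻ x, ENNReal.ofReal (Real.exp (-(l * x))) ∂m

/-- Cauchy-Stieltjes transform of order `θ` as a lower integral. -/
noncomputable def sti (θ : ℝ) (m : Measure ℝ) (l : ℝ) : ℝ≥0∞ := ∫⁻ x, ENNReal.ofReal ((1 + l * x) ^ (-θ)) ∂m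

/-- Thorin exponent as a lower integral. -/
noncomputable def logT (ν : Measure ℝ) (l : ℝ) : ℝ≥0∞ := ∫⁻ x, ENNReal.ofReal (Real.log (1 + l * x)) ∂ν

/-! ### Uniqueness of Laplace and Stieltjes transforms -/

lemma ae_nonneg_of_Iio {m : Measure ℝ} (h : m (Iio 0) = 0) : ∀ᵐ x ∂m, 0 ≤ x := by
  rw [ae_iff]; simpa [Iio] using h

lemma ae_pos_of_Iic {m : Measure ℝ} (h : m (Iic 0) = 0) : ∀ᵐ x ∂m, 0 < x := by
  rw [ae_iff]; simpa [Iic] using h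

lemma measure_Iio_of_ae_nonneg {m : Measure ℝ} (h : ∀ᵐ x ∂m, 0 ≤ x) : m (Iio 0) = 0 := by
  rw [ae_iff] at h; simpa [Iio] using h

lemma measure_Iic_of_ae_pos {m : Measure ℝ} (h : ∀ᵐ x ∂m, 0 < x) : m (Iic 0) = 0 := by
  rw [ae_iff] at h; simpa [Iic] using h

/-- Finite measures on `[0,1]` with the same moments are equal. -/
lemma unitInterval_ext_of_moments {μ μ' : Measure unitInterval} [IsFiniteMeasure μ]
    [IsFiniteMeasure μ']
    (h : ∀ n : ℕ, ∫ x, (x : ℝ) ^ n ∂μ = ∫ x, (x : ℝ) ^ n ∂μ') : μ = μ' := by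
  have hint : ∀ (ρ : Measure unitInterval) [IsFiniteMeasure ρ] (f : C(unitInterval, ℝ)),
      Integrable f ρ := fun ρ _ f =>
    f.continuous.integrable_of_hasCompactSupport (HasCompactSupport.of_compactSpace _)
  -- The integral is Lipschitz in the sup norm, with constant the total mass, so agreement on
  -- polynomials passes to their closure, which is everything by Weierstrass.
  have hcont : ∀ (ρ : Measure unitInterval) [IsFiniteMeasure ρ],
      Continuous (fun f : C(unitInterval, ℝ) => ∫ x, f x ∂ρ) := by
    intro ρ _
    refine (LipschitzWith.of_dist_le_mul (K := (ρ univ).toNNReal) fun f g => ?_).continuous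
    rw [dist_eq_norm, ← integral_sub (hint ρ f) (hint ρ g)]
    refine (norm_integral_le_of_norm_le_const (C := dist f g) (ae_of_all _ fun x => ?_)).trans ?_
    · rw [← dist_eq_norm]; exact ContinuousMap.dist_apply_le_dist x
    · rw [mul_comm]; rfl
  have hall : ∀ f : C(unitInterval, ℝ), ∫ x, f x ∂μ = ∫ x, f x ∂μ' := by
    have hcl : IsClosed {f : C(unitInterval, ℝ) | ∫ x, f x ∂μ = ∫ x, f x ∂μ'} :=
      isClosed_eq (hcont μ) (hcont μ')
    have hsub : (polynomialFunctions unitInterval : Set C(unitInterval, ℝ)) ⊆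
        {f : C(unitInterval, ℝ) | ∫ x, f x ∂μ = ∫ x, f x ∂μ'} := by
      intro f hf
      obtain ⟨p, -, rfl⟩ := hf
      simp only [mem_ofPred_eq]
      have hp : ∀ (ρ : Measure unitInterval) [IsFiniteMeasure ρ],
          ∫ x, (Polynomial.toContinuousMapOnAlgHom unitInterval p) x ∂ρ
            = ∑ i ∈ Finset.range (p.natDegree + 1), p.coeff i * ∫ x, (x : ℝ) ^ i ∂ρ := by
        intro ρ _
        have : ∀ x : unitInterval, (Polynomial.toContinuousMapOnAlgHom unitInterval p) x
            = ∑ i ∈ Finset.range (p.natDegree + 1), p.coeff i * (x : ℝ) ^ i := by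
          intro x
          simp [Polynomial.eval_eq_sum_range]
        simp_rw [this]
        rw [integral_finsetSum]
        · simp_rw [integral_const_mul]
        · intro i _
          exact hint ρ ⟨fun x => p.coeff i * (x : ℝ) ^ i, by fun_prop⟩
      have h1 := hp μ
      have h2 := hp μ'
      simp_rw [h] at h1
      exact h1.trans h2.symm
    have htop := polynomialFunctions_closure_eq_top (0 : ℝ) 1
    intro f
    have hf : f ∈ closure (polynomialFunctions unitInterval : Set C(unitInterval, ℝ)) := by
      have : f ∈ (polynomialFunctions unitInterval).topologicalClosure := by
        rw [show (polynomialFunctions unitInterval).topologicalClosure = ⊤ from htop]; trivial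
      exact this
    exact hcl.closure_subset_iff.2 hsub hf
  refine ext_of_forall_integral_eq_of_IsFiniteMeasure fun f => ?_
  exact hall f.toContinuousMap

/-- A finite measure on `[0,∞)` is determined by its Laplace transform. -/
lemma eq_of_lap_eq {μ μ' : Measure ℝ} [IsFiniteMeasure μ] [IsFiniteMeasure μ']
    (h0 : μ (Iio 0) = 0) (h0' : μ' (Iio 0) = 0) (h : ∀ l, 0 < l → lap μ l = lap μ' l) :
    μ = μ' := by
  -- Under `x ↦ exp (-x)` the Laplace transform at `n` becomes the `n`-th moment on `[0,1]`. The
  -- projection only acts on negative `x`, a null set.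
  let e : ℝ → unitInterval := fun x => projIcc 0 1 zero_le_one (Real.exp (-x))
  have he : Measurable e := by
    refine (continuous_projIcc.comp ?_).measurable
    fun_prop
  let g : unitInterval → ℝ := fun y => -Real.log y
  have hg : Measurable g := by
    exact (Real.measurable_log.comp measurable_subtype_coe).neg
  have hev : ∀ x : ℝ, 0 ≤ x → ((e x : unitInterval) : ℝ) = Real.exp (-x) := by
    intro x hx
    have : Real.exp (-x) ∈ Icc (0 : ℝ) 1 := ⟨(Real.exp_pos _).le, by simpa using hx⟩
    simp [e, projIcc_of_mem zero_le_one this]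
  have hge : ∀ x : ℝ, 0 ≤ x → g (e x) = x := fun x hx => by simp [g, hev x hx]
  have back : ∀ ρ : Measure ℝ, ρ (Iio 0) = 0 → (ρ.map e).map g = ρ := by
    intro ρ hρ
    rw [Measure.map_map hg he]
    conv_rhs => rw [← Measure.map_id (μ := ρ)]
    refine Measure.map_congr ?_
    filter_upwards [ae_nonneg_of_Iio hρ] with x hx using hge x hx
  have hpos : ∀ (ρ : Measure ℝ), ρ (Iio 0) = 0 → ∀ n : ℕ,
      ∫ x, (x : ℝ) ^ n ∂(ρ.map e) = (lap ρ n).toReal := by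
    intro ρ hρ n
    rw [integral_map he.aemeasurable (by fun_prop), lap,
      integral_eq_lintegral_of_nonneg_ae
        (ae_of_all _ fun x => pow_nonneg (e x).2.1 n) (by fun_prop)]
    congr 1
    refine lintegral_congr_ae ?_
    filter_upwards [ae_nonneg_of_Iio hρ] with x hx
    rw [hev x hx, ← Real.exp_nat_mul]
    ring_nf
  -- The zeroth moment is the total mass, the transform at `l = 0`, which the hypothesis does not
  -- cover; it is the monotone limit along `l = 1 / (n + 1)`.
  have hzero : lap μ 0 = lap μ' 0 := by
    have key : ∀ (ρ : Measure ℝ), ρ (Iio 0) = 0 →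
        Tendsto (fun n : ℕ => lap ρ (1 / (n + 1 : ℝ))) atTop (𝓝 (lap ρ 0)) := by
      intro ρ hρ
      refine lintegral_tendsto_of_tendsto_of_monotone (fun n => by fun_prop) ?_ ?_
      · filter_upwards [ae_nonneg_of_Iio hρ] with x hx
        intro a b hab
        refine ENNReal.ofReal_le_ofReal (Real.exp_le_exp.2 (neg_le_neg ?_))
        exact mul_le_mul_of_nonneg_right (one_div_le_one_div_of_le (by positivity)
          (by exact_mod_cast Nat.succ_le_succ hab)) hx
      · refine ae_of_all _ fun x => ?_
        refine ENNReal.tendsto_ofReal ?_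
        have h1 : Tendsto (fun n : ℕ => 1 / ((n : ℝ) + 1)) atTop (𝓝 0) :=
          tendsto_one_div_add_atTop_nhds_zero_nat
        exact (Real.continuous_exp.tendsto _).comp ((h1.mul_const x).neg)
    refine tendsto_nhds_unique (key μ h0) ?_
    refine (key μ' h0').congr fun n => (h _ (by positivity)).symm
  have := unitInterval_ext_of_moments (μ := μ.map e) (μ' := μ'.map e) fun n => by
    rw [hpos μ h0, hpos μ' h0']
    rcases Nat.eq_zero_or_pos n with rfl | hn
    · simpa using congrArg ENNReal.toReal hzero
    · rw [h n (by exact_mod_cast hn)]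
  rw [← back μ h0, ← back μ' h0', this]

lemma gammaMeasure_ae_pos (a : ℝ) : ∀ᵐ x ∂(gammaMeasure a 1), 0 < x := by
  rw [gammaMeasure]
  rw [ae_withDensity_iff (by exact (measurable_gammaPDFReal a 1).ennreal_ofReal)]
  have : ∀ᵐ x : ℝ, x ≠ 0 := by simp [ae_iff]
  filter_upwards [this] with x hx h
  by_contra hx'
  exact h (gammaPDF_of_neg (lt_of_le_of_ne (not_lt.1 hx') hx))

lemma gammaMeasure_eq_withDensity (a : ℝ) : gammaMeasure a 1 =
    (volume.restrict (Ioi 0)).withDensity fun x =>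
      ENNReal.ofReal (1 / Real.Gamma a * x ^ (a - 1) * Real.exp (-x)) := by
  rw [gammaMeasure, ← withDensity_indicator measurableSet_Ioi]
  refine withDensity_congr_ae ?_
  have : ∀ᵐ x : ℝ, x ≠ 0 := by simp [ae_iff]
  filter_upwards [this] with x hx
  rcases lt_or_gt_of_ne hx with h | h
  · rw [gammaPDF_of_neg h, indicator_of_notMem (by simpa using h.le)]
  · rw [gammaPDF_of_nonneg h.le, indicator_of_mem (by simpa using h)]
    simp

lemma lap_gammaMeasure {a : ℝ} (ha : 0 < a) {l : ℝ} (hl : -1 < l) :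
    lap (gammaMeasure a 1) l = ENNReal.ofReal ((1 + l) ^ (-a)) := by
  have hl' : 0 < 1 + l := by linarith
  rw [lap, gammaMeasure_eq_withDensity, lintegral_withDensity_eq_lintegral_mul _ (by fun_prop)
    (by fun_prop)]
  have : ∀ x ∈ Ioi (0 : ℝ), ((fun x => ENNReal.ofReal (1 / Real.Gamma a * x ^ (a - 1) *
      Real.exp (-x))) * fun x => ENNReal.ofReal (Real.exp (-(l * x)))) x
      = ENNReal.ofReal (1 / Real.Gamma a * (x ^ (a - 1) * Real.exp (-((1 + l) * x)))) := by
    intro x hx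
    have hG := Real.Gamma_pos_of_pos ha
    have hx' : (0 : ℝ) < x := hx
    rw [Pi.mul_apply, ← ENNReal.ofReal_mul (by positivity), mul_assoc, mul_assoc,
      ← Real.exp_add]
    ring_nf
  rw [setLIntegral_congr_fun measurableSet_Ioi this]
  have hG := Real.Gamma_pos_of_pos ha
  rw [← ofReal_integral_eq_lintegral_ofReal]
  · rw [integral_const_mul, Real.integral_rpow_mul_exp_neg_mul_Ioi ha hl']
    congr 1
    rw [Real.rpow_neg hl'.le, Real.div_rpow zero_le_one hl'.le, Real.one_rpow]
    field_simp
  · refine Integrable.const_mul ?_ _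
    have h0 := Real.integral_rpow_mul_exp_neg_mul_Ioi ha hl'
    -- Without integrability the Bochner integral would be `0`, whereas the known value is positive.
    by_contra hcon
    rw [integral_undef hcon] at h0
    have : 0 < (1 / (1 + l)) ^ a * Real.Gamma a := by positivity
    linarith
  · refine (ae_restrict_iff' measurableSet_Ioi).2 (ae_of_all _ fun x hx => ?_)
    have hx' : (0 : ℝ) < x := hx
    show 0 ≤ _
    positivity

lemma lap_le {m : Measure ℝ} (h0 : m (Iio 0) = 0) {l : ℝ} (hl : 0 ≤ l) : lap m l ≤ m univ := by
  rw [lap, ← setLIntegral_one, Measure.restrict_univ]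
  refine lintegral_mono_ae ?_
  filter_upwards [ae_nonneg_of_Iio h0] with x hx
  rw [← ENNReal.ofReal_one]
  exact ENNReal.ofReal_le_ofReal (by simpa using mul_nonneg hl hx)

@[fun_prop]
lemma measurable_lap (m : Measure ℝ) [SFinite m] : Measurable (lap m) := by
  unfold lap
  exact Measurable.lintegral_prod_right' (f := fun z : ℝ × ℝ =>
    ENNReal.ofReal (Real.exp (-(z.1 * z.2)))) (by fun_prop)

/-- Gamma randomization turns Laplace transforms into Stieltjes transforms. -/
lemma lintegral_lap_gamma {a : ℝ} (ha : 0 < a) (m : Measure ℝ) [SFinite m] (h0 : m (Iio 0) = 0)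
    {l : ℝ} (hl : 0 ≤ l) : ∫⁻ g, lap m (l * g) ∂(gammaMeasure a 1) = sti a m l := by
  have := isProbabilityMeasure_gammaMeasure ha one_pos
  unfold lap sti
  rw [lintegral_lintegral_swap (by fun_prop)]
  refine lintegral_congr_ae ?_
  filter_upwards [ae_nonneg_of_Iio h0] with x hx
  have := lap_gammaMeasure ha (l := l * x) (by nlinarith [mul_nonneg hl hx])
  rw [← this, lap]
  refine lintegral_congr fun g => ?_
  ring_nf

lemma continuousOn_lap {m : Measure ℝ} [IsFiniteMeasure m] (h0 : m (Iio 0) = 0) :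
    ContinuousOn (fun l => (lap m l).toReal) (Ioi 0) := by
  have : ∀ l ∈ Ioi (0 : ℝ), (lap m l).toReal = ∫ x, Real.exp (-(l * x)) ∂m := fun l _ => by
    rw [integral_eq_lintegral_of_nonneg_ae (ae_of_all _ fun x => (Real.exp_pos _).le)
      (by fun_prop), lap]
  refine ContinuousOn.congr ?_ this
  refine continuousOn_of_dominated (bound := fun _ => 1) (fun l _ => by fun_prop) ?_
    (integrable_const _) (ae_of_all _ fun x => by fun_prop)
  intro l hl
  filter_upwards [ae_nonneg_of_Iio h0] with x hx
  rw [Real.norm_of_nonneg (Real.exp_pos _).le]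
  simpa using mul_nonneg (le_of_lt hl) hx

/-- A finite measure on `[0,∞)` is determined by its Stieltjes transform of order `a`. -/
lemma eq_of_sti_eq {a : ℝ} (ha : 0 < a) {μ μ' : Measure ℝ} [IsFiniteMeasure μ]
    [IsFiniteMeasure μ'] (h0 : μ (Iio 0) = 0) (h0' : μ' (Iio 0) = 0)
    (h : ∀ l, 0 < l → sti a μ l = sti a μ' l) : μ = μ' := by
  have := isProbabilityMeasure_gammaMeasure ha one_pos
  refine eq_of_lap_eq h0 h0' ?_
  -- Weighting the gamma law by `lap m` gives a finite measure whose Laplace transform at `l` is `(1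
  -- + l) ^ (-a)` times the Stieltjes transform of `m` at `1 / (1 + l)`. Laplace uniqueness for `D`
  -- then identifies the densities.
  let D : Measure ℝ → Measure ℝ := fun m => (gammaMeasure a 1).withDensity (lap m)
  have hfin : ∀ (m : Measure ℝ) [IsFiniteMeasure m], m (Iio 0) = 0 →
      ∫⁻ g, lap m g ∂(gammaMeasure a 1) ≠ ∞ := by
    intro m _ hm
    refine ne_of_lt (lt_of_le_of_lt (lintegral_mono_ae (g := fun _ => m univ) ?_) ?_)
    · filter_upwards [gammaMeasure_ae_pos a] with x hx using lap_le hm hx.le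
    · simp
  have hDfin : ∀ (m : Measure ℝ) [IsFiniteMeasure m], m (Iio 0) = 0 → IsFiniteMeasure (D m) :=
    fun m _ hm => isFiniteMeasure_withDensity (hfin m hm)
  have hD0 : ∀ (m : Measure ℝ), (D m) (Iio 0) = 0 := fun m =>
    withDensity_absolutelyContinuous _ _ (measure_Iio_of_ae_nonneg
      ((gammaMeasure_ae_pos a).mono fun x hx => hx.le))
  have hDlap : ∀ (m : Measure ℝ) [IsFiniteMeasure m], m (Iio 0) = 0 → ∀ l, 0 < l →
      lap (D m) l = ENNReal.ofReal ((1 + l) ^ (-a)) * sti a m (1 / (1 + l)) := by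
    intro m _ hm l hl
    have hl' : 0 < 1 + l := by linarith
    rw [lap, lintegral_withDensity_eq_lintegral_mul _ (by fun_prop) (by fun_prop)]
    simp only [Pi.mul_apply]
    have hmul : ∀ g, lap m g * ENNReal.ofReal (Real.exp (-(l * g))) =
        ∫⁻ x, ENNReal.ofReal (Real.exp (-(g * x))) * ENNReal.ofReal (Real.exp (-(l * g))) ∂m :=
      fun g => by rw [lap, lintegral_mul_const _ (by fun_prop)]
    simp_rw [hmul]
    rw [lintegral_lintegral_swap (by fun_prop), sti, ← lintegral_const_mul _ (by fun_prop)]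
    refine lintegral_congr_ae ?_
    filter_upwards [ae_nonneg_of_Iio hm] with x hx
    rw [← ENNReal.ofReal_mul (by positivity), ← Real.mul_rpow (by positivity) (by positivity)]
    have := lap_gammaMeasure ha (l := l + x) (by linarith)
    rw [show (1 + l) * (1 + 1 / (1 + l) * x) = 1 + (l + x) by field_simp; ring, ← this, lap]
    refine lintegral_congr fun g => ?_
    rw [← ENNReal.ofReal_mul (Real.exp_pos _).le, ← Real.exp_add]
    ring_nf
  have := hDfin μ h0
  have := hDfin μ' h0'
  have hDeq : D μ = D μ' := eq_of_lap_eq (hD0 μ) (hD0 μ') fun l hl => by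
    rw [hDlap μ h0 l hl, hDlap μ' h0' l hl, h _ (by positivity)]
  have hae : lap μ =ᵐ[gammaMeasure a 1] lap μ' :=
    (withDensity_eq_iff (by fun_prop) (by fun_prop) (hfin μ h0)).1 hDeq
  -- The gamma density is positive on `(0,∞)`, so gamma-a.e. equality is Lebesgue-a.e. equality
  -- there, and continuity turns it into equality everywhere.
  have hae' : (fun l => (lap μ l).toReal) =ᵐ[volume.restrict (Ioi 0)]
      fun l => (lap μ' l).toReal := by
    rw [gammaMeasure_eq_withDensity, EventuallyEq, ae_withDensity_iff (by fun_prop)] at hae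
    filter_upwards [hae, self_mem_ae_restrict measurableSet_Ioi] with x hx hx0
    have hx0' : (0 : ℝ) < x := hx0
    have hG := Real.Gamma_pos_of_pos ha
    rw [hx (by rw [ne_eq, ENNReal.ofReal_eq_zero, not_le]; positivity)]
  have heq := Measure.eqOn_open_of_ae_eq hae' isOpen_Ioi (continuousOn_lap h0)
    (continuousOn_lap h0')
  intro l hl
  have := heq hl
  exact (ENNReal.toReal_eq_toReal_iff' (ne_top_of_le_ne_top (measure_ne_top _ _) (lap_le h0 hl.le))
    (ne_top_of_le_ne_top (measure_ne_top _ _) (lap_le h0' hl.le))).1 this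

/-! ### The Beta integral behind stick-breaking -/

/-- For a nonnegative derivative integrability is automatic, so singularities such as `t ^ (τ - 1)`
at the endpoint `0` need no separate treatment. -/
lemma lintegral_deriv_Ioc {g g' : ℝ → ℝ} {a b : ℝ} (hab : a ≤ b) (hc : ContinuousOn g (Icc a b))
    (hd : ∀ x ∈ Ioo a b, HasDerivAt g (g' x) x) (hn : ∀ x ∈ Ioo a b, 0 ≤ g' x) :
    ∫⁻ x in Ioc a b, ENNReal.ofReal (g' x) = ENNReal.ofReal (g b - g a) := by
  have hi : IntegrableOn g' (Ioc a b) :=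
    intervalIntegral.integrableOn_deriv_of_nonneg hc hd hn
  rw [setLIntegral_congr Ioo_ae_eq_Ioc.symm, ← ofReal_integral_eq_lintegral_ofReal
    (hi.mono_set Ioo_subset_Ioc_self)
    ((ae_restrict_iff' measurableSet_Ioo).2 (ae_of_all _ hn)),
    ← integral_Ioc_eq_integral_Ioo, ← intervalIntegral.integral_of_le hab,
    intervalIntegral.integral_eq_sub_of_hasDerivAt_of_le hab hc hd
      ((intervalIntegrable_iff_integrableOn_Ioc_of_le hab).2 hi)]

lemma betaMeasure_eq_withDensity (a b : ℝ) : betaMeasure a b =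
    (volume.restrict (Ioo 0 1)).withDensity fun x =>
      ENNReal.ofReal (1 / beta a b * x ^ (a - 1) * (1 - x) ^ (b - 1)) := by
  rw [betaMeasure, ← withDensity_indicator measurableSet_Ioo]
  refine withDensity_congr_ae (ae_of_all _ fun x => ?_)
  rw [betaPDF_eq]
  by_cases hx : x ∈ Ioo (0 : ℝ) 1
  · rw [indicator_of_mem hx, if_pos (show 0 < x ∧ x < 1 from hx)]
  · rw [indicator_of_notMem hx, if_neg (show ¬ (0 < x ∧ x < 1) from hx), ENNReal.ofReal_zero]

lemma betaMeasure_ae_mem (a b : ℝ) : ∀ᵐ x ∂(betaMeasure a b), x ∈ Ioo (0 : ℝ) 1 := by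
  rw [betaMeasure_eq_withDensity]
  exact (withDensity_absolutelyContinuous _ _).ae_le (self_mem_ae_restrict measurableSet_Ioo)

/-- Feynman's parametrization. -/
lemma lintegral_beta_segment {a b u w : ℝ} (ha : 0 < a) (hb : 0 < b) (hu : 0 < u) (hw : 0 < w) :
    ∫⁻ v, ENNReal.ofReal ((v * u + (1 - v) * w) ^ (-(a + b))) ∂(betaMeasure a b)
      = ENNReal.ofReal (u ^ (-a) * w ^ (-b)) := by
  have hB := beta_pos ha hb
  let D : ℝ → ℝ := fun v => v * u + (1 - v) * w
  -- The map `v ↦ v u / (v u + (1 - v) w)` is a bijection of `(0,1)`. Pulling the normalization of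
  -- the Beta density back through it produces the integrand, up to the factor `u ^ (-a) * w ^
  -- (-b)`.
  let f : ℝ → ℝ := fun v => v * u / D v
  have hD : ∀ v ∈ Ioo (0 : ℝ) 1, 0 < D v := fun v hv =>
    add_pos (mul_pos hv.1 hu) (mul_pos (by linarith [hv.2]) hw)
  have h1f : ∀ v ∈ Ioo (0 : ℝ) 1, 1 - f v = (1 - v) * w / D v := fun v hv => by
    have := (hD v hv).ne'
    simp only [f]; field_simp; simp only [D]; ring
  have hf' : ∀ v ∈ Ioo (0 : ℝ) 1, HasDerivWithinAt f (u * w / D v ^ 2) (Ioo 0 1) v := by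
    intro v hv
    have h1 : HasDerivAt (fun v : ℝ => v * u) u v := by
      simpa using (hasDerivAt_id v).mul_const u
    have h2 : HasDerivAt D (u - w) v := by
      exact (h1.add (((hasDerivAt_id v).const_sub 1).mul_const w)).congr_deriv (by ring)
    have h3 := h1.div h2 (hD v hv).ne'
    refine (h3.congr_deriv ?_).hasDerivWithinAt
    congr 1
    simp only [D]; ring
  have hinj : InjOn f (Ioo 0 1) := by
    intro x hx y hy hxy
    simp only [f] at hxy
    rw [div_eq_div_iff (hD x hx).ne' (hD y hy).ne'] at hxy
    have : u * w * (x - y) = 0 := by simp only [D] at hxy; linarith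
    have h0 : u * w ≠ 0 := by positivity
    have := (mul_eq_zero.1 this).resolve_left h0
    linarith
  have himg : f '' (Ioo 0 1) = Ioo 0 1 := by
    ext t
    constructor
    · rintro ⟨v, hv, rfl⟩
      refine ⟨div_pos (mul_pos hv.1 hu) (hD v hv), ?_⟩
      have := h1f v hv
      have h2 : 0 < (1 - v) * w / D v := div_pos (mul_pos (by linarith [hv.2]) hw) (hD v hv)
      linarith
    · intro ht
      have h1t : 0 < 1 - t := by linarith [ht.2]
      have ht0 := ht.1
      have hE : 0 < t * w + (1 - t) * u := by positivity
      refine ⟨t * w / (t * w + (1 - t) * u), ⟨by positivity, ?_⟩, ?_⟩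
      · rw [div_lt_one hE]
        nlinarith [mul_pos h1t hu]
      · simp only [f, D]
        have h2 : 1 - t * w / (t * w + (1 - t) * u) = (1 - t) * u / (t * w + (1 - t) * u) := by
          field_simp; ring
        rw [h2]
        have h3 : t * w / (t * w + (1 - t) * u) * u + (1 - t) * u / (t * w + (1 - t) * u) * w
          = u * w / (t * w + (1 - t) * u) := by field_simp; ring
        rw [h3]
        field_simp
  have hone : ∫⁻ t in Ioo (0 : ℝ) 1,
      ENNReal.ofReal (1 / beta a b * t ^ (a - 1) * (1 - t) ^ (b - 1)) = 1 := by
    rw [← lintegral_betaPDF, lintegral_betaPDF_eq_one ha hb]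
  rw [← himg, lintegral_image_eq_lintegral_abs_deriv_mul measurableSet_Ioo hf' hinj] at hone
  rw [betaMeasure_eq_withDensity, lintegral_withDensity_eq_lintegral_mul _ (by fun_prop)
    (by fun_prop)]
  rw [← mul_one (ENNReal.ofReal (u ^ (-a) * w ^ (-b))), ← hone,
    ← lintegral_const_mul' _ _ ENNReal.ofReal_ne_top]
  refine setLIntegral_congr_fun measurableSet_Ioo fun v hv => ?_
  have hDv := hD v hv
  have hv0 := hv.1
  have hv1 : 0 < 1 - v := by linarith [hv.2]
  rw [Pi.mul_apply, ← ENNReal.ofReal_mul (by positivity), ← ENNReal.ofReal_mul (by positivity),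
    ← ENNReal.ofReal_mul (by positivity), abs_of_pos (by positivity), h1f v hv]
  congr 1
  change _ * D v ^ _ = _
  simp only [f]
  rw [Real.div_rpow (by positivity) hDv.le, Real.div_rpow (by positivity) hDv.le,
    Real.mul_rpow hv0.le hu.le, Real.mul_rpow hv1.le hw.le]
  have e1 : u ^ (-a) * u * u ^ (a - 1) = 1 := by
    nth_rewrite 2 [← Real.rpow_one u]
    rw [← Real.rpow_add hu, ← Real.rpow_add hu]; simp
  have e2 : w ^ (-b) * w * w ^ (b - 1) = 1 := by
    nth_rewrite 2 [← Real.rpow_one w]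
    rw [← Real.rpow_add hw, ← Real.rpow_add hw]; simp
  have e3 : D v ^ (-(a + b)) * D v ^ (a - 1) * D v ^ (b - 1) * D v ^ 2 = 1 := by
    rw [← Real.rpow_natCast, ← Real.rpow_add hDv, ← Real.rpow_add hDv, ← Real.rpow_add hDv]
    convert Real.rpow_zero (D v) using 2
    push_cast; ring
  have hp1 := (Real.rpow_pos_of_pos hDv (a - 1)).ne'
  have hp2 := (Real.rpow_pos_of_pos hDv (b - 1)).ne'
  calc _ = 1 / beta a b * v ^ (a - 1) * (1 - v) ^ (b - 1) * D v ^ (-(a + b)) := rfl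
    _ = 1 / beta a b * v ^ (a - 1) * (1 - v) ^ (b - 1) *
        (1 / (D v ^ (a - 1) * D v ^ (b - 1) * D v ^ 2)) := by
          congr 1
          rw [eq_div_iff (by positivity)]
          linarith
    _ = (u ^ (-a) * u * u ^ (a - 1)) * (w ^ (-b) * w * w ^ (b - 1)) *
        (1 / beta a b * v ^ (a - 1) * (1 - v) ^ (b - 1) *
        (1 / (D v ^ (a - 1) * D v ^ (b - 1) * D v ^ 2))) := by rw [e1, e2]; ring
    _ = _ := by ring_nf

/-! ### Stick-breaking series and removal of the first stick -/

/-- Prepending a first term to a sequence. -/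
def consSeq (x : ℝ) (y : ℕ → ℝ) : ℕ → ℝ
  | 0 => x
  | n + 1 => y n

@[fun_prop]
lemma measurable_consSeq : Measurable fun z : ℝ × (ℕ → ℝ) => consSeq z.1 z.2 := by
  refine measurable_pi_iff.2 fun n => ?_
  cases n with
  | zero => exact measurable_fst
  | succ n => exact (measurable_pi_apply n).comp measurable_snd

lemma infinitePi_eq_map_consSeq (μ : ℕ → Measure ℝ) [∀ n, IsProbabilityMeasure (μ n)] :
    ((μ 0).prod (Measure.infinitePi fun n => μ (n + 1))).map (fun z => consSeq z.1 z.2)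
      = Measure.infinitePi μ := by
  refine Measure.eq_infinitePi _ fun s t ht => ?_
  classical
  -- The cylinder is extended by `univ` to an initial segment of coordinates, which splits into
  -- coordinate `0` and a shifted segment.
  set t' : ℕ → Set ℝ := fun i => if i ∈ s then t i else univ with ht'def
  have ht' : ∀ i, MeasurableSet (t' i) := fun i => by
    by_cases h : i ∈ s <;> simp [t', h, ht]
  set N := s.sup id + 1
  have hsN : ∀ i ∈ s, i < N := fun i hi => Nat.lt_succ_of_le (Finset.le_sup (f := id) hi)
  have hset : Set.pi (s : Set ℕ) t = Set.pi (Finset.range (N + 1) : Set ℕ) t' := by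
    ext x
    simp only [Set.mem_pi]
    constructor
    · intro h i _
      by_cases hi : i ∈ s
      · simpa [t', hi] using h i hi
      · simp [t', hi]
    · intro h i hi
      have := h i (by simpa using (hsN i hi).trans (Nat.lt_succ_self N))
      simpa [t', Finset.mem_coe.1 hi] using this
  have hprod : ∏ i ∈ s, μ i (t i) = ∏ i ∈ Finset.range (N + 1), μ i (t' i) := by
    rw [← Finset.prod_subset (s₁ := s) (s₂ := Finset.range (N + 1))]
    · exact Finset.prod_congr rfl fun i hi => by simp [t', hi]
    · intro i hi; simpa using (hsN i hi).trans (Nat.lt_succ_self N)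
    · intro i _ hi; simp [t', hi]
  rw [hset, hprod, Measure.map_apply measurable_consSeq (.pi (Finset.countable_toSet _)
    fun i _ => ht' i)]
  have hpre : (fun z : ℝ × (ℕ → ℝ) => consSeq z.1 z.2) ⁻¹'
      (Set.pi (Finset.range (N + 1) : Set ℕ) t') =
      t' 0 ×ˢ Set.pi (Finset.range N : Set ℕ) (fun i => t' (i + 1)) := by
    ext ⟨x, y⟩
    simp only [mem_preimage, Set.mem_pi, Finset.coe_range, mem_Iio, mem_prod]
    constructor
    · exact fun h => ⟨h 0 (Nat.succ_pos N), fun i hi => h (i + 1) (Nat.succ_lt_succ hi)⟩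
    · rintro ⟨h0, h1⟩ i hi
      cases i with
      | zero => exact h0
      | succ i => exact h1 i (Nat.lt_of_succ_lt_succ hi)
  rw [hpre, Measure.prod_prod, Measure.infinitePi_pi _ (fun i _ => ht' (i + 1)),
    Finset.prod_range_succ' _ N, mul_comm]

/-- The random series `∑ P_k W_k` with values in `[0,∞]`. -/
noncomputable def stickSum (v w : ℕ → ℝ) : ℝ≥0∞ := ∑' k, ENNReal.ofReal (stickWeight v k * w k)

@[fun_prop]
lemma measurable_stickWeight (k : ℕ) : Measurable fun v : ℕ → ℝ => stickWeight v k := by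
  unfold stickWeight; fun_prop

@[fun_prop]
lemma measurable_stickSum : Measurable fun z : (ℕ → ℝ) × (ℕ → ℝ) => stickSum z.1 z.2 := by
  unfold stickSum
  refine Measurable.tsum fun k => ?_
  have : Measurable fun z : (ℕ → ℝ) × (ℕ → ℝ) => stickWeight z.1 k :=
    (measurable_stickWeight k).comp measurable_fst
  fun_prop

lemma stickWeight_cons_zero (x : ℝ) (v : ℕ → ℝ) : stickWeight (consSeq x v) 0 = x := by
  simp [stickWeight, consSeq]

lemma stickWeight_cons_succ (x : ℝ) (v : ℕ → ℝ) (k : ℕ) :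
    stickWeight (consSeq x v) (k + 1) = (1 - x) * stickWeight v k := by
  simp only [stickWeight, Finset.prod_range_succ', consSeq]
  ring

/-- Self-similarity of stick-breaking: after the first stick of length `x`, what remains is a copy
of the series scaled by `1 - x`. -/
lemma stickSum_cons {x : ℝ} (hx : x ≤ 1) (v : ℕ → ℝ) (y : ℝ) (w : ℕ → ℝ) :
    stickSum (consSeq x v) (consSeq y w) =
      ENNReal.ofReal (x * y) + ENNReal.ofReal (1 - x) * stickSum v w := by
  unfold stickSum
  rw [tsum_eq_zero_add' ENNReal.summable, stickWeight_cons_zero, ← ENNReal.tsum_mul_left]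
  congr 1
  refine tsum_congr fun k => ?_
  rw [stickWeight_cons_succ, mul_assoc, ENNReal.ofReal_mul (by linarith)]
  rfl

lemma sum_stickWeight (v : ℕ → ℝ) (n : ℕ) :
    ∑ k ∈ Finset.range n, stickWeight v k = 1 - ∏ j ∈ Finset.range n, (1 - v j) := by
  induction n with
  | zero => simp
  | succ n ih => rw [Finset.sum_range_succ, ih, Finset.prod_range_succ, stickWeight]; ring

lemma stickWeight_nonneg {v : ℕ → ℝ} (hv : ∀ k, v k ∈ Icc (0 : ℝ) 1) (k : ℕ) :
    0 ≤ stickWeight v k :=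
  mul_nonneg (hv k).1 (Finset.prod_nonneg fun j _ => by linarith [(hv j).2])

lemma stickSum_le {v w : ℕ → ℝ} (hv : ∀ k, v k ∈ Icc (0 : ℝ) 1) {B : ℝ} (hB : 0 ≤ B)
    (hw : ∀ k, w k ≤ B) : stickSum v w ≤ ENNReal.ofReal B := by
  refine ENNReal.tsum_le_of_sum_range_le fun n => ?_
  calc ∑ k ∈ Finset.range n, ENNReal.ofReal (stickWeight v k * w k)
      ≤ ∑ k ∈ Finset.range n, ENNReal.ofReal (stickWeight v k * B) :=
        Finset.sum_le_sum fun k _ => ENNReal.ofReal_le_ofReal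
          (mul_le_mul_of_nonneg_left (hw k) (stickWeight_nonneg hv k))
    _ = ENNReal.ofReal (∑ k ∈ Finset.range n, stickWeight v k * B) :=
        (ENNReal.ofReal_sum_of_nonneg fun k _ => mul_nonneg (stickWeight_nonneg hv k) hB).symm
    _ ≤ ENNReal.ofReal B := by
        refine ENNReal.ofReal_le_ofReal ?_
        rw [← Finset.sum_mul, sum_stickWeight]
        have : 0 ≤ ∏ j ∈ Finset.range n, (1 - v j) :=
          Finset.prod_nonneg fun j _ => by linarith [(hv j).2]
        nlinarith [mul_nonneg this hB]

lemma lintegral_infinitePi_eq_cons (μ : ℕ → Measure ℝ) [∀ n, IsProbabilityMeasure (μ n)]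
    (f : (ℕ → ℝ) → ℝ≥0∞) (hf : Measurable f) :
    ∫⁻ v, f v ∂(Measure.infinitePi μ) =
      ∫⁻ x, ∫⁻ v, f (consSeq x v) ∂(Measure.infinitePi fun n => μ (n + 1)) ∂(μ 0) := by
  rw [← infinitePi_eq_map_consSeq μ, lintegral_map hf measurable_consSeq,
    lintegral_prod _ (by fun_prop)]

lemma ae_infinitePi (μ : ℕ → Measure ℝ) [∀ n, IsProbabilityMeasure (μ n)] {p : ℕ → ℝ → Prop}
    (h : ∀ n, ∀ᵐ x ∂(μ n), p n x) : ∀ᵐ v ∂(Measure.infinitePi μ), ∀ n, p n (v n) := by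
  refine ae_all_iff.2 fun n => ?_
  exact (measurePreserving_eval_infinitePi μ n).quasiMeasurePreserving.ae (h n)

lemma ofReal_one_add_mul {s r : ℝ} (hs : 0 ≤ s) (hr : 0 ≤ r) :
    1 + ENNReal.ofReal s * ENNReal.ofReal r = ENNReal.ofReal (1 + s * r) := by
  rw [← ENNReal.ofReal_mul hs, ENNReal.ofReal_add zero_le_one (mul_nonneg hs hr),
    ENNReal.ofReal_one]

lemma one_add_mul_rpow {s r : ℝ} (hs : 0 ≤ s) (hr : 0 ≤ r) (p : ℝ) :
    (1 + ENNReal.ofReal s * ENNReal.ofReal r) ^ p = ENNReal.ofReal ((1 + s * r) ^ p) := by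
  rw [ofReal_one_add_mul hs hr, ENNReal.ofReal_rpow_of_pos (by nlinarith [mul_nonneg hs hr])]

lemma one_add_mul_top_rpow {s τ : ℝ} (hs : 0 < s) (hτ : 0 < τ) :
    (1 + ENNReal.ofReal s * ∞) ^ (-τ) = 0 := by
  rw [ENNReal.mul_top (by simpa using hs), add_top, ENNReal.top_rpow_of_neg (by linarith)]

/-- This is Feynman's parametrization with `u = 1 + s x` and `w = 1 + s y`. The value `y = ∞` is
allowed because the series is not yet known to converge; both sides then vanish. -/
lemma lintegral_beta_stick {a b s x : ℝ} (ha : 0 < a) (hb : 0 < b) (hs : 0 < s) (hx : 0 ≤ x)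
    (y : ℝ≥0∞) :
    ∫⁻ v, (1 + ENNReal.ofReal s * (ENNReal.ofReal (v * x) + ENNReal.ofReal (1 - v) * y))
        ^ (-(a + b)) ∂(betaMeasure a b)
      = ENNReal.ofReal ((1 + s * x) ^ (-a)) * (1 + ENNReal.ofReal s * y) ^ (-b) := by
  by_cases hy : y = ∞
  · subst hy
    rw [one_add_mul_top_rpow hs hb, mul_zero, lintegral_eq_zero_iff' (by fun_prop)]
    filter_upwards [betaMeasure_ae_mem a b] with v hv
    have hv1 : 0 < 1 - v := by linarith [hv.2]
    rw [ENNReal.mul_top (by simpa using hv1), add_top, one_add_mul_top_rpow hs (by linarith)]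
    rfl
  · obtain ⟨r, hr, rfl⟩ : ∃ r : ℝ, 0 ≤ r ∧ y = ENNReal.ofReal r :=
      ⟨y.toReal, ENNReal.toReal_nonneg, (ENNReal.ofReal_toReal hy).symm⟩
    have h1 : 0 < 1 + s * x := by nlinarith [mul_nonneg hs.le hx]
    have h2 : 0 < 1 + s * r := by nlinarith [mul_nonneg hs.le hr]
    rw [one_add_mul_rpow hs.le hr, ← ENNReal.ofReal_mul (by positivity),
      ← lintegral_beta_segment ha hb h1 h2]
    refine lintegral_congr_ae ?_
    filter_upwards [betaMeasure_ae_mem a b] with v hv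
    have hv1 : 0 ≤ 1 - v := by linarith [hv.2]
    have hv0 := hv.1.le
    rw [← ENNReal.ofReal_mul hv1, ← ENNReal.ofReal_add (by positivity) (by positivity),
      one_add_mul_rpow hs.le (by positivity)]
    ring_nf

lemma isProbabilityMeasure_stick {α τ : ℝ} (h0 : 0 ≤ α) (h1 : α < 1) (hτ : 0 < τ) (k : ℕ) :
    IsProbabilityMeasure (betaMeasure (1 - α) (τ + (k + 1) * α)) :=
  isProbabilityMeasureBeta (by linarith) (by positivity)

/-- Transform of order `σ` of the mean of a `PD(α,τ)` random measure with base law `H`. -/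
noncomputable def stickTransform (σ α τ : ℝ) (H : Measure ℝ) (s : ℝ) : ℝ≥0∞ :=
  ∫⁻ ω, (1 + ENNReal.ofReal s * stickSum ω.1 ω.2) ^ (-σ)
    ∂((stickFractions α τ).prod (Measure.infinitePi fun _ : ℕ => H))

/-- Tonelli places the first stick fraction innermost, where the Beta identity can be applied with
everything else frozen. -/
lemma lintegral_prod_cons (μ μ' : ℕ → Measure ℝ) [∀ n, IsProbabilityMeasure (μ n)]
    [∀ n, IsProbabilityMeasure (μ' n)] (f : (ℕ → ℝ) × (ℕ → ℝ) → ℝ≥0∞) (hf : Measurable f) :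
    ∫⁻ ω, f ω ∂((Measure.infinitePi μ).prod (Measure.infinitePi μ')) =
      ∫⁻ v, ∫⁻ y, ∫⁻ w, ∫⁻ x, f (consSeq x v, consSeq y w) ∂(μ 0)
        ∂(Measure.infinitePi fun n => μ' (n + 1)) ∂(μ' 0)
        ∂(Measure.infinitePi fun n => μ (n + 1)) := by
  rw [lintegral_prod _ hf.aemeasurable, lintegral_infinitePi_eq_cons μ _ hf.lintegral_prod_right']
  have hm : Measurable fun z : ((ℝ × (ℕ → ℝ)) × ℝ) × (ℕ → ℝ) =>
      f (consSeq z.1.1.1 z.1.1.2, consSeq z.1.2 z.2) := by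
    have h1 : Measurable fun z : ((ℝ × (ℕ → ℝ)) × ℝ) × (ℕ → ℝ) => consSeq z.1.1.1 z.1.1.2 :=
      measurable_consSeq.comp (measurable_fst.comp measurable_fst)
    have h2 : Measurable fun z : ((ℝ × (ℕ → ℝ)) × ℝ) × (ℕ → ℝ) => consSeq z.1.2 z.2 :=
      measurable_consSeq.comp
        (f := fun z : ((ℝ × (ℕ → ℝ)) × ℝ) × (ℕ → ℝ) => (z.1.2, z.2)) (by fun_prop)
    exact hf.comp (h1.prodMk h2)
  have hm2 := hm.lintegral_prod_right' (ν := Measure.infinitePi fun n => μ' (n + 1))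
  have hm3 := hm2.lintegral_prod_right' (ν := μ' 0)
  have e1 : ∀ x v, ∫⁻ w, f (consSeq x v, w) ∂(Measure.infinitePi μ') =
      ∫⁻ y, ∫⁻ w, f (consSeq x v, consSeq y w) ∂(Measure.infinitePi fun n => μ' (n + 1))
        ∂(μ' 0) := fun x v =>
    lintegral_infinitePi_eq_cons μ' _ (hf.comp (measurable_const.prodMk measurable_id))
  simp_rw [e1]
  rw [lintegral_lintegral_swap hm3.aemeasurable]
  refine lintegral_congr fun v => ?_
  rw [lintegral_lintegral_swap]
  swap
  · exact (hm2.comp (f := fun z : ℝ × ℝ => ((z.1, v), z.2)) (by fun_prop)).aemeasurable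
  refine lintegral_congr fun y => ?_
  rw [lintegral_lintegral_swap]
  exact (hm.comp (f := fun z : ℝ × (ℕ → ℝ) => (((z.1, v), y), z.2)) (by fun_prop)).aemeasurable

/-- The first fraction is Beta(`1 - α`, `τ + α`), whose parameters add up to `τ + 1`; at exactly
this order the transform factors. The later fractions are those of the parameters `(α, τ + α)`. -/
lemma stickTransform_succ {α τ : ℝ} (h0 : 0 ≤ α) (h1 : α < 1) (hτ : 0 < τ) (H : Measure ℝ)
    [IsProbabilityMeasure H] (hH : H (Iio 0) = 0) {s : ℝ} (hs : 0 < s) :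
    stickTransform (τ + 1) α τ H s =
      sti (1 - α) H s * stickTransform (τ + α) α (τ + α) H s := by
  have hp := fun k : ℕ => isProbabilityMeasure_stick h0 h1 hτ k
  have hp' := fun k : ℕ => isProbabilityMeasure_stick h0 h1 (by linarith : 0 < τ + α) k
  have hshift : (Measure.infinitePi fun n : ℕ =>
      betaMeasure (1 - α) (τ + (((n + 1 : ℕ) : ℝ) + 1) * α)) = stickFractions α (τ + α) := by
    rw [stickFractions]
    congr 1
    funext n
    congr 1
    push_cast; ring
  have hsp : IsProbabilityMeasure (stickFractions α (τ + α)) := by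
    unfold stickFractions; infer_instance
  rw [stickTransform, stickFractions, lintegral_prod_cons _ _ _ (by fun_prop), hshift,
    stickTransform, lintegral_prod _ (by fun_prop), ← lintegral_const_mul]
  swap
  · exact Measurable.lintegral_prod_right' (f := fun z : (ℕ → ℝ) × (ℕ → ℝ) =>
      (1 + ENNReal.ofReal s * stickSum z.1 z.2) ^ (-(τ + α))) (by fun_prop)
  refine lintegral_congr fun v => ?_
  rw [sti, ← lintegral_mul_const _ (by fun_prop)]
  refine lintegral_congr_ae ?_
  filter_upwards [ae_nonneg_of_Iio hH] with y hy
  have hmv : Measurable fun w => stickSum v w :=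
    measurable_stickSum.comp (measurable_const.prodMk measurable_id)
  rw [← lintegral_const_mul _ (by fun_prop)]
  refine lintegral_congr fun w => ?_
  rw [← lintegral_beta_stick (by linarith) (by linarith) hs hy]
  simp only [Nat.cast_zero, zero_add, one_mul]
  refine lintegral_congr_ae ?_
  filter_upwards [betaMeasure_ae_mem (1 - α) (τ + α)] with x hx
  rw [stickSum_cons hx.2.le]
  congr 1
  ring

/-! ### Integral equation for the transforms and its uniqueness -/

/-- The integral operator `h ↦ τ s⁻ᵗ ∫₀ˢ tᵗ⁻¹ h(t) dt`, of order `τ`. -/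
noncomputable def hardyOp (τ : ℝ) (h : ℝ → ℝ≥0∞) (s : ℝ) : ℝ≥0∞ :=
  ENNReal.ofReal (s ^ (-τ)) * ∫⁻ t in Ioc 0 s, ENNReal.ofReal (τ * t ^ (τ - 1)) * h t

lemma lintegral_rpow_Ioc {τ s : ℝ} (hτ : 0 < τ) (hs : 0 ≤ s) :
    ∫⁻ t in Ioc 0 s, ENNReal.ofReal (τ * t ^ (τ - 1)) = ENNReal.ofReal (s ^ τ) := by
  rw [lintegral_deriv_Ioc (g := fun t => t ^ τ) hs]
  · simp [Real.zero_rpow hτ.ne']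
  · exact continuousOn_id.rpow_const fun _ _ => Or.inr hτ.le
  · exact fun x hx => Real.hasDerivAt_rpow_const (Or.inl hx.1.ne')
  · intro x hx
    have := hx.1
    positivity

/-- The derivative of `t ^ τ (1 + t A) ^ (-τ)` is `τ t ^ (τ - 1) (1 + t A) ^ (-(τ + 1))`. The
operator thus lowers the order from `τ + 1` to `τ`. -/
lemma rpow_eq_hardyOp {τ s : ℝ} (hτ : 0 < τ) (hs : 0 < s) (A : ℝ≥0∞) :
    (1 + ENNReal.ofReal s * A) ^ (-τ) =
      hardyOp τ (fun t => (1 + ENNReal.ofReal t * A) ^ (-(τ + 1))) s := by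
  unfold hardyOp
  by_cases hA : A = ∞
  · subst hA
    rw [one_add_mul_top_rpow hs hτ, setLIntegral_congr_fun (g := fun _ => 0) measurableSet_Ioc]
    · simp
    · intro t ht
      simp only
      rw [one_add_mul_top_rpow ht.1 (by linarith), mul_zero]
  · obtain ⟨r, hr, rfl⟩ : ∃ r : ℝ, 0 ≤ r ∧ A = ENNReal.ofReal r :=
      ⟨A.toReal, ENNReal.toReal_nonneg, (ENNReal.ofReal_toReal hA).symm⟩
    have hpos : ∀ t, 0 ≤ t → 0 < 1 + t * r := fun t ht => by nlinarith [mul_nonneg ht hr]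
    have h := lintegral_deriv_Ioc (g := fun t => t ^ τ * (1 + t * r) ^ (-τ))
      (g' := fun t => τ * t ^ (τ - 1) * (1 + t * r) ^ (-(τ + 1))) hs.le ?_ ?_ ?_
    · rw [setLIntegral_congr_fun (g := fun t =>
        ENNReal.ofReal (τ * t ^ (τ - 1) * (1 + t * r) ^ (-(τ + 1)))) measurableSet_Ioc, h,
        one_add_mul_rpow hs.le hr, ← ENNReal.ofReal_mul (by positivity)]
      · congr 1
        simp only [Real.zero_rpow hτ.ne', zero_mul, sub_zero]
        rw [← mul_assoc, ← Real.rpow_add hs]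
        simp
      · intro t ht
        have := ht.1
        simp only
        rw [one_add_mul_rpow ht.1.le hr, ← ENNReal.ofReal_mul (by positivity)]
    · refine (continuousOn_id.rpow_const fun _ _ => Or.inr hτ.le).mul
        (ContinuousOn.rpow_const (by fun_prop) fun x hx => Or.inl (hpos x hx.1).ne')
    · intro x hx
      have hx0 := hx.1
      have hp := hpos x hx.1.le
      have h1 : HasDerivAt (fun t : ℝ => 1 + t * r) r x := by
        simpa using ((hasDerivAt_id x).mul_const r).const_add 1
      have h2 := h1.rpow_const (p := -τ) (Or.inl hp.ne')
      refine ((Real.hasDerivAt_rpow_const (p := τ) (Or.inl hx0.ne')).mul h2).congr_deriv ?_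
      have e1 : x ^ τ = x ^ (τ - 1) * x := by
        nth_rewrite 3 [← Real.rpow_one x]
        rw [← Real.rpow_add hx0]; ring_nf
      have e2 : (1 + x * r) ^ (-τ) = (1 + x * r) ^ (-(τ + 1)) * (1 + x * r) := by
        nth_rewrite 3 [← Real.rpow_one (1 + x * r)]
        rw [← Real.rpow_add hp]; ring_nf
      rw [e1, e2, show -τ - 1 = -(τ + 1) by ring]
      ring
    · intro x hx
      have hx0 := hx.1
      have hp := hpos x hx.1.le
      positivity

/-- Lowering the order in the factorization at order `τ + 1` gives equations in which order and
level agree: level `τ` is expressed through level `τ + α`. For `α = 0` this is a fixed-point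
equation. -/
lemma stickTransform_eq_hardyOp {α τ : ℝ} (h0 : 0 ≤ α) (h1 : α < 1) (hτ : 0 < τ) (H : Measure ℝ)
    [IsProbabilityMeasure H] (hH : H (Iio 0) = 0) {s : ℝ} (hs : 0 < s) :
    stickTransform τ α τ H s =
      hardyOp τ (fun t => sti (1 - α) H t * stickTransform (τ + α) α (τ + α) H t) s := by
  have hp := fun k : ℕ => isProbabilityMeasure_stick h0 h1 hτ k
  have hsp : IsProbabilityMeasure (stickFractions α τ) := by
    unfold stickFractions; infer_instance
  have e : ∀ ω : (ℕ → ℝ) × (ℕ → ℝ), (1 + ENNReal.ofReal s * stickSum ω.1 ω.2) ^ (-τ) = _ :=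
    fun ω => rpow_eq_hardyOp hτ hs _
  rw [stickTransform]
  simp_rw [e]
  unfold hardyOp
  rw [lintegral_const_mul', lintegral_lintegral_swap (by fun_prop)]
  · congr 1
    refine setLIntegral_congr_fun measurableSet_Ioc fun t ht => ?_
    simp only
    rw [← stickTransform_succ h0 h1 hτ H hH ht.1, stickTransform, lintegral_const_mul' _ _ (by simp)]
  · simp

/-- The ratio of consecutive terms is `1 - (1 - α) / (τ + m α + 1)`. Since `τ + m α + 1 ≤ (τ + 1) (m
+ 1)`, the product is dominated by the exponential of a negative multiple of the harmonic sum. -/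
lemma tendsto_mul_prod_div_add_one {α τ : ℝ} (h0 : 0 ≤ α) (h1 : α < 1) (hτ : 0 < τ) :
    Tendsto (fun m : ℕ => (τ + m * α) * ∏ j ∈ Finset.range m, ((τ + j * α) / (τ + j * α + 1)))
      atTop (𝓝 0) := by
  have hpos : ∀ j : ℕ, 0 < τ + j * α := fun j => by positivity
  have hle : ∀ m : ℕ, (τ + m * α) * ∏ j ∈ Finset.range m, ((τ + j * α) / (τ + j * α + 1)) ≤
      τ * Real.exp (-((1 - α) / (τ + 1) * ∑ j ∈ Finset.range m, (1 / ((j : ℝ) + 1)))) := by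
    intro m
    induction m with
    | zero => simp
    | succ m ih =>
      have hm := hpos m
      have e : (τ + (m + 1 : ℕ) * α) *
          ∏ j ∈ Finset.range (m + 1), ((τ + j * α) / (τ + j * α + 1)) =
          ((τ + m * α) * ∏ j ∈ Finset.range m, ((τ + j * α) / (τ + j * α + 1))) *
            ((τ + (m + 1 : ℕ) * α) / (τ + m * α + 1)) := by
        rw [Finset.prod_range_succ]
        ring
      have hfac : (τ + (m + 1 : ℕ) * α) / (τ + m * α + 1) ≤
          Real.exp (-((1 - α) / (τ + 1) * (1 / ((m : ℝ) + 1)))) := by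
        have h2 : (τ + (m + 1 : ℕ) * α) / (τ + m * α + 1) = 1 - (1 - α) / (τ + m * α + 1) := by
          field_simp
          push_cast
          ring
        have h3 : (1 - α) / (τ + 1) * (1 / ((m : ℝ) + 1)) ≤ (1 - α) / (τ + m * α + 1) := by
          rw [div_mul_div_comm, mul_one]
          refine div_le_div_of_nonneg_left (by linarith) (by positivity) ?_
          have : (0 : ℝ) ≤ m := Nat.cast_nonneg m
          nlinarith
        rw [h2]
        have := Real.add_one_le_exp (-((1 - α) / (τ + 1) * (1 / ((m : ℝ) + 1))))
        linarith
      rw [e, Finset.sum_range_succ, mul_add, neg_add, Real.exp_add, ← mul_assoc]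
      refine mul_le_mul ih hfac ?_ (by positivity)
      have := hpos (m + 1)
      positivity
  refine squeeze_zero (fun m => ?_) hle ?_
  · exact mul_nonneg (hpos m).le (Finset.prod_nonneg fun j _ =>
      div_nonneg (hpos j).le (by linarith [hpos j]))
  · have hc : 0 < (1 - α) / (τ + 1) := div_pos (by linarith) (by linarith)
    have := (Real.tendsto_exp_neg_atTop_nhds_zero.comp
      (Real.tendsto_sum_range_one_div_nat_succ_atTop.const_mul_atTop hc)).const_mul τ
    simpa using this

lemma hardyOp_mono {τ : ℝ} {h k : ℝ → ℝ≥0∞} {s : ℝ} (hk : ∀ t, 0 < t → h t ≤ k t) :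
    hardyOp τ h s ≤ hardyOp τ k s := by
  unfold hardyOp
  gcongr ENNReal.ofReal _ * ?_
  exact setLIntegral_mono' measurableSet_Ioc fun t ht => by gcongr; exact hk t ht.1

/-- On linear functions the operator is multiplication by `τ / (τ + 1) < 1`; this is the contraction
behind the comparison principle. -/
lemma hardyOp_add_linear {τ s K : ℝ} (hτ : 0 < τ) (hs : 0 < s) (hK : 0 ≤ K) (h : ℝ → ℝ≥0∞) :
    hardyOp τ (fun t => h t + ENNReal.ofReal (K * t)) s =
      hardyOp τ h s + ENNReal.ofReal (τ / (τ + 1) * K * s) := by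
  unfold hardyOp
  simp_rw [mul_add]
  rw [lintegral_add_right _ (by fun_prop), mul_add]
  congr 1
  have : ∀ t ∈ Ioc 0 s, ENNReal.ofReal (τ * t ^ (τ - 1)) * ENNReal.ofReal (K * t) =
      ENNReal.ofReal (τ * K / (τ + 1)) * ENNReal.ofReal ((τ + 1) * t ^ (τ + 1 - 1)) := by
    intro t ht
    have ht0 := ht.1
    rw [← ENNReal.ofReal_mul (by positivity), ← ENNReal.ofReal_mul (by positivity)]
    congr 1
    rw [show τ + 1 - 1 = (τ - 1) + 1 by ring, Real.rpow_add ht0, Real.rpow_one]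
    field_simp
  rw [setLIntegral_congr_fun measurableSet_Ioc this, lintegral_const_mul' _ _ (by simp),
    lintegral_rpow_Ioc (by linarith) hs.le, ← ENNReal.ofReal_mul (by positivity),
    ← ENNReal.ofReal_mul (by positivity)]
  congr 1
  have : s ^ (-τ) * s ^ (τ + 1) = s := by
    rw [← Real.rpow_add hs]; simp
  calc _ = τ * K / (τ + 1) * (s ^ (-τ) * s ^ (τ + 1)) := by ring
    _ = _ := by rw [this]; ring

/-- Comparison principle for the chain of integral equations satisfied by stick-breaking means. -/
lemma hardyOp_comparison {α τ B : ℝ} (h0 : 0 ≤ α) (h1 : α < 1) (hτ : 0 < τ) (hB : 0 ≤ B)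
    {F G : ℕ → ℝ → ℝ≥0∞} {b : ℝ → ℝ≥0∞} (hb : ∀ t, 0 < t → b t ≤ 1)
    (hF : ∀ (n : ℕ) (s : ℝ), 0 < s → F n s = hardyOp (τ + n * α) (fun t => b t * F (n + 1) t) s)
    (hG : ∀ (n : ℕ) (s : ℝ), 0 < s → G n s = hardyOp (τ + n * α) (fun t => b t * G (n + 1) t) s)
    (hFG : ∀ (n : ℕ) (s : ℝ), 0 < s → F n s ≤ G n s + ENNReal.ofReal (B * (τ + n * α) * s))
    {s : ℝ} (hs : 0 < s) : F 0 s ≤ G 0 s := by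
  have hpos : ∀ j : ℕ, 0 < τ + j * α := fun j => by positivity
  -- The error constant at level `n` after `m` uses of the equation: the initial bound is taken at
  -- level `n + m`, and each level passed on the way back contributes its contraction factor.
  let c : ℕ → ℕ → ℝ := fun n m => (τ + (n + m : ℕ) * α) *
    ∏ j ∈ Finset.range m, ((τ + (n + j : ℕ) * α) / (τ + (n + j : ℕ) * α + 1))
  have hc : ∀ n m, 0 ≤ c n m := fun n m => mul_nonneg (hpos _).le (Finset.prod_nonneg fun j _ =>
    div_nonneg (hpos _).le (by linarith [hpos (n + j)]))
  have key : ∀ m n : ℕ, ∀ s, 0 < s → F n s ≤ G n s + ENNReal.ofReal (B * c n m * s) := by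
    intro m
    induction m with
    | zero => intro n s hs; simpa [c] using hFG n s hs
    | succ m ih =>
      intro n s hs
      have hcs : c n (m + 1) = (τ + n * α) / (τ + n * α + 1) * c (n + 1) m := by
        simp only [c]
        rw [Finset.prod_range_succ']
        have e : ∀ k : ℕ, n + (k + 1) = n + 1 + k := fun k => by ring
        rw [Finset.prod_congr rfl fun k _ => by rw [e k], e m, add_zero]
        ring
      calc F n s = hardyOp (τ + n * α) (fun t => b t * F (n + 1) t) s := hF n s hs
        _ ≤ hardyOp (τ + n * α)
            (fun t => b t * G (n + 1) t + ENNReal.ofReal (B * c (n + 1) m * t)) s := by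
            refine hardyOp_mono fun t ht => ?_
            calc b t * F (n + 1) t
                ≤ b t * (G (n + 1) t + ENNReal.ofReal (B * c (n + 1) m * t)) := by
                  gcongr; exact ih (n + 1) t ht
              _ ≤ _ := by
                  rw [mul_add]
                  gcongr
                  exact mul_le_of_le_one_left zero_le (hb t ht)
        _ = _ := by
            rw [hardyOp_add_linear (hpos n) hs (mul_nonneg hB (hc _ _)), ← hG n s hs, hcs]
            congr 2
            ring
  have hlim : Tendsto (fun m => G 0 s + ENNReal.ofReal (B * c 0 m * s)) atTop
      (𝓝 (G 0 s + ENNReal.ofReal (B * 0 * s))) := by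
    refine tendsto_const_nhds.add (ENNReal.tendsto_ofReal ?_)
    refine Tendsto.mul_const _ (Tendsto.const_mul _ ?_)
    simpa [c] using tendsto_mul_prod_div_add_one h0 h1 hτ
  have := ge_of_tendsto' hlim fun m => key m 0 s hs
  simpa using this

lemma one_sub_le_one_add_rpow_neg {y τ : ℝ} (hy : 0 ≤ y) (hτ : 0 ≤ τ) :
    1 - τ * y ≤ (1 + y) ^ (-τ) := by
  rw [Real.rpow_def_of_pos (by linarith)]
  have h1 := Real.add_one_le_exp (Real.log (1 + y) * -τ)
  have h2 := Real.log_le_sub_one_of_pos (by linarith : 0 < 1 + y)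
  nlinarith

lemma one_add_rpow_neg_le_one (x : ℝ≥0∞) {τ : ℝ} (hτ : 0 < τ) : (1 + x) ^ (-τ) ≤ 1 := by
  rw [ENNReal.rpow_neg]
  exact ENNReal.inv_le_one.2 (ENNReal.one_le_rpow le_self_add hτ)

lemma stickTransform_le_one {α τ σ : ℝ} (h0 : 0 ≤ α) (h1 : α < 1) (hτ : 0 < τ) (hσ : 0 < σ)
    (H : Measure ℝ) [IsProbabilityMeasure H] (s : ℝ) : stickTransform σ α τ H s ≤ 1 := by
  have hp := fun k : ℕ => isProbabilityMeasure_stick h0 h1 hτ k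
  have hsp : IsProbabilityMeasure (stickFractions α τ) := by
    unfold stickFractions; infer_instance
  calc stickTransform σ α τ H s ≤ ∫⁻ _, 1
        ∂((stickFractions α τ).prod (Measure.infinitePi fun _ : ℕ => H)) :=
        lintegral_mono fun ω => one_add_rpow_neg_le_one _ hσ
    _ = 1 := by simp

lemma stickFractions_ae {α τ : ℝ} (h0 : 0 ≤ α) (h1 : α < 1) (hτ : 0 < τ) :
    ∀ᵐ v ∂(stickFractions α τ), ∀ k, v k ∈ Ioo (0 : ℝ) 1 := by
  have hp := fun k : ℕ => isProbabilityMeasure_stick h0 h1 hτ k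
  exact ae_infinitePi _ fun n => betaMeasure_ae_mem _ _

lemma isProbabilityMeasure_stickFractions {α τ : ℝ} (h0 : 0 ≤ α) (h1 : α < 1) (hτ : 0 < τ) :
    IsProbabilityMeasure (stickFractions α τ) := by
  have hp := fun k : ℕ => isProbabilityMeasure_stick h0 h1 hτ k
  unfold stickFractions; infer_instance

/-- If the base law is bounded by `B`, so is the mean, and the transform is at least `1 - B σ s`.
This supplies the initial linear error for the comparison; the additive form avoids truncated
subtraction. -/
lemma one_le_stickTransform_add {α τ σ B : ℝ} (h0 : 0 ≤ α) (h1 : α < 1) (hτ : 0 < τ)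
    (hσ : 0 < σ) (hB : 0 ≤ B) (H : Measure ℝ) [IsProbabilityMeasure H] (hH : ∀ᵐ x ∂H, x ≤ B)
    {s : ℝ} (hs : 0 < s) :
    1 ≤ stickTransform σ α τ H s + ENNReal.ofReal (B * σ * s) := by
  have hsp := isProbabilityMeasure_stickFractions h0 h1 hτ
  have hle : ENNReal.ofReal (1 - σ * (s * B)) ≤ stickTransform σ α τ H s := by
    calc ENNReal.ofReal (1 - σ * (s * B)) = ∫⁻ _, ENNReal.ofReal (1 - σ * (s * B))
        ∂((stickFractions α τ).prod (Measure.infinitePi fun _ : ℕ => H)) := by simp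
      _ ≤ _ := by
        refine lintegral_mono_ae ?_
        have hv := (Measure.quasiMeasurePreserving_fst (μ := stickFractions α τ)
          (ν := Measure.infinitePi fun _ : ℕ => H)).ae
          (stickFractions_ae h0 h1 hτ)
        have hw := (Measure.quasiMeasurePreserving_snd (μ := stickFractions α τ)
          (ν := Measure.infinitePi fun _ : ℕ => H)).ae
          (ae_infinitePi (fun _ => H) fun _ => hH)
        filter_upwards [hv, hw] with ω hv hw
        have h2 := stickSum_le (fun k => Ioo_subset_Icc_self (hv k)) hB hw
        calc ENNReal.ofReal (1 - σ * (s * B)) ≤ ENNReal.ofReal ((1 + s * B) ^ (-σ)) :=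
              ENNReal.ofReal_le_ofReal (one_sub_le_one_add_rpow_neg (by positivity) hσ.le)
          _ = (1 + ENNReal.ofReal s * ENNReal.ofReal B) ^ (-σ) :=
              (one_add_mul_rpow hs.le hB _).symm
          _ ≤ _ := by
              rw [ENNReal.rpow_neg, ENNReal.rpow_neg, ENNReal.inv_le_inv]
              gcongr
  calc (1 : ℝ≥0∞) = ENNReal.ofReal (1 - σ * (s * B) + B * σ * s) := by
        rw [← ENNReal.ofReal_one]; congr 1; ring
    _ ≤ ENNReal.ofReal (1 - σ * (s * B)) + ENNReal.ofReal (B * σ * s) := ENNReal.ofReal_add_le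
    _ ≤ _ := by gcongr

lemma sti_le_one {θ : ℝ} (hθ : 0 ≤ θ) (H : Measure ℝ) [IsProbabilityMeasure H]
    (hH : H (Iio 0) = 0) {s : ℝ} (hs : 0 ≤ s) : sti θ H s ≤ 1 := by
  calc sti θ H s ≤ ∫⁻ _, 1 ∂H := by
        refine lintegral_mono_ae ?_
        filter_upwards [ae_nonneg_of_Iio hH] with x hx
        rw [← ENNReal.ofReal_one]
        exact ENNReal.ofReal_le_ofReal (Real.rpow_le_one_of_one_le_of_nonpos
          (by nlinarith [mul_nonneg hs hx]) (by linarith))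
    _ = 1 := by simp

/-- A family solving the same integral equations as the transforms of stick-breaking means
coincides with them. -/
lemma stickTransform_eq_of_hardyOp {α τ B : ℝ} (h0 : 0 ≤ α) (h1 : α < 1) (hτ : 0 < τ)
    (hB : 0 ≤ B) (H : Measure ℝ) [IsProbabilityMeasure H] (hH0 : H (Iio 0) = 0)
    (hH : ∀ᵐ x ∂H, x ≤ B) {G : ℝ → ℝ → ℝ≥0∞}
    (hG : ∀ σ s, 0 < σ → 0 < s →
      G σ s = hardyOp σ (fun t => sti (1 - α) H t * G (σ + α) t) s)
    (hG1 : ∀ σ s, 0 < σ → 0 < s → G σ s ≤ 1)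
    (hG2 : ∀ σ s, 0 < σ → 0 < s → 1 ≤ G σ s + ENNReal.ofReal (B * σ * s))
    {s : ℝ} (hs : 0 < s) : stickTransform τ α τ H s = G τ s := by
  have hpos : ∀ j : ℕ, 0 < τ + j * α := fun j => by positivity
  have hb : ∀ t, 0 < t → sti (1 - α) H t ≤ 1 := fun t ht =>
    sti_le_one (by linarith) H hH0 ht.le
  have hsucc : ∀ n : ℕ, τ + (n + 1 : ℕ) * α = τ + n * α + α := fun n => by push_cast; ring
  have e0 : τ + (0 : ℕ) * α = τ := by simp
  let F : ℕ → ℝ → ℝ≥0∞ := fun n t => stickTransform (τ + n * α) α (τ + n * α) H t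
  let G' : ℕ → ℝ → ℝ≥0∞ := fun n t => G (τ + n * α) t
  have hF : ∀ (n : ℕ) (s : ℝ), 0 < s → F n s = hardyOp (τ + n * α)
      (fun t => sti (1 - α) H t * F (n + 1) t) s := fun n s hs => by
    simp only [F, hsucc]
    exact stickTransform_eq_hardyOp h0 h1 (hpos n) H hH0 hs
  have hG' : ∀ (n : ℕ) (s : ℝ), 0 < s → G' n s = hardyOp (τ + n * α)
      (fun t => sti (1 - α) H t * G' (n + 1) t) s := fun n s hs => by
    simp only [G', hsucc]
    exact hG _ s (hpos n) hs
  -- Both families lie between `1 - B σ s` and `1`, so the comparison runs in both directions.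
  have hle := hardyOp_comparison h0 h1 hτ hB hb hF hG' (fun n s hs =>
    (stickTransform_le_one h0 h1 (hpos n) (hpos n) H s).trans (hG2 _ s (hpos n) hs)) hs
  have hge := hardyOp_comparison h0 h1 hτ hB hb hG' hF (fun n s hs =>
    (hG1 _ s (hpos n) hs).trans (one_le_stickTransform_add h0 h1 (hpos n) (hpos n) hB H hH hs)) hs
  simp only [F, G', e0] at hle hge
  exact le_antisymm hle hge

/-- The ODE says that `t ^ σ g` has derivative `σ t ^ (σ - 1) b`. Closed-form candidates can then be
verified by differentiation. -/
lemma hardyOp_eq_of_hasDerivAt {σ s : ℝ} (hσ : 0 < σ) (hs : 0 < s) {g b : ℝ → ℝ}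
    (hc : ContinuousOn g (Icc 0 s)) {g' : ℝ → ℝ}
    (hd : ∀ t ∈ Ioo 0 s, HasDerivAt g (g' t) t)
    (hb : ∀ t, 0 < t → 0 ≤ b t) (hg' : ∀ t, 0 < t → σ * g t + t * g' t = σ * b t) :
    ENNReal.ofReal (g s) = hardyOp σ (fun t => ENNReal.ofReal (b t)) s := by
  unfold hardyOp
  have h := lintegral_deriv_Ioc (g := fun t => t ^ σ * g t)
      (g' := fun t => σ * t ^ (σ - 1) * b t) hs.le ?_ ?_ ?_
  · rw [setLIntegral_congr_fun (g := fun t => ENNReal.ofReal (σ * t ^ (σ - 1) * b t))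
      measurableSet_Ioc, h, ← ENNReal.ofReal_mul (by positivity)]
    · congr 1
      simp only [Real.zero_rpow hσ.ne', zero_mul, sub_zero]
      rw [← mul_assoc, ← Real.rpow_add hs]
      simp
    · intro t ht
      have := ht.1
      simp only
      rw [← ENNReal.ofReal_mul (by positivity)]
  · exact (continuousOn_id.rpow_const fun _ _ => Or.inr hσ.le).mul hc
  · intro x hx
    refine ((Real.hasDerivAt_rpow_const (p := σ) (Or.inl hx.1.ne')).mul (hd x hx)).congr_deriv ?_
    have e1 : x ^ σ = x ^ (σ - 1) * x := by
      nth_rewrite 3 [← Real.rpow_one x]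
      rw [← Real.rpow_add hx.1]; ring_nf
    rw [e1]
    linear_combination x ^ (σ - 1) * hg' x hx.1
  · intro x hx
    have := hx.1
    have := hb x hx.1
    positivity

/-! ### Mass given by a Poisson-Dirichlet measure to a set of probability `p` -/

/-- The two-point law with mass `p` at `1` and mass `1 - p` at `0`. -/
noncomputable def bernoulliLaw (p : ℝ) : Measure ℝ :=
  ((volume : Measure ℝ).restrict (Icc 0 1)).map fun u => if u ≤ p then 1 else 0

lemma lintegral_bernoulliLaw {p : ℝ} (h0 : 0 ≤ p) (h1 : p ≤ 1) {f : ℝ → ℝ≥0∞}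
    (hf : Measurable f) :
    ∫⁻ x, f x ∂(bernoulliLaw p) = ENNReal.ofReal p * f 1 + ENNReal.ofReal (1 - p) * f 0 := by
  have hm : Measurable fun u : ℝ => if u ≤ p then (1 : ℝ) else 0 :=
    Measurable.ite measurableSet_Iic measurable_const measurable_const
  rw [bernoulliLaw, lintegral_map hf hm, ← Icc_union_Ioc_eq_Icc h0 h1, lintegral_union
    measurableSet_Ioc (by
      rw [Set.disjoint_left]; intro x hx hx'; exact absurd hx.2 (not_le.2 hx'.1))]
  congr 1
  · rw [setLIntegral_congr_fun (g := fun _ => f 1) measurableSet_Icc]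
    · simp [mul_comm]
    · intro x hx; simp [hx.2]
  · rw [setLIntegral_congr_fun (g := fun _ => f 0) measurableSet_Ioc]
    · simp [mul_comm]
    · intro x hx; simp [not_le.2 hx.1]

/-- Stieltjes transform of the mass that a `PD(α,τ)` random measure gives to a set of
probability `p`. -/
lemma stickTransform_bernoulliLaw {α τ p : ℝ} (h0 : 0 < α) (h1 : α < 1) (hτ : 0 < τ)
    (hp0 : 0 ≤ p) (hp1 : p ≤ 1) {s : ℝ} (hs : 0 < s) :
    stickTransform τ α τ (bernoulliLaw p) s =
      ENNReal.ofReal ((1 - p + p * (1 + s) ^ α) ^ (-(τ / α))) := by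
  have hm : Measurable fun u : ℝ => if u ≤ p then (1 : ℝ) else 0 :=
    Measurable.ite measurableSet_Iic measurable_const measurable_const
  have hP : IsProbabilityMeasure ((volume : Measure ℝ).restrict (Icc 0 1)) := ⟨by simp⟩
  have hH : IsProbabilityMeasure (bernoulliLaw p) := Measure.isProbabilityMeasure_map hm.aemeasurable
  have hmem : ∀ᵐ x ∂(bernoulliLaw p), x ∈ Icc (0 : ℝ) 1 := by
    refine (ae_map_iff hm.aemeasurable measurableSet_Icc).2 (ae_of_all _ fun u => ?_)
    split_ifs <;> simp
  have hsti : ∀ t, 0 < t → sti (1 - α) (bernoulliLaw p) t =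
      ENNReal.ofReal (1 - p + p * (1 + t) ^ (α - 1)) := by
    intro t ht
    rw [sti, lintegral_bernoulliLaw hp0 hp1 (by fun_prop), ← ENNReal.ofReal_mul hp0,
      ← ENNReal.ofReal_mul (by linarith), ← ENNReal.ofReal_add (by positivity)
      (mul_nonneg (by linarith) (by positivity))]
    simp only [mul_one, mul_zero, add_zero, Real.one_rpow, neg_sub]
    ring_nf
  have hc : ∀ t : ℝ, 0 ≤ t → 1 ≤ 1 - p + p * (1 + t) ^ α := fun t ht => by
    have := Real.one_le_rpow (by linarith : 1 ≤ 1 + t) h0.le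
    nlinarith
  -- The candidate is needed for every order `σ`, since its equation at `σ` involves `σ + α`.
  refine stickTransform_eq_of_hardyOp h0.le h1 hτ zero_le_one _
    (measure_Iio_of_ae_nonneg (hmem.mono fun x hx => hx.1)) (hmem.mono fun x hx => hx.2)
    (G := fun σ s => ENNReal.ofReal ((1 - p + p * (1 + s) ^ α) ^ (-(σ / α)))) ?_ ?_ ?_ hs
  · intro σ s hσ hs
    have hcongr : hardyOp σ (fun t => sti (1 - α) (bernoulliLaw p) t *
        ENNReal.ofReal ((1 - p + p * (1 + t) ^ α) ^ (-((σ + α) / α)))) s =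
        hardyOp σ (fun t => ENNReal.ofReal ((1 - p + p * (1 + t) ^ (α - 1)) *
          (1 - p + p * (1 + t) ^ α) ^ (-((σ + α) / α)))) s := by
      unfold hardyOp
      congr 1
      refine setLIntegral_congr_fun measurableSet_Ioc fun t ht => ?_
      have := ht.1
      simp only
      rw [hsti t ht.1, ← ENNReal.ofReal_mul (add_nonneg (by linarith) (by positivity))]
    rw [hcongr]
    refine hardyOp_eq_of_hasDerivAt hσ hs
      (g := fun t => (1 - p + p * (1 + t) ^ α) ^ (-(σ / α)))
      (g' := fun t => p * (α * (1 + t) ^ (α - 1)) * (-(σ / α)) *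
        (1 - p + p * (1 + t) ^ α) ^ (-(σ / α) - 1)) ?_ ?_ ?_ ?_
    · refine ContinuousOn.rpow_const ?_ fun t ht => Or.inl (by linarith [hc t ht.1])
      exact continuousOn_const.add (continuousOn_const.mul
        (ContinuousOn.rpow_const (by fun_prop) fun t _ => Or.inr h0.le))
    · intro t ht
      have ht1 : 1 + t ≠ 0 := by linarith [ht.1]
      have hd1 : HasDerivAt (fun t : ℝ => 1 + t) 1 t := (hasDerivAt_id t).const_add 1
      have hd2 := ((hd1.rpow_const (p := α) (Or.inl ht1)).const_mul p).const_add (1 - p)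
      refine (hd2.rpow_const (p := -(σ / α)) (Or.inl (by linarith [hc t ht.1.le]))).congr_deriv ?_
      ring
    · intro t ht
      have := hc t ht.le
      exact mul_nonneg (add_nonneg (by linarith) (by positivity)) (by positivity)
    · intro t ht
      have hct : 0 < 1 - p + p * (1 + t) ^ α := by linarith [hc t ht.le]
      have e1 : (1 - p + p * (1 + t) ^ α) ^ (-(σ / α)) =
          (1 - p + p * (1 + t) ^ α) ^ (-(σ / α) - 1) * (1 - p + p * (1 + t) ^ α) := by
        nth_rewrite 3 [← Real.rpow_one (1 - p + p * (1 + t) ^ α)]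
        rw [← Real.rpow_add hct]; ring_nf
      have e2 : (1 + t) ^ α = (1 + t) ^ (α - 1) * (1 + t) := by
        nth_rewrite 3 [← Real.rpow_one (1 + t)]
        rw [← Real.rpow_add (by linarith)]; ring_nf
      have e3 : -((σ + α) / α) = -(σ / α) - 1 := by field_simp; ring
      rw [e3, e1]
      set X := (1 - p + p * (1 + t) ^ α) ^ (-(σ / α) - 1)
      rw [e2]
      field_simp
      ring
  · intro σ s hσ hs
    rw [← ENNReal.ofReal_one]
    exact ENNReal.ofReal_le_ofReal (Real.rpow_le_one_of_one_le_of_nonpos (hc s hs.le)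
      (by have : 0 ≤ σ / α := by positivity
          linarith))
  · intro σ s hσ hs
    rw [← ENNReal.ofReal_add (Real.rpow_nonneg (by linarith [hc s hs.le]) _) (by positivity),
      ← ENNReal.ofReal_one]
    refine ENNReal.ofReal_le_ofReal ?_
    have h2 := one_sub_le_one_add_rpow_neg hs.le hσ.le
    -- The candidate is smallest at `p = 1`, where it equals `(1 + s) ^ (-σ)`, and Bernoulli's
    -- inequality applies there.
    have h3 : (1 + s) ^ (-σ) ≤ (1 - p + p * (1 + s) ^ α) ^ (-(σ / α)) := by
      have e : (1 + s) ^ (-σ) = ((1 + s) ^ α) ^ (-(σ / α)) := by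
        rw [← Real.rpow_mul (by linarith)]
        congr 1
        field_simp
      rw [e]
      refine Real.rpow_le_rpow_of_nonpos (by linarith [hc s hs.le]) ?_
        (by have : 0 ≤ σ / α := by positivity
            linarith)
      have := Real.one_le_rpow (by linarith : 1 ≤ 1 + s) h0.le
      nlinarith
    linarith

/-! ### Dirichlet means and the Cifarelli-Regazzini identity -/

/-- For `α = 0` the level does not move, and the equation becomes the linear ODE `σ g + t g' = σ g ∫
1 / (1 + t x) H(dx)`. Its solution is `exp (-σ L)` with `L' = ∫ x / (1 + t x) H(dx)`. -/
lemma stickTransform_dirichlet_of_le {τ B : ℝ} (hτ : 0 < τ) (hB : 0 ≤ B) (H : Measure ℝ)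
    [IsProbabilityMeasure H] (hH0 : H (Iio 0) = 0) (hH : ∀ᵐ x ∂H, x ≤ B) {s : ℝ} (hs : 0 < s) :
    stickTransform τ 0 τ H s = ENNReal.ofReal (Real.exp (-(τ * (logT H s).toReal))) := by
  have h0 := ae_nonneg_of_Iio hH0
  let L : ℝ → ℝ := fun t => ∫ x, Real.log (1 + t * x) ∂H
  have hlog_nonneg : ∀ t x : ℝ, 0 ≤ t → 0 ≤ x → 0 ≤ Real.log (1 + t * x) := fun t x ht hx =>
    Real.log_nonneg (by nlinarith [mul_nonneg ht hx])
  have hlog_le : ∀ t x : ℝ, 0 ≤ t → 0 ≤ x → x ≤ B → Real.log (1 + t * x) ≤ t * B := by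
    intro t x ht hx hxB
    have h1 := Real.log_le_sub_one_of_pos (by nlinarith [mul_nonneg ht hx] : 0 < 1 + t * x)
    nlinarith
  have hL : ∀ t, 0 ≤ t → L t = (logT H t).toReal := by
    intro t ht
    simp only [L, logT]
    rw [integral_eq_lintegral_of_nonneg_ae _ (Measurable.aestronglyMeasurable (by fun_prop))]
    filter_upwards [h0] with x hx using hlog_nonneg t x ht hx
  have hint : ∀ t, 0 ≤ t → Integrable (fun x => Real.log (1 + t * x)) H := by
    intro t ht
    refine Integrable.of_bound (C := t * B) (Measurable.aestronglyMeasurable (by fun_prop)) ?_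
    filter_upwards [h0, hH] with x hx hxB
    rw [Real.norm_of_nonneg (hlog_nonneg t x ht hx)]
    exact hlog_le t x ht hx hxB
  have hL0 : ∀ t, 0 ≤ t → 0 ≤ L t := fun t ht => by rw [hL t ht]; exact ENNReal.toReal_nonneg
  have hLB : ∀ t, 0 ≤ t → L t ≤ t * B := by
    intro t ht
    calc L t ≤ ∫ _, t * B ∂H := by
          refine integral_mono_ae (hint t ht) (integrable_const _) ?_
          filter_upwards [h0, hH] with x hx hxB using hlog_le t x ht hx hxB
      _ = t * B := by simp
  have hLd : ∀ t, 0 < t → HasDerivAt L (∫ x, x / (1 + t * x) ∂H) t := by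
    intro t ht
    refine (hasDerivAt_integral_of_dominated_loc_of_deriv_le (bound := fun _ => B)
      (F' := fun t x => x / (1 + t * x)) (Ioi_mem_nhds ht) ?_ (hint t ht.le) (Measurable.aestronglyMeasurable (by fun_prop)) ?_
      (integrable_const _) ?_).2
    · exact Eventually.of_forall fun _ => Measurable.aestronglyMeasurable (by fun_prop)
    · filter_upwards [h0, hH] with x hx hxB u hu
      have hu' : (0 : ℝ) < u := hu
      have h1 : 1 ≤ 1 + u * x := by nlinarith [mul_nonneg hu'.le hx]
      rw [Real.norm_of_nonneg (by positivity)]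
      exact (div_le_self hx h1).trans hxB
    · filter_upwards [h0] with x hx u hu
      have hu' : (0 : ℝ) < u := hu
      have h1 : 0 < 1 + u * x := by nlinarith [mul_nonneg hu'.le hx]
      have h2 : HasDerivAt (fun t : ℝ => 1 + t * x) x u := by
        simpa using ((hasDerivAt_id u).mul_const x).const_add 1
      exact h2.log h1.ne'
  have hLc : ∀ s, ContinuousOn L (Icc 0 s) := by
    intro s
    refine continuousOn_of_dominated (bound := fun _ => s * B) (fun t _ => Measurable.aestronglyMeasurable (by fun_prop)) ?_
      (integrable_const _) ?_
    · intro t ht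
      filter_upwards [h0, hH] with x hx hxB
      rw [Real.norm_of_nonneg (hlog_nonneg t x ht.1 hx)]
      exact (hlog_le t x ht.1 hx hxB).trans (mul_le_mul_of_nonneg_right ht.2 hB)
    · filter_upwards [h0] with x hx
      refine ContinuousOn.log (by fun_prop) fun t ht => ?_
      nlinarith [mul_nonneg ht.1 hx]
  rw [← hL s hs.le]
  have hsti : ∀ t, 0 < t → sti (1 - 0) H t = ENNReal.ofReal (∫ x, 1 / (1 + t * x) ∂H) := by
    intro t ht
    rw [sti, ofReal_integral_eq_lintegral_ofReal]
    · refine lintegral_congr_ae ?_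
      filter_upwards [h0] with x hx
      have h1 : 0 < 1 + t * x := by nlinarith [mul_nonneg ht.le hx]
      rw [sub_zero, Real.rpow_neg_one, one_div]
    · refine Integrable.of_bound (C := 1) (Measurable.aestronglyMeasurable (by fun_prop)) ?_
      filter_upwards [h0] with x hx
      have h1 : 1 ≤ 1 + t * x := by nlinarith [mul_nonneg ht.le hx]
      rw [Real.norm_of_nonneg (by positivity)]
      exact div_le_self zero_le_one h1
    · filter_upwards [h0] with x hx
      have h1 : 1 ≤ 1 + t * x := by nlinarith [mul_nonneg ht.le hx]
      show 0 ≤ _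
      positivity
  have hI0 : ∀ t, 0 < t → 0 ≤ ∫ x, 1 / (1 + t * x) ∂H := by
    intro t ht
    refine integral_nonneg_of_ae ?_
    filter_upwards [h0] with x hx
    have h1 : 1 ≤ 1 + t * x := by nlinarith [mul_nonneg ht.le hx]
    show 0 ≤ _
    positivity
  -- Integrating `1 - t x / (1 + t x) = 1 / (1 + t x)` is what makes the exponential satisfy the
  -- ODE.
  have hrel : ∀ t, 0 < t → 1 - t * ∫ x, x / (1 + t * x) ∂H = ∫ x, 1 / (1 + t * x) ∂H := by
    intro t ht
    rw [← integral_const_mul]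
    have h1 : ∫ _, (1 : ℝ) ∂H = 1 := by simp
    nth_rewrite 1 [← h1]
    rw [← integral_sub (integrable_const _)]
    · refine integral_congr_ae ?_
      filter_upwards [h0] with x hx
      have h1 : 0 < 1 + t * x := by nlinarith [mul_nonneg ht.le hx]
      field_simp
      ring
    · refine Integrable.of_bound (C := 1) (Measurable.aestronglyMeasurable (by fun_prop)) ?_
      filter_upwards [h0] with x hx
      have h1 : 0 < 1 + t * x := by nlinarith [mul_nonneg ht.le hx]
      rw [Real.norm_of_nonneg (by positivity), ← mul_div_assoc, div_le_one h1]
      linarith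
  refine stickTransform_eq_of_hardyOp le_rfl zero_lt_one hτ hB H hH0 hH
    (G := fun σ s => ENNReal.ofReal (Real.exp (-(σ * L s)))) ?_ ?_ ?_ hs
  · intro σ s hσ hs
    have hcongr : hardyOp σ (fun t => sti (1 - 0) H t *
        ENNReal.ofReal (Real.exp (-((σ + 0) * L t)))) s =
        hardyOp σ (fun t => ENNReal.ofReal ((∫ x, 1 / (1 + t * x) ∂H) *
          Real.exp (-(σ * L t)))) s := by
      unfold hardyOp
      congr 1
      refine setLIntegral_congr_fun measurableSet_Ioc fun t ht => ?_
      simp only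
      rw [hsti t ht.1, ← ENNReal.ofReal_mul (hI0 t ht.1), add_zero]
    rw [hcongr]
    refine hardyOp_eq_of_hasDerivAt hσ hs (g := fun t => Real.exp (-(σ * L t)))
      (g' := fun t => Real.exp (-(σ * L t)) * (-(σ * ∫ x, x / (1 + t * x) ∂H))) ?_ ?_ ?_ ?_
    · exact Real.continuous_exp.comp_continuousOn ((continuousOn_const.mul (hLc s)).neg)
    · intro t ht
      exact ((hLd t ht.1).const_mul σ).neg.exp
    · intro t ht
      exact mul_nonneg (hI0 t ht) (Real.exp_pos _).le
    · intro t ht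
      rw [← hrel t ht]
      ring
  · intro σ s hσ hs
    rw [← ENNReal.ofReal_one]
    refine ENNReal.ofReal_le_ofReal ?_
    have := mul_nonneg hσ.le (hL0 s hs.le)
    simpa using this
  · intro σ s hσ hs
    rw [← ENNReal.ofReal_add (Real.exp_pos _).le (by positivity), ← ENNReal.ofReal_one]
    refine ENNReal.ofReal_le_ofReal ?_
    have h1 := Real.add_one_le_exp (-(σ * L s))
    have h2 := mul_le_mul_of_nonneg_left (hLB s hs.le) hσ.le
    nlinarith

lemma tendsto_stickSum_min {v w : ℕ → ℝ} (hv : ∀ k, v k ∈ Ioo (0 : ℝ) 1) :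
    Tendsto (fun n : ℕ => stickSum v fun k => min (w k) n) atTop (𝓝 (stickSum v w)) := by
  unfold stickSum
  -- As an integral against counting measure, the series is accessible to monotone convergence.
  simp_rw [← lintegral_count]
  have hP := stickWeight_nonneg fun k => Ioo_subset_Icc_self (hv k)
  refine lintegral_tendsto_of_tendsto_of_monotone (fun n => by fun_prop) ?_ ?_
  · refine ae_of_all _ fun k n m hnm => ENNReal.ofReal_le_ofReal ?_
    exact mul_le_mul_of_nonneg_left (min_le_min_left _ (by exact_mod_cast hnm)) (hP k)
  · refine ae_of_all _ fun k => tendsto_const_nhds.congr' ?_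
    obtain ⟨N, hN⟩ := exists_nat_ge (w k)
    filter_upwards [eventually_ge_atTop N] with n hn
    rw [min_eq_left (hN.trans (by exact_mod_cast hn))]

lemma continuous_one_add_mul_rpow {c : ℝ≥0∞} (hc : c ≠ ∞) (p : ℝ) :
    Continuous fun x : ℝ≥0∞ => (1 + c * x) ^ p := by
  refine ENNReal.continuous_rpow_const.comp ?_
  exact continuous_const.add (ENNReal.continuous_const_mul hc)

/-- The Cifarelli-Regazzini identity for the stick-breaking mean. -/
lemma stickTransform_dirichlet {τ : ℝ} (hτ : 0 < τ) (H : Measure ℝ)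
    [IsProbabilityMeasure H] (hH0 : H (Iio 0) = 0) {s : ℝ} (hs : 0 < s) (hfin : logT H s ≠ ∞) :
    stickTransform τ 0 τ H s = ENNReal.ofReal (Real.exp (-(τ * (logT H s).toReal))) := by
  have h0 := ae_nonneg_of_Iio hH0
  have hsp := isProbabilityMeasure_stickFractions le_rfl zero_lt_one hτ (α := 0)
  -- The base law is truncated at `n`: the bounded case applies to `min x n`, the transform
  -- converges by dominated convergence and the logarithmic integral by monotone convergence.
  have hmn : ∀ n : ℕ, Measurable fun x : ℝ => min x n := fun n => by fun_prop
  have hpr : ∀ n : ℕ, IsProbabilityMeasure (H.map fun x => min x (n : ℝ)) := fun n =>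
    Measure.isProbabilityMeasure_map (hmn n).aemeasurable
  have hbdd : ∀ n : ℕ, stickTransform τ 0 τ (H.map fun x => min x (n : ℝ)) s =
      ENNReal.ofReal (Real.exp (-(τ * (logT (H.map fun x => min x (n : ℝ)) s).toReal))) := by
    intro n
    refine stickTransform_dirichlet_of_le hτ (Nat.cast_nonneg n) _ ?_ ?_ hs
    · refine measure_Iio_of_ae_nonneg
        ((ae_map_iff (hmn n).aemeasurable measurableSet_Ici).2 ?_)
      filter_upwards [h0] with x hx using le_min hx (Nat.cast_nonneg n)
    · refine (ae_map_iff (hmn n).aemeasurable measurableSet_Iic).2 (ae_of_all _ fun x => ?_)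
      exact min_le_right _ _
  have hlhs : Tendsto (fun n : ℕ => stickTransform τ 0 τ (H.map fun x => min x (n : ℝ)) s) atTop
      (𝓝 (stickTransform τ 0 τ H s)) := by
    have e : ∀ n : ℕ, stickTransform τ 0 τ (H.map fun x => min x (n : ℝ)) s =
        ∫⁻ ω, (1 + ENNReal.ofReal s * stickSum ω.1 fun k => min (ω.2 k) n) ^ (-τ)
          ∂((stickFractions 0 τ).prod (Measure.infinitePi fun _ : ℕ => H)) := by
      intro n
      rw [stickTransform, ← Measure.infinitePi_map_pi (fun _ : ℕ => H) (fun _ => hmn n),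
        lintegral_prod _ (by fun_prop), lintegral_prod]
      · refine lintegral_congr fun v => ?_
        have hmv : Measurable fun w => stickSum v w :=
          measurable_stickSum.comp (measurable_const.prodMk measurable_id)
        rw [lintegral_map (by fun_prop) (by fun_prop)]
      · have : Measurable fun ω : (ℕ → ℝ) × (ℕ → ℝ) => stickSum ω.1 fun k => min (ω.2 k) n :=
          measurable_stickSum.comp (f := fun ω : (ℕ → ℝ) × (ℕ → ℝ) =>
            (ω.1, fun k => min (ω.2 k) (n : ℝ))) (by fun_prop)
        fun_prop
    simp_rw [e]
    refine tendsto_lintegral_of_dominated_convergence (fun _ => 1) (fun n => ?_) (fun n => ?_) ?_ ?_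
    · have : Measurable fun ω : (ℕ → ℝ) × (ℕ → ℝ) => stickSum ω.1 fun k => min (ω.2 k) n :=
        measurable_stickSum.comp (f := fun ω : (ℕ → ℝ) × (ℕ → ℝ) =>
          (ω.1, fun k => min (ω.2 k) (n : ℝ))) (by fun_prop)
      fun_prop
    · exact ae_of_all _ fun ω => one_add_rpow_neg_le_one _ hτ
    · simp
    · have hv := (Measure.quasiMeasurePreserving_fst (μ := stickFractions 0 τ)
          (ν := Measure.infinitePi fun _ : ℕ => H)).ae
          (stickFractions_ae le_rfl zero_lt_one hτ)
      filter_upwards [hv] with ω hω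
      exact ((continuous_one_add_mul_rpow ENNReal.ofReal_ne_top (-τ)).tendsto _).comp
        (tendsto_stickSum_min hω)
  have hlog : Tendsto (fun n : ℕ => logT (H.map fun x => min x (n : ℝ)) s) atTop
      (𝓝 (logT H s)) := by
    have e : ∀ n : ℕ, logT (H.map fun x => min x (n : ℝ)) s =
        ∫⁻ x, ENNReal.ofReal (Real.log (1 + s * min x n)) ∂H := fun n => by
      rw [logT, lintegral_map (by fun_prop) (hmn n)]
    simp_rw [e]
    refine lintegral_tendsto_of_tendsto_of_monotone (fun n => by fun_prop) ?_ ?_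
    · filter_upwards [h0] with x hx n m hnm
      refine ENNReal.ofReal_le_ofReal (Real.log_le_log ?_ ?_)
      · have := mul_nonneg hs.le (le_min hx (Nat.cast_nonneg n))
        linarith
      · have : min x (n : ℝ) ≤ min x m := min_le_min_left _ (by exact_mod_cast hnm)
        nlinarith
    · refine ae_of_all _ fun x => tendsto_const_nhds.congr' ?_
      obtain ⟨N, hN⟩ := exists_nat_ge x
      filter_upwards [eventually_ge_atTop N] with n hn
      rw [min_eq_left (hN.trans (by exact_mod_cast hn))]
  refine tendsto_nhds_unique hlhs ?_
  simp_rw [hbdd]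
  refine ENNReal.tendsto_ofReal ((Real.continuous_exp.tendsto _).comp ?_)
  exact ((ENNReal.tendsto_toReal hfin).comp hlog).const_mul τ |>.neg

lemma tendsto_logT_zero {ν : Measure ℝ} (h0 : ν (Iio 0) = 0) (hfin : logT ν 1 ≠ ∞) :
    Tendsto (fun n : ℕ => logT ν (1 / ((n : ℝ) + 1))) atTop (𝓝 0) := by
  have h : Tendsto (fun n : ℕ => logT ν (1 / ((n : ℝ) + 1))) atTop (𝓝 (∫⁻ _, 0 ∂ν)) := by
    refine tendsto_lintegral_of_dominated_convergence
      (fun x => ENNReal.ofReal (Real.log (1 + 1 * x))) (fun n => by fun_prop) (fun n => ?_) hfin ?_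
    · filter_upwards [ae_nonneg_of_Iio h0] with x hx
      have h1 : 1 / ((n : ℝ) + 1) ≤ 1 := by
        rw [div_le_one (by positivity)]
        linarith [Nat.cast_nonneg (α := ℝ) n]
      refine ENNReal.ofReal_le_ofReal (Real.log_le_log (by positivity) ?_)
      nlinarith
    · refine ae_of_all _ fun x => ?_
      have h1 : Tendsto (fun n : ℕ => 1 + 1 / ((n : ℝ) + 1) * x) atTop (𝓝 (1 + 0 * x)) :=
        (tendsto_one_div_add_atTop_nhds_zero_nat.mul_const x).const_add 1
      have h2 := ENNReal.tendsto_ofReal (h1.log (by simp))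
      simpa using h2
  simpa using h

/-- The integrand of the transform vanishes where the series is infinite, so the transform is at
most the probability of convergence. By the identity just proved it tends to `1` as `s → 0`. -/
lemma ae_stickSum_ne_top {τ : ℝ} (hτ : 0 < τ) (H : Measure ℝ)
    [IsProbabilityMeasure H] (hH0 : H (Iio 0) = 0) (hfin : ∀ s, 0 < s → logT H s ≠ ∞) :
    ∀ᵐ ω ∂((stickFractions 0 τ).prod (Measure.infinitePi fun _ : ℕ => H)),
      stickSum ω.1 ω.2 ≠ ∞ := by
  have hsp := isProbabilityMeasure_stickFractions le_rfl zero_lt_one hτ (α := 0)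
  set P := (stickFractions 0 τ).prod (Measure.infinitePi fun _ : ℕ => H)
  have hms : MeasurableSet {ω : (ℕ → ℝ) × (ℕ → ℝ) | stickSum ω.1 ω.2 ≠ ∞} :=
    measurable_stickSum (measurableSet_singleton ∞).compl
  have h1 : Tendsto (fun n : ℕ => stickTransform τ 0 τ H (1 / ((n : ℝ) + 1))) atTop (𝓝 1) := by
    have e : ∀ n : ℕ, stickTransform τ 0 τ H (1 / ((n : ℝ) + 1)) = _ := fun n =>
      stickTransform_dirichlet hτ H hH0 (s := 1 / ((n : ℝ) + 1)) (by positivity)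
        (hfin _ (by positivity))
    simp_rw [e]
    have h2 := ((ENNReal.tendsto_toReal ENNReal.zero_ne_top).comp
      (tendsto_logT_zero hH0 (hfin 1 one_pos))).const_mul τ |>.neg
    have h3 := ENNReal.tendsto_ofReal ((Real.continuous_exp.tendsto _).comp h2)
    simpa using h3
  have hle : (1 : ℝ≥0∞) ≤ P {ω | stickSum ω.1 ω.2 ≠ ∞} := by
    refine le_of_tendsto' h1 fun n => ?_
    rw [← lintegral_indicator_one hms]
    refine lintegral_mono fun ω => ?_
    by_cases h : stickSum ω.1 ω.2 = ∞
    · simp only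
      rw [h, one_add_mul_top_rpow (by positivity) hτ]
      exact zero_le
    · rw [indicator_of_mem (by exact h)]
      exact one_add_rpow_neg_le_one _ hτ
  have := (prob_compl_eq_zero_iff hms).2 (le_antisymm prob_le_one hle)
  rw [ae_iff]
  exact this

lemma dirichletMean_eq (θ : ℝ) (H : Measure ℝ) : dirichletMean θ H =
    ((stickFractions 0 θ).prod (Measure.infinitePi fun _ : ℕ => H)).map fun ω =>
      (stickSum ω.1 ω.2).toReal := rfl

lemma isNonnegLaw_dirichletMean {θ : ℝ} (hθ : 0 < θ) (H : Measure ℝ) [IsProbabilityMeasure H] :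
    IsNonnegLaw (dirichletMean θ H) := by
  have hsp := isProbabilityMeasure_stickFractions le_rfl zero_lt_one hθ (α := 0)
  have hm : Measurable fun ω : (ℕ → ℝ) × (ℕ → ℝ) => (stickSum ω.1 ω.2).toReal := by fun_prop
  rw [dirichletMean_eq]
  refine ⟨Measure.isProbabilityMeasure_map hm.aemeasurable, ?_⟩
  refine measure_Iio_of_ae_nonneg ((ae_map_iff hm.aemeasurable measurableSet_Ici).2 ?_)
  exact ae_of_all _ fun ω => ENNReal.toReal_nonneg

/-- The Cifarelli-Regazzini identity. -/
lemma sti_dirichletMean {θ : ℝ} (hθ : 0 < θ) (H : Measure ℝ)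
    [IsProbabilityMeasure H] (hH0 : H (Iio 0) = 0) (hfin : ∀ s, 0 < s → logT H s ≠ ∞)
    {l : ℝ} (hl : 0 < l) :
    sti θ (dirichletMean θ H) l = ENNReal.ofReal (Real.exp (-(θ * (logT H l).toReal))) := by
  rw [← stickTransform_dirichlet hθ H hH0 hl (hfin l hl), sti, dirichletMean_eq,
    lintegral_map (by fun_prop) (by fun_prop), stickTransform]
  refine lintegral_congr_ae ?_
  filter_upwards [ae_stickSum_ne_top hθ H hH0 hfin] with ω hω
  rw [← one_add_mul_rpow hl.le ENNReal.toReal_nonneg, ENNReal.ofReal_toReal hω]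

/-! ### Contour integral for the density of `rho` -/

/-- The function `ζ ↦ 1 / (1 + exp (a ζ))`. -/
noncomputable def logisticC (a : ℝ) (z : ℂ) : ℂ := 1 / (1 + Complex.exp (a * z))

lemma one_add_exp_ne_zero {a : ℝ} {z : ℂ} (h : |a * z.im| < Real.pi) :
    1 + Complex.exp (a * z) ≠ 0 := by
  intro h0
  have h1 : Complex.exp (a * z) = Complex.exp (Real.pi * Complex.I) := by
    rw [Complex.exp_pi_mul_I]; linear_combination h0
  obtain ⟨n, hn⟩ := Complex.exp_eq_exp_iff_exists_int.1 h1
  have him := congrArg Complex.im hn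
  simp at him
  have hpi := Real.pi_pos
  rw [him, show Real.pi + n * (2 * Real.pi) = Real.pi * (1 + 2 * n) by ring, abs_mul,
    abs_of_pos hpi] at h
  have h2 : |(1 : ℝ) + 2 * n| < 1 := by
    by_contra hc
    nlinarith
  have h3 : |(1 : ℤ) + 2 * n| < 1 := by exact_mod_cast h2
  have h4 := Int.abs_lt_one_iff.1 h3
  omega

lemma one_sub_exp_ne_zero {z : ℂ} (h : |z.im| ≤ Real.pi) (hz : z ≠ 0) :
    1 - Complex.exp z ≠ 0 := by
  intro h0
  have h1 : Complex.exp z = 1 := by linear_combination -h0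
  obtain ⟨n, hn⟩ := Complex.exp_eq_one_iff.1 h1
  have him := congrArg Complex.im hn
  simp at him
  have hpi := Real.pi_pos
  have hn0 : n ≠ 0 := by
    rintro rfl
    exact hz (by simpa using hn)
  have h2 : (1 : ℝ) ≤ |(n : ℝ)| := by exact_mod_cast Int.one_le_abs hn0
  rw [him, abs_mul, abs_of_pos (by positivity : 0 < 2 * Real.pi)] at h
  nlinarith

/-- The integrand of the contour integral computing the Stieltjes transform of `rho`. -/
noncomputable def stripKernel (a s : ℝ) (z : ℂ) : ℂ :=
  (logisticC a z - logisticC a s) / (1 - Complex.exp (z - s))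

/-- In the strip `|Im z| ≤ π` the denominator vanishes only at `s`, where the numerator vanishes
too, and `a < 1` pushes the poles of the logistic function to `|Im z| ≥ π / a > π`. Cauchy's theorem
applies on the rectangle. -/
lemma rect_integral_stripKernel {a s R : ℝ} (ha0 : 0 < a) (ha1 : a < 1) (hR : |s| < R) :
    (∫ x in (-R)..R, stripKernel a s (x - Real.pi * Complex.I)) -
      (∫ x in (-R)..R, stripKernel a s (x + Real.pi * Complex.I)) +
      Complex.I * (∫ y in (-Real.pi)..Real.pi, stripKernel a s (R + y * Complex.I)) -
      Complex.I * (∫ y in (-Real.pi)..Real.pi, stripKernel a s (-R + y * Complex.I)) = 0 := by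
  have hpi := Real.pi_pos
  have hs := abs_lt.1 hR
  let U : Set ℂ := {z | |a * z.im| < Real.pi}
  have hU : IsOpen U := isOpen_lt (by fun_prop) continuous_const
  have hsU : (s : ℂ) ∈ U := by simp [U, hpi]
  let E : ℂ → ℂ := fun z => Complex.exp (z - s)
  -- The quotient of divided differences at `s` is the holomorphic extension of the kernel across
  -- its removable singularity.
  let g : ℂ → ℂ := fun z => -(dslope (logisticC a) s z) / dslope E s z
  have hsub : ∀ z : ℂ, |z.im| ≤ Real.pi → z ∈ U := by
    intro z hz
    simp only [U, mem_ofPred_eq, abs_mul, abs_of_pos ha0]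
    nlinarith [abs_nonneg z.im]
  have hφ : DifferentiableOn ℂ (logisticC a) U := by
    intro z hz
    unfold logisticC
    refine DifferentiableAt.differentiableWithinAt ?_
    exact (differentiableAt_const _).div (by fun_prop) (one_add_exp_ne_zero hz)
  have hE : DifferentiableOn ℂ E U := by
    have : Differentiable ℂ E := by fun_prop
    exact this.differentiableOn
  have hdφ := (Complex.differentiableOn_dslope (hU.mem_nhds hsU)).2 hφ
  have hdE := (Complex.differentiableOn_dslope (hU.mem_nhds hsU)).2 hE
  have hne : ∀ z : ℂ, |z.im| ≤ Real.pi → dslope E s z ≠ 0 := by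
    intro z hz
    by_cases hzs : z = s
    · subst hzs
      rw [dslope_same]
      have : HasDerivAt E (Complex.exp (s - s) * 1) s :=
        (Complex.hasDerivAt_exp _).comp (s : ℂ) ((hasDerivAt_id _).sub_const _)
      rw [this.deriv]
      simp
    · rw [dslope_of_ne _ hzs, slope_def_field]
      have h1 := one_sub_exp_ne_zero (z := z - s) (by simpa using hz) (sub_ne_zero.2 hzs)
      refine div_ne_zero ?_ (sub_ne_zero.2 hzs)
      simp only [E, sub_self, Complex.exp_zero]
      intro h2
      exact h1 (by linear_combination -h2)
  have hg : ∀ z : ℂ, z ≠ s → g z = stripKernel a s z := by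
    intro z hz
    have hz' := sub_ne_zero.2 hz
    simp only [g, stripKernel]
    rw [dslope_of_ne _ hz, dslope_of_ne _ hz, slope_def_field, slope_def_field]
    simp only [E, sub_self, Complex.exp_zero]
    rw [← neg_sub (Complex.exp (z - s)) 1, div_neg, neg_div, div_div_div_cancel_right₀ hz']
  have hrect := Complex.integral_boundary_rect_eq_zero_of_differentiableOn g
    (⟨-R, -Real.pi⟩ : ℂ) (⟨R, Real.pi⟩ : ℂ) (by
      intro z hz
      have him : z.im ∈ uIcc (-Real.pi) Real.pi := hz.2
      rw [uIcc_of_le (by linarith), mem_Icc, ← abs_le] at him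
      have hzU := hsub z him
      exact (((hdφ z hzU).differentiableAt (hU.mem_nhds hzU)).neg.div
        ((hdE z hzU).differentiableAt (hU.mem_nhds hzU)) (hne z him)).differentiableWithinAt)
  simp only [smul_eq_mul] at hrect
  have e1 : ∀ x : ℝ, g (x + (-Real.pi : ℝ) * Complex.I) =
      stripKernel a s (x - Real.pi * Complex.I) := by
    intro x
    rw [hg]
    · congr 1; push_cast; ring
    · intro h
      have := congrArg Complex.im h
      simp at this
  have e2 : ∀ x : ℝ, g (x + Real.pi * Complex.I) =
      stripKernel a s (x + Real.pi * Complex.I) := by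
    intro x
    rw [hg]
    intro h
    have := congrArg Complex.im h
    simp at this
  have e3 : ∀ y : ℝ, g (R + y * Complex.I) = stripKernel a s (R + y * Complex.I) := by
    intro y
    rw [hg]
    intro h
    have := congrArg Complex.re h
    simp at this
    linarith
  have e4 : ∀ y : ℝ, g ((-R : ℝ) + y * Complex.I) = stripKernel a s (-R + y * Complex.I) := by
    intro y
    rw [hg]
    · congr 1; push_cast; ring
    · intro h
      have := congrArg Complex.re h
      simp at this
      linarith
  simp_rw [e1, e2, e3, e4] at hrect
  exact hrect

/-- Convergence along `atTop ×ˢ ⊤` is uniform in the second variable, here the height on a vertical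
side of the rectangle. -/
lemma tendsto_exp_uniform {c : ℝ} (hc : 0 < c) (d : ℝ) : Tendsto
    (fun p : ℝ × ℝ => Complex.exp (-(c * (p.1 + p.2 * Complex.I) + d))) (atTop ×ˢ ⊤) (𝓝 0) := by
  rw [tendsto_zero_iff_norm_tendsto_zero]
  have e : ∀ p : ℝ × ℝ, ‖Complex.exp (-(c * (p.1 + p.2 * Complex.I) + d))‖ =
      Real.exp (-(c * p.1 + d)) := by
    intro p
    rw [Complex.norm_exp]
    simp
  simp_rw [e]
  refine Real.tendsto_exp_neg_atTop_nhds_zero.comp ?_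
  exact tendsto_atTop_add_const_right _ _ (tendsto_fst.const_mul_atTop hc)

lemma tendsto_integral_of_uniform {f : ℝ → ℝ → ℂ} {c : ℂ} (hm : ∀ R, Measurable (f R))
    (h : Tendsto (fun p : ℝ × ℝ => f p.1 p.2) (atTop ×ˢ ⊤) (𝓝 c)) (a b : ℝ) :
    Tendsto (fun R => ∫ y in a..b, f R y) atTop (𝓝 (∫ _ in a..b, c)) := by
  have hu : TendstoUniformly f (fun _ => c) atTop := tendsto_prod_top_iff.1 h
  refine intervalIntegral.tendsto_integral_filter_of_dominated_convergence (fun _ => ‖c‖ + 1)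
    (Eventually.of_forall fun R => (hm R).aestronglyMeasurable) ?_ (by simp) ?_
  · filter_upwards [Metric.tendstoUniformly_iff.1 hu 1 one_pos] with R hR
    refine ae_of_all _ fun y _ => ?_
    have := hR y
    rw [dist_eq_norm] at this
    have h2 := norm_sub_norm_le (f R y) c
    rw [norm_sub_rev] at h2
    linarith
  · exact ae_of_all _ fun y _ => hu.tendsto_at y

lemma measurable_stripKernel (a s : ℝ) : Measurable (stripKernel a s) := by
  unfold stripKernel logisticC
  fun_prop

lemma tendsto_stripKernel_right {a : ℝ} (s : ℝ) (ha : 0 < a) :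
    Tendsto (fun R : ℝ => ∫ y in (-Real.pi)..Real.pi, stripKernel a s (R + y * Complex.I)) atTop
      (𝓝 0) := by
  have h1 := tendsto_exp_uniform ha 0
  have h2 := tendsto_exp_uniform one_pos (-s)
  -- Both factors are rewritten through decaying exponentials: `1 / (1 + e ^ w) = e ^ (-w) / (e ^
  -- (-w) + 1)` and `1 / (1 - e ^ w) = e ^ (-w) / (e ^ (-w) - 1)`.
  have h3 : Tendsto (fun p : ℝ × ℝ => stripKernel a s (p.1 + p.2 * Complex.I)) (atTop ×ˢ ⊤)
      (𝓝 ((0 / (0 + 1) - logisticC a s) * (0 / (0 - 1)))) := by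
    refine (((h1.div (h1.add_const 1) (by simp)).sub_const (logisticC a s)).mul
      (h2.div (h2.sub_const 1) (by simp))).congr fun p => ?_
    unfold stripKernel
    rw [div_eq_mul_one_div (_ - _) (1 - _)]
    congr 1
    · unfold logisticC
      congr 1
      rw [Pi.div_apply, Complex.exp_neg]
      have := Complex.exp_ne_zero (a * (p.1 + p.2 * Complex.I) + (0 : ℝ))
      field_simp
      simp [add_comm]
    · rw [Pi.div_apply, Complex.exp_neg]
      have := Complex.exp_ne_zero ((1 : ℝ) * (p.1 + p.2 * Complex.I) + (-s : ℝ))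
      field_simp
      simp [sub_eq_add_neg]
  have h4 := tendsto_integral_of_uniform (f := fun R y => stripKernel a s (R + y * Complex.I))
    (fun R => (measurable_stripKernel a s).comp (by fun_prop)) h3 (-Real.pi) Real.pi
  simpa using h4

lemma tendsto_stripKernel_left {a : ℝ} (s : ℝ) (ha : 0 < a) :
    Tendsto (fun R : ℝ => ∫ y in (-Real.pi)..Real.pi, stripKernel a s (-R + y * Complex.I)) atTop
      (𝓝 (2 * Real.pi * (1 - logisticC a s))) := by
  -- Replacing `(R, y)` by `(R, -y)` and negating turns points of the right side into points `-R + i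
  -- y` of the left side, so the same decay estimate applies.
  have hsw : Tendsto (fun p : ℝ × ℝ => (p.1, -p.2)) (atTop ×ˢ ⊤) (atTop ×ˢ ⊤) :=
    tendsto_fst.prodMk tendsto_top
  have h1 := (tendsto_exp_uniform ha 0).comp hsw
  have h2 := (tendsto_exp_uniform one_pos s).comp hsw
  have h3 : Tendsto (fun p : ℝ × ℝ => stripKernel a s (-p.1 + p.2 * Complex.I)) (atTop ×ˢ ⊤)
      (𝓝 ((1 / (1 + 0) - logisticC a s) / (1 - 0))) := by
    refine (((tendsto_const_nhds.div (h1.const_add 1) (by simp)).sub_const (logisticC a s)).div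
      (h2.const_sub 1) (by simp)).congr fun p => ?_
    unfold stripKernel logisticC
    simp only [Pi.div_apply, Function.comp_apply]
    have e1 : -((a : ℂ) * (p.1 + (-p.2 : ℝ) * Complex.I) + (0 : ℝ)) =
        a * (-p.1 + p.2 * Complex.I) := by push_cast; ring
    have e2 : -(((1 : ℝ) : ℂ) * (p.1 + (-p.2 : ℝ) * Complex.I) + s) =
        -p.1 + p.2 * Complex.I - s := by push_cast; ring
    rw [e1, e2]
  have h4 := tendsto_integral_of_uniform (f := fun R y => stripKernel a s (-R + y * Complex.I))
    (fun R => (measurable_stripKernel a s).comp (by fun_prop)) h3 (-Real.pi) Real.pi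
  convert h4 using 2
  simp
  ring

/-- The density of `-log X`, where `X` has law `rho a`. -/
noncomputable def logRho (a x : ℝ) : ℝ :=
  Real.sin (Real.pi * a) / Real.pi *
    (Real.exp (a * x) / (Real.exp (a * x) ^ 2 + 2 * Real.exp (a * x) * Real.cos (Real.pi * a) + 1))

/-- Completing the square gives `(u + r cos (π a)) ^ 2 + r ^ 2 sin (π a) ^ 2`. -/
lemma quad_pos {a r : ℝ} (ha0 : 0 < a) (ha1 : a < 1) (hr : 0 < r) (u : ℝ) :
    0 < u ^ 2 + 2 * u * r * Real.cos (Real.pi * a) + r ^ 2 := by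
  have hpi := Real.pi_pos
  have hs : 0 < Real.sin (Real.pi * a) :=
    Real.sin_pos_of_pos_of_lt_pi (by positivity) (by nlinarith)
  have h2 := Real.sin_sq_add_cos_sq (Real.pi * a)
  have h3 : 0 < r ^ 2 * Real.sin (Real.pi * a) ^ 2 := by positivity
  nlinarith [sq_nonneg (u + r * Real.cos (Real.pi * a))]

lemma sin_pi_mul_pos {a : ℝ} (ha0 : 0 < a) (ha1 : a < 1) : 0 < Real.sin (Real.pi * a) :=
  Real.sin_pos_of_pos_of_lt_pi (by have := Real.pi_pos; positivity)
    (by have := Real.pi_pos; nlinarith)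

lemma logRho_nonneg {a : ℝ} (ha0 : 0 < a) (ha1 : a < 1) (x : ℝ) : 0 ≤ logRho a x := by
  have h1 := quad_pos ha0 ha1 one_pos (Real.exp (a * x))
  have h2 := sin_pi_mul_pos ha0 ha1
  have := Real.pi_pos
  unfold logRho
  simp only [mul_one, one_pow] at h1
  positivity

/-- On both lines `Im z = ±π` the exponential in the denominator equals `-exp (x - s)`. Only the
logistic function jumps, and its jump is `2 π i` times `logRho`. -/
lemma stripKernel_sub {a s : ℝ} (ha0 : 0 < a) (ha1 : a < 1) (x : ℝ) :
    stripKernel a s (x - Real.pi * Complex.I) - stripKernel a s (x + Real.pi * Complex.I) =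
      2 * Real.pi * Complex.I * ((logRho a x * (1 / (1 + Real.exp (x - s))) : ℝ) : ℂ) := by
  have hpi := Real.pi_pos
  have hd1 : Complex.exp (x - Real.pi * Complex.I - s) = -Complex.exp (x - s) := by
    rw [show (x : ℂ) - Real.pi * Complex.I - s = x - s - Real.pi * Complex.I by ring,
      Complex.exp_sub, Complex.exp_pi_mul_I, div_neg, div_one]
  have hd2 : Complex.exp (x + Real.pi * Complex.I - s) = -Complex.exp (x - s) := by
    rw [show (x : ℂ) + Real.pi * Complex.I - s = x - s + Real.pi * Complex.I by ring,
      Complex.exp_add, Complex.exp_pi_mul_I]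
    ring
  set u : ℂ := Complex.exp (a * x) with hu
  set c : ℂ := Complex.cos (Real.pi * a) with hc
  set σ : ℂ := Complex.sin (Real.pi * a) with hσ
  have hcs : σ ^ 2 + c ^ 2 = 1 := Complex.sin_sq_add_cos_sq _
  have ha1' : Complex.exp (a * (x - Real.pi * Complex.I)) = u * (c - σ * Complex.I) := by
    rw [show (a : ℂ) * (x - Real.pi * Complex.I) = a * x + (-(Real.pi * a : ℂ)) * Complex.I by ring,
      Complex.exp_add, Complex.exp_mul_I, Complex.cos_neg, Complex.sin_neg]
    ring
  have ha2' : Complex.exp (a * (x + Real.pi * Complex.I)) = u * (c + σ * Complex.I) := by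
    rw [show (a : ℂ) * (x + Real.pi * Complex.I) = a * x + (Real.pi * a : ℂ) * Complex.I by ring,
      Complex.exp_add, Complex.exp_mul_I]
  have hn1 : 1 + u * (c - σ * Complex.I) ≠ 0 := by
    rw [← ha1']
    refine one_add_exp_ne_zero ?_
    simp [abs_mul, abs_of_pos ha0, abs_of_pos hpi]
    nlinarith
  have hn2 : 1 + u * (c + σ * Complex.I) ≠ 0 := by
    rw [← ha2']
    refine one_add_exp_ne_zero ?_
    simp [abs_mul, abs_of_pos ha0, abs_of_pos hpi]
    nlinarith
  have hprod : u ^ 2 + 2 * u * c + 1 = (1 + u * (c - σ * Complex.I)) *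
      (1 + u * (c + σ * Complex.I)) := by
    linear_combination (-u ^ 2) * hcs + u ^ 2 * σ ^ 2 * Complex.I_sq
  have key : 1 / (1 + u * (c - σ * Complex.I)) - 1 / (1 + u * (c + σ * Complex.I)) =
      2 * Complex.I * (σ * (u / (u ^ 2 + 2 * u * c + 1))) := by
    rw [hprod]
    field_simp
    ring
  unfold stripKernel
  rw [hd1, hd2, ← sub_div, sub_sub_sub_cancel_right]
  unfold logisticC
  rw [ha1', ha2', key]
  unfold logRho
  push_cast
  rw [← hu, ← hc, ← hσ]
  have : (Real.pi : ℂ) ≠ 0 := by exact_mod_cast hpi.ne'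
  rw [sub_neg_eq_add]
  field_simp

lemma intervalIntegrable_stripKernel {a s : ℝ} (ha0 : 0 < a) (ha1 : a < 1) {y : ℝ}
    (hy : |y| = Real.pi) (R R' : ℝ) :
    IntervalIntegrable (fun x : ℝ => stripKernel a s (x + y * Complex.I)) volume R R' := by
  refine Continuous.intervalIntegrable ?_ _ _
  unfold stripKernel logisticC
  have hpi := Real.pi_pos
  refine Continuous.div ?_ (by fun_prop) ?_
  · refine Continuous.sub (Continuous.div continuous_const (by fun_prop) fun x => ?_)
      continuous_const
    refine one_add_exp_ne_zero ?_
    simp [abs_mul, abs_of_pos ha0, hy]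
    nlinarith
  · intro x
    refine one_sub_exp_ne_zero (by simp [hy]) ?_
    intro h
    have := congrArg Complex.im h
    simp at this
    rw [this] at hy
    simp at hy
    linarith

/-- As `R → ∞` in the rectangle identity, the right side contributes nothing, the left side tends to
`2 π (1 - logisticC a s)`, and the horizontal sides combine into the integral sought. -/
lemma lintegral_logRho {a : ℝ} (ha0 : 0 < a) (ha1 : a < 1) (s : ℝ) :
    ∫⁻ x, ENNReal.ofReal (logRho a x * (1 / (1 + Real.exp (x - s)))) =
      ENNReal.ofReal (1 - 1 / (1 + Real.exp (a * s))) := by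
  have hpi := Real.pi_pos
  have hq : ∀ x, 0 ≤ logRho a x * (1 / (1 + Real.exp (x - s))) := fun x =>
    mul_nonneg (logRho_nonneg ha0 ha1 x) (by positivity)
  have hcont : Continuous fun x => logRho a x * (1 / (1 + Real.exp (x - s))) := by
    refine Continuous.mul ?_ (Continuous.div continuous_const (by fun_prop) fun x => ?_)
    · unfold logRho
      refine continuous_const.mul (Continuous.div (by fun_prop) (by fun_prop) fun x => ?_)
      have := quad_pos ha0 ha1 one_pos (Real.exp (a * x))
      simp only [mul_one, one_pow] at this
      exact this.ne'
    · positivity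
  have hid : ∀ R, |s| < R → ((∫ x in (-R)..R, logRho a x * (1 / (1 + Real.exp (x - s))) : ℝ) : ℂ) =
      (1 / (2 * Real.pi)) * ((∫ y in (-Real.pi)..Real.pi, stripKernel a s (-R + y * Complex.I)) -
        ∫ y in (-Real.pi)..Real.pi, stripKernel a s (R + y * Complex.I)) := by
    intro R hR
    have h := rect_integral_stripKernel ha0 ha1 hR
    have i1 := intervalIntegrable_stripKernel (s := s) ha0 ha1 (y := -Real.pi)
      (by rw [abs_neg, abs_of_pos hpi]) (-R) R
    have i2 := intervalIntegrable_stripKernel (s := s) ha0 ha1 (y := Real.pi)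
      (abs_of_pos hpi) (-R) R
    have e1 : (fun x : ℝ => stripKernel a s (x + (-Real.pi : ℝ) * Complex.I)) =
        fun x : ℝ => stripKernel a s (x - Real.pi * Complex.I) := by
      funext x; congr 1; push_cast; ring
    rw [e1] at i1
    rw [← intervalIntegral.integral_sub i1 i2] at h
    simp_rw [stripKernel_sub ha0 ha1] at h
    rw [intervalIntegral.integral_const_mul, intervalIntegral.integral_ofReal] at h
    have hI : Complex.I ≠ 0 := Complex.I_ne_zero
    have hp : (Real.pi : ℂ) ≠ 0 := by exact_mod_cast hpi.ne'
    have h' : 2 * (Real.pi : ℂ) *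
        ((∫ x in (-R)..R, logRho a x * (1 / (1 + Real.exp (x - s))) : ℝ) : ℂ) =
        (∫ y in (-Real.pi)..Real.pi, stripKernel a s (-R + y * Complex.I)) -
        ∫ y in (-Real.pi)..Real.pi, stripKernel a s (R + y * Complex.I) := by
      refine mul_left_cancel₀ hI ?_
      linear_combination h
    rw [← h']
    field_simp
  have hlimC : Tendsto (fun R => ((∫ x in (-R)..R, logRho a x * (1 / (1 + Real.exp (x - s))) : ℝ) : ℂ))
      atTop (𝓝 ((1 - 1 / (1 + Real.exp (a * s)) : ℝ) : ℂ)) := by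
    have h1 := ((tendsto_stripKernel_left s ha0).sub (tendsto_stripKernel_right s ha0)).const_mul
      (1 / (2 * Real.pi) : ℂ)
    have e : (1 / (2 * Real.pi) : ℂ) * (2 * Real.pi * (1 - logisticC a s) - 0) =
        ((1 - 1 / (1 + Real.exp (a * s)) : ℝ) : ℂ) := by
      have hp : (Real.pi : ℂ) ≠ 0 := by exact_mod_cast hpi.ne'
      unfold logisticC
      push_cast
      field_simp
      ring
    rw [e] at h1
    refine h1.congr' ?_
    filter_upwards [eventually_gt_atTop |s|] with R hR using (hid R hR).symm
  have hlim : Tendsto (fun R => ∫ x in (-R)..R, logRho a x * (1 / (1 + Real.exp (x - s))))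
      atTop (𝓝 (1 - 1 / (1 + Real.exp (a * s)))) := by
    have := (Complex.continuous_re.tendsto _).comp hlimC
    simpa only [Function.comp_def, Complex.ofReal_re] using this
  -- The integrand is nonnegative, so the limit over symmetric intervals is the full lower integral.
  have hcov : AECover (volume : Measure ℝ) atTop fun R : ℝ => Ioc (-R) R :=
    aecover_Ioc tendsto_neg_atTop_atBot tendsto_id
  have hl2 := hcov.lintegral_tendsto_of_countably_generated
    (f := fun x => ENNReal.ofReal (logRho a x * (1 / (1 + Real.exp (x - s)))))
    (hcont.measurable.ennreal_ofReal.aemeasurable)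
  refine tendsto_nhds_unique hl2 ((ENNReal.tendsto_ofReal hlim).congr' ?_)
  filter_upwards [eventually_ge_atTop 0] with R hR
  rw [intervalIntegral.integral_of_le (by linarith), ofReal_integral_eq_lintegral_ofReal
    (hcont.integrableOn_Ioc) (ae_of_all _ hq)]

/-! ### The Thorin measures `ϱ_α`, `ϱ_{α,ν}`, `Λ_{α,ν}` and their exponents -/

/-- Sigma-finiteness comes for free: by Markov's inequality a finite logarithmic integral forces
finite mass on each `(1 / (n + 1), ∞)`. -/
lemma isThorin_of_logT {ν : Measure ℝ} (hpos : ∀ᵐ x ∂ν, 0 < x)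
    (hfin : ∀ l, 0 < l → logT ν l ≠ ∞) : IsThorin ν := by
  refine ⟨measure_Iic_of_ae_pos hpos, ⟨⟨⟨fun n => Iic 0 ∪ Ioi (1 / ((n : ℝ) + 1)),
    fun _ => trivial, fun n => ?_, ?_⟩⟩⟩, fun l hl => ?_⟩
  · refine (measure_union_le _ _).trans_lt ?_
    rw [measure_Iic_of_ae_pos hpos, zero_add]
    have hδ : 0 < Real.log (1 + 1 * (1 / ((n : ℝ) + 1))) := Real.log_pos (by simp; positivity)
    have hm := meas_ge_le_lintegral_div (μ := ν)
      (f := fun x => ENNReal.ofReal (Real.log (1 + 1 * x))) (by fun_prop)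
      (ε := ENNReal.ofReal (Real.log (1 + 1 * (1 / ((n : ℝ) + 1))))) (by simpa using hδ)
      ENNReal.ofReal_ne_top
    refine lt_of_le_of_lt ((measure_mono ?_).trans hm)
      (ENNReal.div_lt_top (hfin 1 one_pos) (by simpa using hδ))
    intro x hx
    have hx' : 1 / ((n : ℝ) + 1) < x := hx
    exact ENNReal.ofReal_le_ofReal (Real.log_le_log (by positivity) (by linarith))
  · refine eq_univ_of_forall fun x => mem_iUnion.2 ?_
    by_cases hx : x ≤ 0
    · exact ⟨0, Or.inl hx⟩
    · obtain ⟨n, hn⟩ := exists_nat_one_div_lt (not_le.1 hx)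
      exact ⟨n, Or.inr hn⟩
  · refine ⟨(by fun_prop : Measurable fun x => Real.log (1 + l * x)).aestronglyMeasurable, ?_⟩
    rw [hasFiniteIntegral_iff_ofReal]
    · exact lt_top_iff_ne_top.2 (hfin l hl)
    · filter_upwards [hpos] with x hx
      exact Real.log_nonneg (by nlinarith [mul_pos hl hx])

lemma IsThorin.ae_pos {ν : Measure ℝ} (h : IsThorin ν) : ∀ᵐ x ∂ν, 0 < x := ae_pos_of_Iic h.pos

lemma IsThorin.logT_ne_top {ν : Measure ℝ} (h : IsThorin ν) {l : ℝ} (hl : 0 < l) :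
    logT ν l ≠ ∞ := by
  have h1 := (h.integrable l hl).2
  rw [hasFiniteIntegral_iff_ofReal] at h1
  · exact h1.ne
  · filter_upwards [h.ae_pos] with x hx
    exact Real.log_nonneg (by nlinarith [mul_pos hl hx])

lemma IsThorin.thorinExponent_eq {ν : Measure ℝ} (h : IsThorin ν) {l : ℝ} (hl : 0 < l) :
    thorinExponent ν l = (logT ν l).toReal := by
  rw [thorinExponent, logT, integral_eq_lintegral_of_nonneg_ae _
    (h.integrable l hl).aestronglyMeasurable]
  filter_upwards [h.ae_pos] with x hx
  exact Real.log_nonneg (by nlinarith [mul_pos hl hx])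

/-- The density of `rho α` scaled by `r ^ (1 / α)`. -/
noncomputable def rhoDensity (α r x : ℝ) : ℝ :=
  Real.sin (Real.pi * α) / Real.pi *
    (x ^ (α - 1) * r / (x ^ (2 * α) + 2 * x ^ α * r * Real.cos (Real.pi * α) + r ^ 2))

@[fun_prop]
lemma measurable_rhoDensity (α : ℝ) : Measurable fun z : ℝ × ℝ => rhoDensity α z.1 z.2 := by
  unfold rhoDensity
  fun_prop

lemma rpow_two_mul {x : ℝ} (hx : 0 ≤ x) (a : ℝ) : x ^ (2 * a) = (x ^ a) ^ 2 := by
  rw [mul_comm, Real.rpow_mul hx, Real.rpow_ofNat]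

lemma rhoDensity_den_pos {α r x : ℝ} (h0 : 0 < α) (h1 : α < 1) (hr : 0 < r) (hx : 0 ≤ x) :
    0 < x ^ (2 * α) + 2 * x ^ α * r * Real.cos (Real.pi * α) + r ^ 2 := by
  rw [rpow_two_mul hx]
  exact quad_pos h0 h1 hr _

lemma rhoDensity_nonneg {α r x : ℝ} (h0 : 0 < α) (h1 : α < 1) (hr : 0 < r) (hx : 0 ≤ x) :
    0 ≤ rhoDensity α r x := by
  have h2 := rhoDensity_den_pos h0 h1 hr hx
  have h3 := sin_pi_mul_pos h0 h1
  have := Real.pi_pos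
  unfold rhoDensity
  positivity

lemma rho_eq_withDensity (α : ℝ) : rho α =
    (volume.restrict (Ioi 0)).withDensity fun x => ENNReal.ofReal (rhoDensity α 1 x) := by
  unfold rho rhoDensity
  simp

lemma rhoMixed_eq_withDensity (α : ℝ) (ν : Measure ℝ) : rhoMixed α ν =
    (volume.restrict (Ioi 0)).withDensity fun x =>
      ∫⁻ r, ENNReal.ofReal (rhoDensity α r x) ∂ν := rfl

lemma lintegral_rho (α : ℝ) {f : ℝ → ℝ≥0∞} (hf : Measurable f) : ∫⁻ y, f y ∂(rho α) =
    ∫⁻ y in Ioi 0, ENNReal.ofReal (rhoDensity α 1 y) * f y := by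
  rw [rho_eq_withDensity, lintegral_withDensity_eq_lintegral_mul _ _ hf]
  · rfl
  · exact ((measurable_rhoDensity α).comp (measurable_const.prodMk measurable_id)).ennreal_ofReal

/-- The Stieltjes-type transform of `rho α` behind the identity for its Thorin exponent. -/
lemma lintegral_rhoDensity_mul {α l : ℝ} (h0 : 0 < α) (h1 : α < 1) (hl : 0 < l) :
    ∫⁻ y, ENNReal.ofReal (y / (1 + l * y)) ∂(rho α) =
      ENNReal.ofReal (l ^ (α - 1) / (1 + l ^ α)) := by
  -- The substitution `y = exp (-t)`, with `s = log l`, reduces the transform to the strip integral.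
  have hrange : (fun t : ℝ => Real.exp (-t)) '' univ = Ioi 0 := by
    rw [image_univ]
    ext y
    constructor
    · rintro ⟨t, rfl⟩; exact Real.exp_pos _
    · intro hy; exact ⟨-Real.log y, by simp [Real.exp_log hy]⟩
  rw [lintegral_rho _ (by fun_prop), ← hrange,
    lintegral_image_eq_lintegral_abs_deriv_mul MeasurableSet.univ
    (f' := fun t => -Real.exp (-t))]
  · have hpt : ∀ t : ℝ, ENNReal.ofReal |(-Real.exp (-t))| *
        (ENNReal.ofReal (rhoDensity α 1 (Real.exp (-t))) *
          ENNReal.ofReal (Real.exp (-t) / (1 + l * Real.exp (-t)))) =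
        ENNReal.ofReal l⁻¹ *
          ENNReal.ofReal (logRho α t * (1 / (1 + Real.exp (t - Real.log l)))) := by
      intro t
      have hd := rhoDensity_nonneg h0 h1 one_pos (Real.exp_pos (-t)).le
      rw [abs_neg, abs_of_pos (Real.exp_pos _), ← ENNReal.ofReal_mul hd,
        ← ENNReal.ofReal_mul (Real.exp_pos _).le, ← ENNReal.ofReal_mul (by positivity)]
      congr 1
      have hq := quad_pos h0 h1 one_pos (Real.exp (α * t))
      have hu := Real.exp_pos (α * t)
      have he := Real.exp_pos t
      have e1 : Real.exp (-t) ^ (α - 1) * Real.exp (-t) = (Real.exp (α * t))⁻¹ := by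
        rw [← Real.exp_mul, ← Real.exp_add, ← Real.exp_neg]; ring_nf
      have e2 : Real.exp (-t) ^ α = (Real.exp (α * t))⁻¹ := by
        rw [← Real.exp_mul, ← Real.exp_neg]; ring_nf
      have e3 : Real.exp (-t) / (1 + l * Real.exp (-t)) =
          l⁻¹ * (1 / (1 + Real.exp (t - Real.log l))) := by
        rw [Real.exp_sub, Real.exp_log hl, Real.exp_neg]
        field_simp
        ring
      rw [e3]
      have e4 : Real.exp (-t) * rhoDensity α 1 (Real.exp (-t)) = logRho α t := by
        unfold rhoDensity logRho
        rw [rpow_two_mul (Real.exp_pos _).le, e2]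
        have e5 : Real.exp (-t) * (Real.sin (Real.pi * α) / Real.pi *
            (Real.exp (-t) ^ (α - 1) * 1 / ((Real.exp (α * t))⁻¹ ^ 2 +
              2 * (Real.exp (α * t))⁻¹ * 1 * Real.cos (Real.pi * α) + 1 ^ 2))) =
            Real.sin (Real.pi * α) / Real.pi * ((Real.exp (-t) ^ (α - 1) * Real.exp (-t)) /
            ((Real.exp (α * t))⁻¹ ^ 2 +
              2 * (Real.exp (α * t))⁻¹ * Real.cos (Real.pi * α) + 1)) := by ring
        rw [e5, e1]
        congr 1
        have hpos : (Real.exp (α * t))⁻¹ ^ 2 + 2 * (Real.exp (α * t))⁻¹ * Real.cos (Real.pi * α) + 1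
            = (Real.exp (α * t) ^ 2 + 2 * Real.exp (α * t) * Real.cos (Real.pi * α) + 1) /
              Real.exp (α * t) ^ 2 := by field_simp; ring
        rw [hpos]
        field_simp
      rw [← e4]
      ring
    simp_rw [hpt]
    rw [lintegral_const_mul' _ _ ENNReal.ofReal_ne_top, Measure.restrict_univ,
      lintegral_logRho h0 h1, ← ENNReal.ofReal_mul (by positivity)]
    congr 1
    have e6 : Real.exp (α * Real.log l) = l ^ α := by
      rw [Real.rpow_def_of_pos hl, mul_comm]
    have hla : 0 < l ^ α := by positivity
    rw [e6, Real.rpow_sub hl, Real.rpow_one]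
    field_simp
    ring
  · intro t _
    have := ((hasDerivAt_id t).neg).exp
    refine (this.congr_deriv ?_).hasDerivWithinAt
    simp
  · intro x _ y _ hxy
    simpa using hxy

lemma log_eq_lintegral {l y : ℝ} (hl : 0 ≤ l) (hy : 0 ≤ y) :
    ENNReal.ofReal (Real.log (1 + l * y)) =
      ∫⁻ t in Ioc 0 l, ENNReal.ofReal (y / (1 + t * y)) := by
  have hpos : ∀ t, 0 ≤ t → 0 < 1 + t * y := fun t ht => by nlinarith [mul_nonneg ht hy]
  rw [lintegral_deriv_Ioc (g := fun t => Real.log (1 + t * y)) hl]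
  · simp
  · exact ContinuousOn.log (by fun_prop) fun t ht => (hpos t ht.1).ne'
  · intro t ht
    have h2 : HasDerivAt (fun t : ℝ => 1 + t * y) y t := by
      simpa using ((hasDerivAt_id t).mul_const y).const_add 1
    exact h2.log (hpos t ht.1.le).ne'
  · intro t ht
    exact div_nonneg hy (hpos t ht.1.le).le

lemma rho_ae_pos (α : ℝ) : ∀ᵐ x ∂(rho α), 0 < x := by
  rw [rho_eq_withDensity]
  exact (withDensity_absolutelyContinuous _ _).ae_le (self_mem_ae_restrict measurableSet_Ioi)

lemma sFinite_rho (α : ℝ) : SFinite (rho α) := by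
  rw [rho_eq_withDensity]
  infer_instance

/-- Writing the logarithm as an integral over `t ∈ (0, l]` and exchanging the order leaves `t ^ (α -
1) / (1 + t ^ α)`, the derivative of `log (1 + t ^ α) / α`. -/
lemma logT_rho {α l : ℝ} (h0 : 0 < α) (h1 : α < 1) (hl : 0 < l) :
    logT (rho α) l = ENNReal.ofReal (Real.log (1 + l ^ α) / α) := by
  have := sFinite_rho α
  have e : logT (rho α) l = ∫⁻ y, (∫⁻ t in Ioc 0 l, ENNReal.ofReal (y / (1 + t * y))) ∂(rho α) := by
    unfold logT
    refine lintegral_congr_ae ?_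
    filter_upwards [rho_ae_pos α] with y hy using log_eq_lintegral hl.le hy.le
  rw [e, lintegral_lintegral_swap (by fun_prop), setLIntegral_congr_fun
    (g := fun t => ENNReal.ofReal (t ^ (α - 1) / (1 + t ^ α))) measurableSet_Ioc (fun t ht => lintegral_rhoDensity_mul h0 h1 ht.1),
    lintegral_deriv_Ioc (g := fun t => Real.log (1 + t ^ α) / α) hl.le]
  · simp [Real.zero_rpow h0.ne']
  · refine ContinuousOn.div_const (ContinuousOn.log ?_ fun t ht => ?_) _
    · exact continuousOn_const.add (continuousOn_id.rpow_const fun _ _ => Or.inr h0.le)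
    · have := Real.rpow_nonneg ht.1 α
      positivity
  · intro t ht
    have h2 := (Real.hasDerivAt_rpow_const (p := α) (Or.inl ht.1.ne')).const_add 1
    have h3 : 0 < 1 + t ^ α := by have := Real.rpow_nonneg ht.1.le α; positivity
    refine ((h2.log h3.ne').div_const α).congr_deriv ?_
    field_simp
  · intro t ht
    have := ht.1
    positivity

/-- The mass is the monotone limit of `∫ l y / (1 + l y) ϱ_α(dy) = 1 / (l ^ (-α) + 1)` along `l = n
+ 1`. -/
lemma rho_univ {α : ℝ} (h0 : 0 < α) (h1 : α < 1) : rho α univ = 1 := by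
  have hA : Tendsto (fun n : ℕ => ∫⁻ y, ENNReal.ofReal (((n : ℝ) + 1) * (y / (1 + ((n : ℝ) + 1) * y)))
      ∂(rho α)) atTop (𝓝 (∫⁻ _, 1 ∂(rho α))) := by
    refine lintegral_tendsto_of_tendsto_of_monotone (fun n => by fun_prop) ?_ ?_
    · filter_upwards [rho_ae_pos α] with y hy n m hnm
      refine ENNReal.ofReal_le_ofReal ?_
      have hnm' : (n : ℝ) ≤ m := by exact_mod_cast hnm
      rw [← mul_div_assoc, ← mul_div_assoc, div_le_div_iff₀ (by positivity) (by positivity)]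
      nlinarith
    · filter_upwards [rho_ae_pos α] with y hy
      have e : ∀ n : ℕ, ((n : ℝ) + 1) * (y / (1 + ((n : ℝ) + 1) * y)) =
          y / (1 / ((n : ℝ) + 1) + y) := fun n => by field_simp
      simp_rw [e]
      have h2 : Tendsto (fun n : ℕ => y / (1 / ((n : ℝ) + 1) + y)) atTop (𝓝 (y / (0 + y))) :=
        tendsto_const_nhds.div (tendsto_one_div_add_atTop_nhds_zero_nat.add_const y) (by
          rw [zero_add]; exact hy.ne')
      rw [zero_add, div_self hy.ne'] at h2
      simpa using ENNReal.tendsto_ofReal h2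
  have hB : Tendsto (fun n : ℕ => ∫⁻ y, ENNReal.ofReal (((n : ℝ) + 1) * (y / (1 + ((n : ℝ) + 1) * y)))
      ∂(rho α)) atTop (𝓝 1) := by
    have e : ∀ n : ℕ, ∫⁻ y, ENNReal.ofReal (((n : ℝ) + 1) * (y / (1 + ((n : ℝ) + 1) * y))) ∂(rho α) =
        ENNReal.ofReal (1 / (((n : ℝ) + 1) ^ (-α) + 1)) := by
      intro n
      have hn : (0 : ℝ) < (n : ℝ) + 1 := by positivity
      simp_rw [ENNReal.ofReal_mul hn.le]
      rw [lintegral_const_mul' _ _ ENNReal.ofReal_ne_top, lintegral_rhoDensity_mul h0 h1 hn,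
        ← ENNReal.ofReal_mul hn.le]
      congr 1
      rw [Real.rpow_sub hn, Real.rpow_one, Real.rpow_neg hn.le]
      field_simp
    simp_rw [e]
    have h2 : Tendsto (fun n : ℕ => ((n : ℝ) + 1) ^ (-α)) atTop (𝓝 0) :=
      (tendsto_rpow_neg_atTop h0).comp (tendsto_atTop_add_const_right _ _
        tendsto_natCast_atTop_atTop)
    have h3 : Tendsto (fun n : ℕ => 1 / (((n : ℝ) + 1) ^ (-α) + 1)) atTop (𝓝 (1 / (0 + 1))) :=
      tendsto_const_nhds.div (h2.add_const 1) (by norm_num)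
    simpa using ENNReal.tendsto_ofReal h3
  simpa using tendsto_nhds_unique hA hB

/-- The slice of `rhoMixed` at `r` is the image of `rho` under dilation by `r ^ (1 / α)`. -/
lemma lintegral_rhoDensity_scale {α r : ℝ} (h0 : 0 < α) (hr : 0 < r)
    {f : ℝ → ℝ≥0∞} (hf : Measurable f) :
    ∫⁻ x in Ioi 0, ENNReal.ofReal (rhoDensity α r x) * f x =
      ∫⁻ y, f (r ^ (1 / α) * y) ∂(rho α) := by
  set c := r ^ (1 / α) with hc
  have hc0 : 0 < c := by positivity
  have hca : c ^ α = r := by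
    rw [hc, ← Real.rpow_mul hr.le, one_div_mul_cancel h0.ne', Real.rpow_one]
  have himg : (fun y => c * y) '' Ioi 0 = Ioi 0 := by
    ext x
    constructor
    · rintro ⟨y, hy, rfl⟩; exact mul_pos hc0 hy
    · intro hx; exact ⟨x / c, div_pos hx hc0, mul_div_cancel₀ _ hc0.ne'⟩
  rw [lintegral_rho _ (by fun_prop), ← himg, lintegral_image_eq_lintegral_abs_deriv_mul
    measurableSet_Ioi (f' := fun _ => c), himg]
  · refine setLIntegral_congr_fun measurableSet_Ioi fun y hy => ?_
    have hy' : (0 : ℝ) < y := hy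
    rw [← mul_assoc, ← ENNReal.ofReal_mul (abs_nonneg c), abs_of_pos hc0]
    congr 2
    unfold rhoDensity
    rw [Real.mul_rpow hc0.le hy'.le, rpow_two_mul (by positivity), rpow_two_mul hy'.le,
      Real.mul_rpow hc0.le hy'.le, hca]
    have e1 : c * c ^ (α - 1) = r := by
      rw [Real.rpow_sub hc0, Real.rpow_one, hca]
      field_simp
    have e2 : (r * y ^ α) ^ 2 + 2 * (r * y ^ α) * r * Real.cos (Real.pi * α) + r ^ 2 =
        r ^ 2 * ((y ^ α) ^ 2 + 2 * y ^ α * 1 * Real.cos (Real.pi * α) + 1 ^ 2) := by ring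
    rw [e2]
    calc _ = Real.sin (Real.pi * α) / Real.pi * ((c * c ^ (α - 1)) * r * y ^ (α - 1) /
          (r ^ 2 * ((y ^ α) ^ 2 + 2 * y ^ α * 1 * Real.cos (Real.pi * α) + 1 ^ 2))) := by ring
      _ = _ := by
        rw [e1, show r * r * y ^ (α - 1) = r ^ 2 * (y ^ (α - 1) * 1) by ring,
          mul_div_mul_left _ _ (by positivity)]
  · intro y _
    exact (((hasDerivAt_id y).const_mul c).congr_deriv (by simp)).hasDerivWithinAt
  · intro x _ y _ hxy
    exact mul_left_cancel₀ hc0.ne' hxy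

lemma measurable_lintegral_rhoDensity (α : ℝ) (ν : Measure ℝ) [SFinite ν] :
    Measurable fun x => ∫⁻ r, ENNReal.ofReal (rhoDensity α r x) ∂ν :=
  Measurable.lintegral_prod_right' (f := fun z : ℝ × ℝ => ENNReal.ofReal (rhoDensity α z.2 z.1))
    (((measurable_rhoDensity α).comp measurable_swap).ennreal_ofReal)

lemma lintegral_rhoMixed {α : ℝ} (h0 : 0 < α) {ν : Measure ℝ} [SFinite ν]
    (hν : ∀ᵐ x ∂ν, 0 < x) {f : ℝ → ℝ≥0∞} (hf : Measurable f) :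
    ∫⁻ x, f x ∂(rhoMixed α ν) = ∫⁻ r, ∫⁻ y, f (r ^ (1 / α) * y) ∂(rho α) ∂ν := by
  rw [rhoMixed_eq_withDensity, lintegral_withDensity_eq_lintegral_mul _
    (measurable_lintegral_rhoDensity α ν) hf]
  have hm : ∀ x, Measurable fun r => ENNReal.ofReal (rhoDensity α r x) := fun x =>
    ((measurable_rhoDensity α).comp (measurable_id.prodMk measurable_const)).ennreal_ofReal
  have hj : Measurable fun z : ℝ × ℝ => ENNReal.ofReal (rhoDensity α z.2 z.1) * f z.1 :=
    (((measurable_rhoDensity α).comp measurable_swap).ennreal_ofReal).mul (hf.comp measurable_fst)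
  simp only [Pi.mul_apply]
  simp_rw [← lintegral_mul_const _ (hm _)]
  rw [lintegral_lintegral_swap hj.aemeasurable]
  refine lintegral_congr_ae ?_
  filter_upwards [hν] with r hr using lintegral_rhoDensity_scale h0 hr hf

lemma rhoMixed_ae_pos (α : ℝ) (ν : Measure ℝ) : ∀ᵐ x ∂(rhoMixed α ν), 0 < x := by
  rw [rhoMixed_eq_withDensity]
  exact (withDensity_absolutelyContinuous _ _).ae_le (self_mem_ae_restrict measurableSet_Ioi)

lemma rhoMixed_univ {α : ℝ} (h0 : 0 < α) (h1 : α < 1) {ν : Measure ℝ} [SFinite ν]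
    (hν : ∀ᵐ x ∂ν, 0 < x) : rhoMixed α ν univ = ν univ := by
  rw [← lintegral_one, lintegral_rhoMixed h0 hν measurable_const]
  simp [rho_univ h0 h1]

/-- A dilation by `r ^ (1 / α)` replaces `l ^ α` by `l ^ α r` in the exponent of `rho`, and
integrating over `r` rebuilds the exponent of `ν` at `l ^ α`. -/
lemma logT_rhoMixed {α l : ℝ} (h0 : 0 < α) (h1 : α < 1) (hl : 0 < l) {ν : Measure ℝ} [SFinite ν]
    (hν : ∀ᵐ x ∂ν, 0 < x) :
    logT (rhoMixed α ν) l = ENNReal.ofReal (1 / α) * logT ν (l ^ α) := by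
  rw [logT, lintegral_rhoMixed h0 hν (by fun_prop), logT,
    ← lintegral_const_mul' _ _ ENNReal.ofReal_ne_top]
  refine lintegral_congr_ae ?_
  filter_upwards [hν] with r hr
  have h2 := logT_rho h0 h1 (l := l * r ^ (1 / α)) (by positivity)
  have h3 : (l * r ^ (1 / α)) ^ α = l ^ α * r := by
    rw [Real.mul_rpow hl.le (by positivity), ← Real.rpow_mul hr.le, one_div_mul_cancel h0.ne',
      Real.rpow_one]
  rw [h3, logT] at h2
  simp_rw [← mul_assoc]
  rw [h2, ← ENNReal.ofReal_mul (by positivity)]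
  congr 1
  ring

lemma isThorin_rhoMixed {α : ℝ} (h0 : 0 < α) (h1 : α < 1) {ν : Measure ℝ} (hν : IsThorin ν) :
    IsThorin (rhoMixed α ν) := by
  have := hν.sigmaFinite
  refine isThorin_of_logT (rhoMixed_ae_pos α ν) fun l hl => ?_
  rw [logT_rhoMixed h0 h1 hl hν.ae_pos]
  exact ENNReal.mul_ne_top ENNReal.ofReal_ne_top (hν.logT_ne_top (by positivity))

/-- Lamperti's law with skewness `r / (1 + r)` is the image of the slice at `r` under `x ↦ x / (1 +
x)`, whose Jacobian is `1 / (1 + x) ^ 2`. -/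
lemma lampertiDensity_comp {α r x : ℝ} (h0 : 0 < α) (h1 : α < 1) (hr : 0 < r) (hx : 0 < x) :
    1 / (1 + x) ^ 2 * lampertiDensity α (r / (1 + r)) (x / (1 + x)) = rhoDensity α r x := by
  have hx1 : 0 < 1 + x := by linarith
  have hr1 : 0 < 1 + r := by linarith
  have hden := quad_pos h0 h1 hr (x ^ α)
  have e1 : 1 - x / (1 + x) = 1 / (1 + x) := by field_simp; ring
  have e2 : 1 - r / (1 + r) = 1 / (1 + r) := by field_simp; ring
  have e3 : (1 + x) ^ α = (1 + x) ^ (α - 1) * (1 + x) := by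
    rw [Real.rpow_sub hx1, Real.rpow_one]; field_simp
  have hY : 0 < (1 + x) ^ (α - 1) := by positivity
  have hpi := Real.pi_pos
  unfold lampertiDensity rhoDensity
  rw [e1, e2, rpow_two_mul (by positivity), rpow_two_mul (by positivity), rpow_two_mul hx.le,
    Real.div_rpow hx.le hx1.le, Real.div_rpow hx.le hx1.le, Real.div_rpow zero_le_one hx1.le,
    Real.div_rpow zero_le_one hx1.le, Real.one_rpow, Real.one_rpow, e3]
  set Y := (1 + x) ^ (α - 1)
  have hden2 : (1 / (1 + r)) ^ 2 * (x ^ α / (Y * (1 + x))) ^ 2 +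
      (r / (1 + r)) ^ 2 * (1 / (Y * (1 + x))) ^ 2 +
      2 * (r / (1 + r)) * (1 / (1 + r)) * (x ^ α / (Y * (1 + x))) * (1 / (Y * (1 + x))) *
        Real.cos (Real.pi * α) =
      ((x ^ α) ^ 2 + 2 * x ^ α * r * Real.cos (Real.pi * α) + r ^ 2) /
        ((1 + r) ^ 2 * (Y * (1 + x)) ^ 2) := by field_simp; ring
  rw [hden2]
  field_simp

lemma measurable_lampertiDensity (α : ℝ) :
    Measurable fun z : ℝ × ℝ => lampertiDensity α (z.1 / (1 + z.1)) z.2 := by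
  unfold lampertiDensity
  fun_prop

lemma lintegral_lampertiMixed {α : ℝ} (h0 : 0 < α) (h1 : α < 1) {ν : Measure ℝ} [SFinite ν]
    (hν : ∀ᵐ x ∂ν, 0 < x) {f : ℝ → ℝ≥0∞} (hf : Measurable f) :
    ∫⁻ x, f x ∂(lampertiMixed α ν) = ∫⁻ x, f (x / (1 + x)) ∂(rhoMixed α ν) := by
  have hm : Measurable fun x => ∫⁻ r, ENNReal.ofReal (lampertiDensity α (r / (1 + r)) x) ∂ν :=
    Measurable.lintegral_prod_right' (f := fun z : ℝ × ℝ =>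
      ENNReal.ofReal (lampertiDensity α (z.2 / (1 + z.2)) z.1))
      (((measurable_lampertiDensity α).comp measurable_swap).ennreal_ofReal)
  have himg : (fun x : ℝ => x / (1 + x)) '' Ioi 0 = Ioo 0 1 := by
    ext z
    constructor
    · rintro ⟨x, hx, rfl⟩
      have hx' : (0 : ℝ) < x := hx
      exact ⟨by positivity, by rw [div_lt_one (by positivity)]; linarith⟩
    · intro hz
      have hz1 : 0 < 1 - z := by linarith [hz.2]
      refine ⟨z / (1 - z), div_pos hz.1 hz1, ?_⟩
      have : 1 + z / (1 - z) = 1 / (1 - z) := by field_simp; ring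
      simp only
      rw [this]
      field_simp
  rw [rhoMixed_eq_withDensity, lampertiMixed, lintegral_withDensity_eq_lintegral_mul _ hm hf,
    lintegral_withDensity_eq_lintegral_mul _ (measurable_lintegral_rhoDensity α ν) (by fun_prop),
    ← himg, lintegral_image_eq_lintegral_abs_deriv_mul measurableSet_Ioi
      (f' := fun x => 1 / (1 + x) ^ 2)]
  · refine setLIntegral_congr_fun measurableSet_Ioi fun x hx => ?_
    have hx' : (0 : ℝ) < x := hx
    simp only [Pi.mul_apply]
    rw [← mul_assoc, ← lintegral_const_mul' _ _ ENNReal.ofReal_ne_top]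
    congr 1
    refine lintegral_congr_ae ?_
    filter_upwards [hν] with r hr
    rw [← ENNReal.ofReal_mul (abs_nonneg _), abs_of_nonneg (by positivity),
      lampertiDensity_comp h0 h1 hr hx']
  · intro x hx
    have hx' : (0 : ℝ) < x := hx
    have h2 : HasDerivAt (fun x : ℝ => 1 + x) 1 x := (hasDerivAt_id x).const_add 1
    refine (((hasDerivAt_id x).div h2 (by positivity)).congr_deriv ?_).hasDerivWithinAt
    simp
  · intro x hx y hy hxy
    have hx' : (0 : ℝ) < x := hx
    have hy' : (0 : ℝ) < y := hy
    simp only at hxy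
    rw [div_eq_div_iff (by positivity) (by positivity)] at hxy
    linarith

lemma lampertiMixed_ae_pos (α : ℝ) (ν : Measure ℝ) : ∀ᵐ x ∂(lampertiMixed α ν), 0 < x := by
  have h : ∀ᵐ x ∂(lampertiMixed α ν), x ∈ Ioo (0 : ℝ) 1 :=
    (withDensity_absolutelyContinuous _ _).ae_le (self_mem_ae_restrict measurableSet_Ioo)
  exact h.mono fun x hx => hx.1

lemma lampertiMixed_univ {α : ℝ} (h0 : 0 < α) (h1 : α < 1) {ν : Measure ℝ} [SFinite ν]
    (hν : ∀ᵐ x ∂ν, 0 < x) : lampertiMixed α ν univ = ν univ := by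
  rw [← lintegral_one, lintegral_lampertiMixed h0 h1 hν measurable_const, lintegral_one,
    rhoMixed_univ h0 h1 hν]

/-- The reason is `(1 + l x / (1 + x)) (1 + x) = 1 + (1 + l) x`. The additive form avoids
subtraction in `[0,∞]`. -/
lemma logT_lampertiMixed_add {α l : ℝ} (h0 : 0 < α) (h1 : α < 1) (hl : 0 < l) {ν : Measure ℝ}
    [SFinite ν] (hν : ∀ᵐ x ∂ν, 0 < x) :
    logT (lampertiMixed α ν) l + logT (rhoMixed α ν) 1 = logT (rhoMixed α ν) (1 + l) := by
  rw [logT, lintegral_lampertiMixed h0 h1 hν (by fun_prop), logT,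
    ← lintegral_add_left (by fun_prop), logT]
  refine lintegral_congr_ae ?_
  filter_upwards [rhoMixed_ae_pos α ν] with x hx
  have h2 : 0 < 1 + l * (x / (1 + x)) := by positivity
  rw [← ENNReal.ofReal_add (Real.log_nonneg (by
      have : 0 < l * (x / (1 + x)) := by positivity
      linarith)) (Real.log_nonneg (by linarith)),
    ← Real.log_mul h2.ne' (by positivity)]
  congr 2
  field_simp
  ring

lemma isThorin_lampertiMixed {α : ℝ} (h0 : 0 < α) (h1 : α < 1) {ν : Measure ℝ} (hν : IsThorin ν) :
    IsThorin (lampertiMixed α ν) := by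
  have := hν.sigmaFinite
  refine isThorin_of_logT (lampertiMixed_ae_pos α ν) fun l hl => ?_
  have h2 := (isThorin_rhoMixed h0 h1 hν).logT_ne_top (l := 1 + l) (by linarith)
  rw [← logT_lampertiMixed_add h0 h1 hl hν.ae_pos] at h2
  exact (ENNReal.add_ne_top.1 h2).1

/-! ### The classes of laws in terms of lower integrals; products and gamma mixtures -/

lemma integral_eq_iff_lintegral {m : Measure ℝ} {f : ℝ → ℝ} (hf : 0 ≤ᵐ[m] f)
    (hm : Measurable f) (hfin : ∫⁻ x, ENNReal.ofReal (f x) ∂m ≠ ∞) {r : ℝ} (hr : 0 ≤ r) :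
    ∫ x, f x ∂m = r ↔ ∫⁻ x, ENNReal.ofReal (f x) ∂m = ENNReal.ofReal r := by
  rw [integral_eq_lintegral_of_nonneg_ae hf hm.aestronglyMeasurable,
    eq_comm (a := ENNReal.toReal _)]
  exact ⟨fun h => by rw [h, ENNReal.ofReal_toReal hfin],
    fun h => by rw [h, ENNReal.toReal_ofReal hr]⟩

lemma integral_exp_eq_iff {m : Measure ℝ} (hm : IsNonnegLaw m) {l : ℝ} (hl : 0 < l) {r : ℝ}
    (hr : 0 ≤ r) : ∫ x, Real.exp (-(l * x)) ∂m = r ↔ lap m l = ENNReal.ofReal r := by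
  have := hm.prob
  exact integral_eq_iff_lintegral (ae_of_all _ fun x => (Real.exp_pos _).le) (by fun_prop)
    (ne_top_of_le_ne_top (measure_ne_top m univ) (lap_le hm.nonneg hl.le)) hr

lemma integral_rpow_eq_iff {m : Measure ℝ} (hm : IsNonnegLaw m) {θ : ℝ} (hθ : 0 < θ) {l : ℝ}
    (hl : 0 < l) {r : ℝ} (hr : 0 ≤ r) :
    ∫ x, (1 + l * x) ^ (-θ) ∂m = r ↔ sti θ m l = ENNReal.ofReal r := by
  have := hm.prob
  refine integral_eq_iff_lintegral ?_ (by fun_prop)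
    (ne_top_of_le_ne_top ENNReal.one_ne_top (sti_le_one hθ.le m hm.nonneg hl.le)) hr
  filter_upwards [ae_nonneg_of_Iio hm.nonneg] with x hx
  show 0 ≤ _
  have := mul_nonneg hl.le hx
  positivity

lemma mem_GGC_iff {θ : ℝ} {ν m : Measure ℝ} (hν : IsThorin ν) : m ∈ GGC θ ν ↔ IsNonnegLaw m ∧
    ∀ l, 0 < l → lap m l = ENNReal.ofReal (Real.exp (-(θ * (logT ν l).toReal))) := by
  unfold GGC
  rw [mem_ofPred_eq]
  constructor
  · rintro ⟨-, h1, h2⟩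
    refine ⟨h1, fun l hl => ?_⟩
    rw [← integral_exp_eq_iff h1 hl (Real.exp_pos _).le, h2 l hl, hν.thorinExponent_eq hl]
  · rintro ⟨h1, h2⟩
    refine ⟨hν, h1, fun l hl => ?_⟩
    rw [integral_exp_eq_iff h1 hl (Real.exp_pos _).le, h2 l hl, hν.thorinExponent_eq hl]

lemma mem_meanLaw_iff {θ : ℝ} (hθ : 0 < θ) {ν m : Measure ℝ} (hν : IsThorin ν) :
    m ∈ meanLaw θ ν ↔ IsNonnegLaw m ∧
      ∀ l, 0 < l → sti θ m l = ENNReal.ofReal (Real.exp (-(θ * (logT ν l).toReal))) := by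
  unfold meanLaw
  rw [mem_ofPred_eq]
  constructor
  · rintro ⟨-, h1, h2⟩
    refine ⟨h1, fun l hl => ?_⟩
    rw [← integral_rpow_eq_iff h1 hθ hl (Real.exp_pos _).le, h2 l hl, hν.thorinExponent_eq hl]
  · rintro ⟨h1, h2⟩
    refine ⟨hν, h1, fun l hl => ?_⟩
    rw [integral_rpow_eq_iff h1 hθ hl (Real.exp_pos _).le, h2 l hl, hν.thorinExponent_eq hl]

lemma mem_stableLaw_iff {α : ℝ} {m : Measure ℝ} : m ∈ stableLaw α ↔ IsNonnegLaw m ∧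
    ∀ l, 0 < l → lap m l = ENNReal.ofReal (Real.exp (-(l ^ α))) := by
  unfold stableLaw
  rw [mem_ofPred_eq]
  refine and_congr_right fun h1 => forall_congr' fun l => forall_congr' fun hl => ?_
  rw [integral_exp_eq_iff h1 hl (Real.exp_pos _).le]

lemma eq_of_mem_GGC {θ : ℝ} {ν m m' : Measure ℝ} (hν : IsThorin ν) (h : m ∈ GGC θ ν)
    (h' : m' ∈ GGC θ ν) : m = m' := by
  rw [mem_GGC_iff hν] at h h'
  have := h.1.prob
  have := h'.1.prob
  exact eq_of_lap_eq h.1.nonneg h'.1.nonneg fun l hl => by rw [h.2 l hl, h'.2 l hl]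

lemma eq_of_mem_meanLaw {θ : ℝ} (hθ : 0 < θ) {ν m m' : Measure ℝ} (hν : IsThorin ν)
    (h : m ∈ meanLaw θ ν) (h' : m' ∈ meanLaw θ ν) : m = m' := by
  rw [mem_meanLaw_iff hθ hν] at h h'
  have := h.1.prob
  have := h'.1.prob
  exact eq_of_sti_eq hθ h.1.nonneg h'.1.nonneg fun l hl => by rw [h.2 l hl, h'.2 l hl]

lemma eq_of_mem_stableLaw {α : ℝ} {m m' : Measure ℝ}
    (h : m ∈ stableLaw α) (h' : m' ∈ stableLaw α) : m = m' := by
  rw [mem_stableLaw_iff] at h h'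
  have := h.1.prob
  have := h'.1.prob
  exact eq_of_lap_eq h.1.nonneg h'.1.nonneg fun l hl => by rw [h.2 l hl, h'.2 l hl]

lemma GGC_eq_singleton {θ : ℝ} {ν m : Measure ℝ} (hν : IsThorin ν) (h : m ∈ GGC θ ν) :
    GGC θ ν = {m} :=
  eq_singleton_iff_unique_mem.2 ⟨h, fun _ h' => eq_of_mem_GGC hν h' h⟩

lemma meanLaw_eq_singleton {θ : ℝ} (hθ : 0 < θ) {ν m : Measure ℝ} (hν : IsThorin ν)
    (h : m ∈ meanLaw θ ν) : meanLaw θ ν = {m} :=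
  eq_singleton_iff_unique_mem.2 ⟨h, fun _ h' => eq_of_mem_meanLaw hθ hν h' h⟩

lemma isNonnegLaw_prodLaw {m m' : Measure ℝ} (h : IsNonnegLaw m) (h' : IsNonnegLaw m') :
    IsNonnegLaw (prodLaw m m') := by
  have := h.prob
  have := h'.prob
  have hm : Measurable fun z : ℝ × ℝ => z.1 * z.2 := by fun_prop
  refine ⟨Measure.isProbabilityMeasure_map hm.aemeasurable, measure_Iio_of_ae_nonneg
    ((ae_map_iff hm.aemeasurable measurableSet_Ici).2 ?_)⟩
  have h1 := (Measure.quasiMeasurePreserving_fst (μ := m) (ν := m')).ae (ae_nonneg_of_Iio h.nonneg)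
  have h2 := (Measure.quasiMeasurePreserving_snd (μ := m) (ν := m')).ae (ae_nonneg_of_Iio h'.nonneg)
  filter_upwards [h1, h2] with z h1 h2 using mul_nonneg h1 h2

lemma lintegral_prodLaw {m m' : Measure ℝ} [SFinite m'] {f : ℝ → ℝ≥0∞}
    (hf : Measurable f) : ∫⁻ x, f x ∂(prodLaw m m') = ∫⁻ x, ∫⁻ y, f (x * y) ∂m' ∂m := by
  rw [prodLaw, lintegral_map hf (by fun_prop), lintegral_prod _ (by fun_prop)]

lemma isNonnegLaw_powLaw {a : ℝ} {m : Measure ℝ} (h : IsNonnegLaw m) : IsNonnegLaw (powLaw a m) := by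
  have := h.prob
  have hm : Measurable fun x : ℝ => x ^ a := by fun_prop
  refine ⟨Measure.isProbabilityMeasure_map hm.aemeasurable, measure_Iio_of_ae_nonneg
    ((ae_map_iff hm.aemeasurable measurableSet_Ici).2 ?_)⟩
  filter_upwards [ae_nonneg_of_Iio h.nonneg] with x hx using Real.rpow_nonneg hx a

lemma isNonnegLaw_gammaMeasure {a : ℝ} (ha : 0 < a) : IsNonnegLaw (gammaMeasure a 1) :=
  ⟨isProbabilityMeasure_gammaMeasure ha one_pos,
    measure_Iio_of_ae_nonneg ((gammaMeasure_ae_pos a).mono fun _ h => h.le)⟩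

/-- Integrating out the gamma factor first turns `exp (-l G M)` into `(1 + l M) ^ (-a)`; this links
mean functionals to GGC laws. -/
lemma lap_gammaMixture {a : ℝ} (ha : 0 < a) {m : Measure ℝ} (hm : IsNonnegLaw m) {l : ℝ}
    (hl : 0 < l) : lap (gammaMixture a m) l = sti a m l := by
  have := hm.prob
  rw [← lintegral_lap_gamma ha m hm.nonneg hl.le, lap, gammaMixture, lintegral_prodLaw (by fun_prop)]
  unfold lap
  simp_rw [mul_assoc]

lemma gammaMixture_mem_GGC {θ : ℝ} (hθ : 0 < θ) {ν m : Measure ℝ} (hν : IsThorin ν)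
    (h : m ∈ meanLaw θ ν) : gammaMixture θ m ∈ GGC θ ν := by
  rw [mem_meanLaw_iff hθ hν] at h
  rw [mem_GGC_iff hν]
  exact ⟨isNonnegLaw_prodLaw (isNonnegLaw_gammaMeasure hθ) h.1, fun l hl => by
    rw [lap_gammaMixture hθ h.1 hl, h.2 l hl]⟩

lemma dirichletMean_mem_meanLaw {θ : ℝ} (hθ : 0 < θ) {ν : Measure ℝ} (hν : IsThorin ν)
    [IsProbabilityMeasure ν] : dirichletMean θ ν ∈ meanLaw θ ν := by
  rw [mem_meanLaw_iff hθ hν]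
  exact ⟨isNonnegLaw_dirichletMean hθ ν, fun l hl =>
    sti_dirichletMean hθ ν (measure_Iio_of_ae_nonneg (hν.ae_pos.mono fun _ h => h.le))
      (fun s hs => hν.logT_ne_top hs) hl⟩

/-! ### Existence of the mean functional -/

/-- The missing mass is put at `0`, where the logarithm vanishes. The completed measure may charge
`0` and so need not be Thorin, which is why the Dirichlet identity was proved for base laws on
`[0,∞)`. -/
lemma meanLaw_nonempty {θ : ℝ} (hθ : 0 < θ) {ν : Measure ℝ} (hν : IsThorin ν)
    (h1 : ν univ ≤ 1) : (meanLaw θ ν).Nonempty := by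
  set H := ν + (1 - ν univ) • Measure.dirac 0 with hH
  have hp : IsProbabilityMeasure H := ⟨by simp [hH, add_tsub_cancel_of_le h1]⟩
  have hlog : ∀ l, logT H l = logT ν l := fun l => by
    simp [logT, hH, lintegral_add_measure, lintegral_smul_measure]
  have h0 : H (Iio 0) = 0 := by
    simp [hH, measure_Iio_of_ae_nonneg (hν.ae_pos.mono fun _ h => h.le)]
  refine ⟨dirichletMean θ H, (mem_meanLaw_iff hθ hν).2 ⟨isNonnegLaw_dirichletMean hθ H, ?_⟩⟩
  intro l hl
  rw [← hlog, sti_dirichletMean hθ H h0 (fun s hs => by rw [hlog]; exact hν.logT_ne_top hs) hl]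

/-- Since `l / (1 + l M)` increases with `l`, doubling `l` raises the exponent `ϑ_ν` by at most `log
2`. That increment is `∫ log ((1 + 2 l x) / (1 + l x)) ν(dx)`, which increases to `ν((0,∞)) log 2`.
-/
lemma measure_univ_le_one_of_mem_meanLaw {θ : ℝ} (hθ : 0 < θ) {ν m : Measure ℝ}
    (hν : IsThorin ν) (h : m ∈ meanLaw θ ν) : ν univ ≤ 1 := by
  rw [mem_meanLaw_iff hθ hν] at h
  obtain ⟨hm, hst⟩ := h
  have hlog2 : 0 < Real.log 2 := Real.log_pos one_lt_two
  have hmono : ∀ l, 0 < l → ENNReal.ofReal (l ^ θ) * sti θ m l ≤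
      ENNReal.ofReal ((2 * l) ^ θ) * sti θ m (2 * l) := by
    intro l hl
    unfold sti
    rw [← lintegral_const_mul' _ _ ENNReal.ofReal_ne_top,
      ← lintegral_const_mul' _ _ ENNReal.ofReal_ne_top]
    refine lintegral_mono_ae ?_
    filter_upwards [ae_nonneg_of_Iio hm.nonneg] with x hx
    have p1 : 0 < 1 + l * x := by positivity
    have p2 : 0 < 1 + 2 * l * x := by positivity
    rw [← ENNReal.ofReal_mul (by positivity), ← ENNReal.ofReal_mul (by positivity)]
    refine ENNReal.ofReal_le_ofReal ?_
    rw [Real.rpow_neg p1.le, Real.rpow_neg p2.le, ← div_eq_mul_inv, ← div_eq_mul_inv,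
      ← Real.div_rpow hl.le p1.le, ← Real.div_rpow (by positivity) p2.le]
    refine Real.rpow_le_rpow (by positivity) ?_ hθ.le
    rw [div_le_div_iff₀ p1 p2]
    nlinarith
  have hdiff : ∀ l, 0 < l → (logT ν (2 * l)).toReal ≤ (logT ν l).toReal + Real.log 2 := by
    intro l hl
    have h1 := hmono l hl
    rw [hst l hl, hst (2 * l) (by positivity), ← ENNReal.ofReal_mul (by positivity),
      ← ENNReal.ofReal_mul (by positivity),
      ENNReal.ofReal_le_ofReal_iff (by positivity), Real.rpow_def_of_pos hl,
      Real.rpow_def_of_pos (by positivity), ← Real.exp_add, ← Real.exp_add, Real.exp_le_exp,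
      Real.log_mul two_ne_zero hl.ne'] at h1
    nlinarith
  have hint : ∀ l, 0 < l → ∫⁻ x, ENNReal.ofReal (Real.log ((1 + 2 * l * x) / (1 + l * x))) ∂ν ≤
      ENNReal.ofReal (Real.log 2) := by
    intro l hl
    have hsum : logT ν l + ∫⁻ x, ENNReal.ofReal (Real.log ((1 + 2 * l * x) / (1 + l * x))) ∂ν =
        logT ν (2 * l) := by
      unfold logT
      rw [← lintegral_add_left (by fun_prop)]
      refine lintegral_congr_ae ?_
      filter_upwards [hν.ae_pos] with x hx
      have p1 : 0 < l * x := by positivity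
      rw [Real.log_div (by positivity) (by positivity), ← ENNReal.ofReal_add
        (Real.log_nonneg (by linarith))]
      · ring_nf
      · rw [sub_nonneg]
        exact Real.log_le_log (by positivity) (by linarith)
    have hfin := hν.logT_ne_top hl
    have hfin2 := hν.logT_ne_top (l := 2 * l) (by positivity)
    rw [← ENNReal.add_le_add_iff_left hfin, hsum, ← ENNReal.ofReal_toReal hfin,
      ← ENNReal.ofReal_toReal hfin2, ← ENNReal.ofReal_add ENNReal.toReal_nonneg hlog2.le]
    exact ENNReal.ofReal_le_ofReal (hdiff l hl)
  have hlim : Tendsto (fun n : ℕ => ∫⁻ x, ENNReal.ofReal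
      (Real.log ((1 + 2 * ((n : ℝ) + 1) * x) / (1 + ((n : ℝ) + 1) * x))) ∂ν) atTop
      (𝓝 (∫⁻ _, ENNReal.ofReal (Real.log 2) ∂ν)) := by
    refine lintegral_tendsto_of_tendsto_of_monotone (fun n => by fun_prop) ?_ ?_
    · filter_upwards [hν.ae_pos] with x hx n k hnk
      have hnk' : (n : ℝ) ≤ k := by exact_mod_cast hnk
      refine ENNReal.ofReal_le_ofReal (Real.log_le_log (by positivity) ?_)
      rw [div_le_div_iff₀ (by positivity) (by positivity)]
      nlinarith
    · filter_upwards [hν.ae_pos] with x hx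
      have e : ∀ n : ℕ, (1 + 2 * ((n : ℝ) + 1) * x) / (1 + ((n : ℝ) + 1) * x) =
          (1 / ((n : ℝ) + 1) + 2 * x) / (1 / ((n : ℝ) + 1) + x) := fun n => by field_simp
      simp_rw [e]
      have h0 := tendsto_one_div_add_atTop_nhds_zero_nat (𝕜 := ℝ)
      have h2 := (h0.add_const (2 * x)).div (h0.add_const x) (by rw [zero_add]; exact hx.ne')
      rw [zero_add, zero_add, mul_div_assoc, div_self hx.ne', mul_one] at h2
      exact ENNReal.tendsto_ofReal (h2.log two_ne_zero)
  have hle := le_of_tendsto' hlim fun n : ℕ => hint ((n : ℝ) + 1) (by positivity)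
  rw [lintegral_const] at hle
  have hc : ENNReal.ofReal (Real.log 2) ≠ 0 := by simpa using hlog2
  exact (ENNReal.mul_le_mul_iff_right hc ENNReal.ofReal_ne_top).1 (by simpa using hle)

/-! ### Existence of GGC laws by countable convolution -/

lemma lintegral_prod_infinitePi (n : ℕ) : ∀ (μ : ℕ → Measure ℝ) [∀ n, IsProbabilityMeasure (μ n)]
    (f : ℕ → ℝ → ℝ≥0∞), (∀ k, Measurable (f k)) →
    ∫⁻ x, ∏ k ∈ Finset.range n, f k (x k) ∂(Measure.infinitePi μ) =
      ∏ k ∈ Finset.range n, ∫⁻ x, f k x ∂(μ k) := by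
  induction n with
  | zero => intro μ _ f _; simp
  | succ n ih =>
    intro μ _ f hf
    have hmeas : ∀ (n : ℕ) (f : ℕ → ℝ → ℝ≥0∞), (∀ k, Measurable (f k)) →
        Measurable fun x : ℕ → ℝ => ∏ k ∈ Finset.range n, f k (x k) := fun n f hf =>
      Finset.measurable_fun_prod _ fun k _ => (hf k).comp (measurable_pi_apply k)
    rw [lintegral_infinitePi_eq_cons μ _ (hmeas (n + 1) f hf)]
    simp_rw [Finset.prod_range_succ']
    have e : ∀ (x : ℝ) (v : ℕ → ℝ), ∀ k, consSeq x v (k + 1) = v k := fun _ _ _ => rfl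
    have e0 : ∀ (x : ℝ) (v : ℕ → ℝ), consSeq x v 0 = x := fun _ _ => rfl
    simp_rw [e, e0]
    have h1 : ∀ x, ∫⁻ v, (∏ k ∈ Finset.range n, f (k + 1) (v k)) * f 0 x
        ∂(Measure.infinitePi fun n => μ (n + 1)) =
        (∏ k ∈ Finset.range n, ∫⁻ x, f (k + 1) x ∂(μ (k + 1))) * f 0 x := by
      intro x
      rw [lintegral_mul_const _ (hmeas n (fun k => f (k + 1)) fun k => hf (k + 1)),
        ih (fun n => μ (n + 1)) (fun k => f (k + 1)) fun k => hf (k + 1)]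
    simp_rw [h1]
    rw [lintegral_const_mul _ (hf 0)]

/-- Convolution of countably many laws: the exponents add up. -/
lemma exists_law_of_tsum {μ : ℕ → Measure ℝ} (hμ : ∀ n, IsNonnegLaw (μ n)) {ψ : ℕ → ℝ → ℝ≥0∞}
    (hψ : ∀ n l, 0 < l → lap (μ n) l = ENNReal.ofReal (Real.exp (-(ψ n l).toReal)))
    (hfin : ∀ l, 0 < l → ∑' n, ψ n l ≠ ∞)
    (hlim : Tendsto (fun j : ℕ => ∑' n, ψ n (1 / ((j : ℝ) + 1))) atTop (𝓝 0)) :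
    ∃ m, IsNonnegLaw m ∧
      ∀ l, 0 < l → lap m l = ENNReal.ofReal (Real.exp (-(∑' n, ψ n l).toReal)) := by
  have hpr := fun n => (hμ n).prob
  set P := Measure.infinitePi μ
  let X : (ℕ → ℝ) → ℝ≥0∞ := fun x => ∑' k, ENNReal.ofReal (x k)
  have hX : Measurable X := Measurable.tsum fun k => by fun_prop
  have hx0 : ∀ᵐ x ∂P, ∀ k, 0 ≤ x k := ae_infinitePi μ fun n => ae_nonneg_of_Iio (hμ n).nonneg
  -- This is `exp (-l X)` with the convention that it vanishes at `X = ∞`, the limit of the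
  -- exponentials of the partial sums.
  let e : ℝ → (ℕ → ℝ) → ℝ≥0∞ := fun l x =>
    if X x = ∞ then 0 else ENNReal.ofReal (Real.exp (-(l * (X x).toReal)))
  have hpart : ∀ l, 0 < l → ∀ n, ∫⁻ x, ENNReal.ofReal
      (Real.exp (-(l * ∑ k ∈ Finset.range n, x k))) ∂P =
      ENNReal.ofReal (Real.exp (-(∑ k ∈ Finset.range n, ψ k l).toReal)) := by
    intro l hl n
    have h1 : ∀ x : ℕ → ℝ, ENNReal.ofReal (Real.exp (-(l * ∑ k ∈ Finset.range n, x k))) =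
        ∏ k ∈ Finset.range n, ENNReal.ofReal (Real.exp (-(l * x k))) := by
      intro x
      rw [← ENNReal.ofReal_prod_of_nonneg fun k _ => (Real.exp_pos _).le, ← Real.exp_sum,
        Finset.sum_neg_distrib, Finset.mul_sum]
    simp_rw [h1]
    rw [lintegral_prod_infinitePi n μ (fun _ x => ENNReal.ofReal (Real.exp (-(l * x))))
      fun k => by fun_prop]
    have h2 : ∀ k, ∫⁻ x, ENNReal.ofReal (Real.exp (-(l * x))) ∂(μ k) =
        ENNReal.ofReal (Real.exp (-(ψ k l).toReal)) := fun k => hψ k l hl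
    simp_rw [h2]
    rw [← ENNReal.ofReal_prod_of_nonneg fun k _ => (Real.exp_pos _).le, ← Real.exp_sum,
      Finset.sum_neg_distrib, ENNReal.toReal_sum]
    exact fun k _ => ENNReal.ne_top_of_tsum_ne_top (hfin l hl) k
  have hconv : ∀ l, 0 < l → Tendsto (fun n : ℕ => ∫⁻ x, ENNReal.ofReal
      (Real.exp (-(l * ∑ k ∈ Finset.range n, x k))) ∂P) atTop (𝓝 (∫⁻ x, e l x ∂P)) := by
    intro l hl
    refine tendsto_lintegral_of_dominated_convergence (fun _ => 1) (fun n => by fun_prop) ?_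
      (by simp) ?_
    · intro n
      filter_upwards [hx0] with x hx
      rw [← ENNReal.ofReal_one]
      refine ENNReal.ofReal_le_ofReal ?_
      have := mul_nonneg hl.le (Finset.sum_nonneg fun k (_ : k ∈ Finset.range n) => hx k)
      simpa using this
    · filter_upwards [hx0] with x hx
      have hS : Tendsto (fun n => ENNReal.ofReal (∑ k ∈ Finset.range n, x k)) atTop
          (𝓝 (X x)) := by
        have := ENNReal.tendsto_nat_tsum fun k => ENNReal.ofReal (x k)
        refine this.congr fun n => ?_
        rw [ENNReal.ofReal_sum_of_nonneg fun k _ => hx k]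
      simp only [e]
      split_ifs with hXt
      · rw [hXt] at hS
        have h3 : Tendsto (fun n => ∑ k ∈ Finset.range n, x k) atTop atTop := by
          refine tendsto_atTop.2 fun b => ?_
          have := hS.eventually (lt_mem_nhds (show ENNReal.ofReal (max b 0) < ∞ from ENNReal.ofReal_lt_top))
          filter_upwards [this] with n hn
          have hs := Finset.sum_nonneg fun k (_ : k ∈ Finset.range n) => hx k
          exact (le_max_left b 0).trans ((ENNReal.ofReal_le_ofReal_iff hs).1 hn.le)
        have h4 := ENNReal.tendsto_ofReal
          (Real.tendsto_exp_neg_atTop_nhds_zero.comp (h3.const_mul_atTop hl))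
        simpa using h4
      · have h3 := (ENNReal.tendsto_toReal hXt).comp hS
        have h4 : Tendsto (fun n => ∑ k ∈ Finset.range n, x k) atTop (𝓝 (X x).toReal) := by
          refine h3.congr fun n => ?_
          exact ENNReal.toReal_ofReal (Finset.sum_nonneg fun k _ => hx k)
        exact ENNReal.tendsto_ofReal ((Real.continuous_exp.tendsto _).comp (h4.const_mul l).neg)
  have he : ∀ l, 0 < l → ∫⁻ x, e l x ∂P =
      ENNReal.ofReal (Real.exp (-(∑' n, ψ n l).toReal)) := by
    intro l hl
    refine tendsto_nhds_unique (hconv l hl) ?_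
    simp_rw [hpart l hl]
    refine ENNReal.tendsto_ofReal ((Real.continuous_exp.tendsto _).comp ?_)
    exact ((ENNReal.tendsto_toReal (hfin l hl)).comp (ENNReal.tendsto_nat_tsum fun k => ψ k l)).neg
  have hms : MeasurableSet {x | X x ≠ ∞} := hX (measurableSet_singleton ∞).compl
  -- The expectation of `e l` is at most the probability that `X` is finite, and `hlim` makes it
  -- tend to `1` as `l → 0`.
  have hXfin : ∀ᵐ x ∂P, X x ≠ ∞ := by
    have h1 : Tendsto (fun j : ℕ => ∫⁻ x, e (1 / ((j : ℝ) + 1)) x ∂P) atTop (𝓝 1) := by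
      have e' : ∀ j : ℕ, ∫⁻ x, e (1 / ((j : ℝ) + 1)) x ∂P = _ := fun j =>
        he (1 / ((j : ℝ) + 1)) (by positivity)
      simp_rw [e']
      have h2 := ((ENNReal.tendsto_toReal ENNReal.zero_ne_top).comp hlim).neg
      have h3 := ENNReal.tendsto_ofReal ((Real.continuous_exp.tendsto _).comp h2)
      simpa using h3
    have hle : (1 : ℝ≥0∞) ≤ P {x | X x ≠ ∞} := by
      refine le_of_tendsto' h1 fun j => ?_
      rw [← lintegral_indicator_one hms]
      refine lintegral_mono fun x => ?_
      by_cases h : X x = ∞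
      · simp [e, h]
      · rw [indicator_of_mem (by exact h)]
        simp only [e, if_neg h, Pi.one_apply]
        rw [← ENNReal.ofReal_one]
        refine ENNReal.ofReal_le_ofReal ?_
        have : 0 ≤ 1 / ((j : ℝ) + 1) * (X x).toReal := by positivity
        simpa using this
    have := (prob_compl_eq_zero_iff hms).2 (le_antisymm prob_le_one hle)
    rw [ae_iff]
    exact this
  have hXr : Measurable fun x => (X x).toReal := hX.ennreal_toReal
  refine ⟨P.map fun x => (X x).toReal, ⟨Measure.isProbabilityMeasure_map hXr.aemeasurable,
    measure_Iio_of_ae_nonneg ((ae_map_iff hXr.aemeasurable measurableSet_Ici).2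
      (ae_of_all _ fun x => ENNReal.toReal_nonneg))⟩, fun l hl => ?_⟩
  rw [← he l hl, lap, lintegral_map (by fun_prop) hXr]
  refine lintegral_congr_ae ?_
  filter_upwards [hXfin] with x hx
  simp only [e, if_neg hx]

lemma logT_mono {ν ν' : Measure ℝ} (h : ν ≤ ν') (l : ℝ) : logT ν l ≤ logT ν' l :=
  lintegral_mono' h le_rfl

lemma isThorin_of_le {ν ν' : Measure ℝ} (h : ν ≤ ν') (hν' : IsThorin ν') : IsThorin ν :=
  isThorin_of_logT (h.absolutelyContinuous.ae_le hν'.ae_pos)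
    fun l hl => ne_top_of_le_ne_top (hν'.logT_ne_top hl) (logT_mono h l)

/-- With `t` the total mass and `H = ν / t`, the Dirichlet mean of parameter `θ t` has exponent `θ t
ϑ_H = θ ϑ_ν`; gamma randomization turns it into the law required. The zero measure corresponds to
the point mass at `0`. -/
lemma GGC_nonempty_of_isFiniteMeasure {θ : ℝ} (hθ : 0 < θ) {ν : Measure ℝ} (hν : IsThorin ν)
    [IsFiniteMeasure ν] : (GGC θ ν).Nonempty := by
  by_cases h0 : ν = 0
  · subst h0
    refine ⟨Measure.dirac 0, (mem_GGC_iff hν).2 ⟨⟨inferInstance, by simp⟩, fun l hl => ?_⟩⟩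
    simp [lap, logT]
  · have hne : ν univ ≠ 0 := by simpa using h0
    set t := (ν univ).toReal with ht
    have ht0 : 0 < t := ENNReal.toReal_pos hne (measure_ne_top _ _)
    set H := (ν univ)⁻¹ • ν with hH
    have hp : IsProbabilityMeasure H := ⟨by
      rw [hH, Measure.smul_apply, smul_eq_mul, ENNReal.inv_mul_cancel hne (measure_ne_top _ _)]⟩
    have hlog : ∀ l, logT H l = (ν univ)⁻¹ * logT ν l := fun l => by
      rw [logT, hH, lintegral_smul_measure, smul_eq_mul, logT]
    have hHT : IsThorin H := by
      refine isThorin_of_logT (Measure.ae_smul_measure hν.ae_pos _) fun l hl => ?_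
      rw [hlog]
      exact ENNReal.mul_ne_top (ENNReal.inv_ne_top.2 hne) (hν.logT_ne_top hl)
    have hmem := gammaMixture_mem_GGC (θ := θ * t) (by positivity) hHT
      (dirichletMean_mem_meanLaw (by positivity) hHT)
    rw [mem_GGC_iff hHT] at hmem
    refine ⟨_, (mem_GGC_iff hν).2 ⟨hmem.1, fun l hl => ?_⟩⟩
    rw [hmem.2 l hl, hlog, ENNReal.toReal_mul, ENNReal.toReal_inv, ← ht]
    congr 3
    field_simp

/-- A sigma-finite `ν` is a sum of finite measures, each Thorin because it is dominated by `ν`. The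
exponents add up under convolution. -/
lemma GGC_nonempty {θ : ℝ} (hθ : 0 < θ) {ν : Measure ℝ} (hν : IsThorin ν) :
    (GGC θ ν).Nonempty := by
  have := hν.sigmaFinite
  have hle : ∀ n, sfiniteSeq ν n ≤ ν := fun n => sfiniteSeq_le ν n
  have hT : ∀ n, IsThorin (sfiniteSeq ν n) := fun n => isThorin_of_le (hle n) hν
  choose μ hμ using fun n => GGC_nonempty_of_isFiniteMeasure hθ (hT n)
  have hμ' := fun n => (mem_GGC_iff (hT n)).1 (hμ n)
  have hsum : ∀ l, ∑' n, ENNReal.ofReal θ * logT (sfiniteSeq ν n) l =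
      ENNReal.ofReal θ * logT ν l := by
    intro l
    rw [ENNReal.tsum_mul_left]
    congr 1
    unfold logT
    rw [← lintegral_sum_measure, sum_sfiniteSeq]
  obtain ⟨m, hm, hlap⟩ := exists_law_of_tsum (fun n => (hμ' n).1)
    (ψ := fun n l => ENNReal.ofReal θ * logT (sfiniteSeq ν n) l) (fun n l hl => by
      rw [(hμ' n).2 l hl, ENNReal.toReal_mul, ENNReal.toReal_ofReal hθ.le])
    (fun l hl => by
      rw [hsum]; exact ENNReal.mul_ne_top ENNReal.ofReal_ne_top (hν.logT_ne_top hl))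
    (by
      simp_rw [hsum]
      have := ENNReal.Tendsto.const_mul (a := ENNReal.ofReal θ) (tendsto_logT_zero
        (measure_Iio_of_ae_nonneg (hν.ae_pos.mono fun _ h => h.le)) (hν.logT_ne_top one_pos))
        (Or.inr ENNReal.ofReal_ne_top)
      simpa using this)
  refine ⟨m, (mem_GGC_iff hν).2 ⟨hm, fun l hl => ?_⟩⟩
  rw [hlap l hl, hsum, ENNReal.toReal_mul, ENNReal.toReal_ofReal hθ.le]

/-! ### Existence of the stable law -/

/-- The measure with density `x ^ (-α - 1)` on `(0,∞)`, proportional to the Thorin measure of the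
`α`-stable law. -/
noncomputable def powerMeasure (α : ℝ) : Measure ℝ :=
  (volume.restrict (Ioi 0)).withDensity fun x => ENNReal.ofReal (x ^ (-α - 1))

lemma lintegral_powerMeasure (α : ℝ) {f : ℝ → ℝ≥0∞} (hf : Measurable f) :
    ∫⁻ x, f x ∂(powerMeasure α) = ∫⁻ x in Ioi 0, ENNReal.ofReal (x ^ (-α - 1)) * f x := by
  rw [powerMeasure, lintegral_withDensity_eq_lintegral_mul _ (by fun_prop) hf]
  rfl

lemma log_one_add_le_rpow {u b : ℝ} (hu : 0 ≤ u) (hb0 : 0 < b) (hb1 : b ≤ 1) :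
    Real.log (1 + u) ≤ u ^ b / b := by
  have h1 : (1 + u) ^ b ≤ 1 + u ^ b := by
    simpa using Real.rpow_add_le_add_rpow zero_le_one hu hb0.le hb1
  have h2 : 0 ≤ u ^ b := Real.rpow_nonneg hu b
  rw [le_div_iff₀ hb0, mul_comm, ← Real.log_rpow (by linarith)]
  calc Real.log ((1 + u) ^ b) ≤ (1 + u) ^ b - 1 := Real.log_le_sub_one_of_pos (by positivity)
    _ ≤ u ^ b := by linarith

/-- The bound `log (1 + x) ≤ x` suffices near `0`; at infinity the power `α / 2 < α` leaves an
integrable tail. -/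
lemma logT_powerMeasure_one_ne_top {α : ℝ} (h0 : 0 < α) (h1 : α < 1) :
    logT (powerMeasure α) 1 ≠ ∞ := by
  rw [logT, lintegral_powerMeasure α (by fun_prop), ← Ioc_union_Ioi_eq_Ioi zero_le_one,
    lintegral_union measurableSet_Ioi (Ioc_disjoint_Ioi le_rfl)]
  refine ENNReal.add_ne_top.2 ⟨?_, ?_⟩
  · have hi : IntegrableOn (fun x : ℝ => x ^ (-α)) (Ioc 0 1) :=
      (intervalIntegrable_iff_integrableOn_Ioc_of_le zero_le_one).1
        (intervalIntegral.intervalIntegrable_rpow' (by linarith))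
    refine ne_top_of_le_ne_top hi.lintegral_lt_top.ne (setLIntegral_mono' measurableSet_Ioc ?_)
    intro x hx
    have hx0 := hx.1
    rw [← ENNReal.ofReal_mul (by positivity)]
    refine ENNReal.ofReal_le_ofReal ?_
    have := log_one_add_le_rpow hx0.le one_pos le_rfl
    rw [Real.rpow_one, div_one] at this
    rw [one_mul]
    calc x ^ (-α - 1) * Real.log (1 + x) ≤ x ^ (-α - 1) * x := by gcongr
      _ = x ^ (-α) := by
        rw [Real.rpow_sub hx0, Real.rpow_one]; field_simp
  · have hi : IntegrableOn (fun x : ℝ => x ^ (-(α / 2) - 1) * (2 / α)) (Ioi 1) :=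
      (integrableOn_Ioi_rpow_of_lt (by linarith) one_pos).mul_const _
    refine ne_top_of_le_ne_top hi.lintegral_lt_top.ne (setLIntegral_mono' measurableSet_Ioi ?_)
    intro x hx
    have hx0 : (0 : ℝ) < x := zero_lt_one.trans hx
    rw [← ENNReal.ofReal_mul (by positivity)]
    refine ENNReal.ofReal_le_ofReal ?_
    have := log_one_add_le_rpow hx0.le (b := α / 2) (by linarith) (by linarith)
    rw [one_mul]
    calc x ^ (-α - 1) * Real.log (1 + x) ≤ x ^ (-α - 1) * (x ^ (α / 2) / (α / 2)) := by gcongr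
      _ = (x ^ (-α - 1) * x ^ (α / 2)) * (2 / α) := by field_simp
      _ = x ^ (-(α / 2) - 1) * (2 / α) := by
        rw [← Real.rpow_add hx0]; ring_nf

lemma logT_powerMeasure_one_ne_zero (α : ℝ) : logT (powerMeasure α) 1 ≠ 0 := by
  intro h
  rw [logT, lintegral_powerMeasure α (by fun_prop), lintegral_eq_zero_iff (by fun_prop),
    EventuallyEq, ae_restrict_iff' measurableSet_Ioi] at h
  have h2 : ∀ᵐ x : ℝ, x ∉ Ioi (0 : ℝ) := by
    filter_upwards [h] with x hx hx0
    have hx0' : (0 : ℝ) < x := hx0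
    have h3 := hx hx0
    simp only [Pi.zero_apply, mul_eq_zero, ENNReal.ofReal_eq_zero] at h3
    rcases h3 with h3 | h3
    · exact absurd h3 (not_le.2 (by positivity))
    · exact absurd h3 (not_le.2 (Real.log_pos (by linarith)))
  have h3 : volume (Ioi (0 : ℝ)) = 0 := by simpa [ae_iff, Ioi] using h2
  simp at h3

/-- Scaling shows that the exponent is homogeneous of degree `α`, so the constant never has to be
evaluated. -/
lemma logT_powerMeasure {α l : ℝ} (hl : 0 < l) :
    logT (powerMeasure α) l = ENNReal.ofReal (l ^ α) * logT (powerMeasure α) 1 := by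
  have himg : (fun y => l * y) '' Ioi 0 = Ioi 0 := by
    ext x
    constructor
    · rintro ⟨y, hy, rfl⟩; exact mul_pos hl hy
    · intro hx; exact ⟨x / l, div_pos hx hl, mul_div_cancel₀ _ hl.ne'⟩
  unfold logT
  rw [lintegral_powerMeasure α (by fun_prop), lintegral_powerMeasure α (by fun_prop)]
  conv_rhs => rw [← himg]
  rw [lintegral_image_eq_lintegral_abs_deriv_mul measurableSet_Ioi (f' := fun _ => l),
    ← lintegral_const_mul' _ _ ENNReal.ofReal_ne_top]
  · refine setLIntegral_congr_fun measurableSet_Ioi fun y hy => ?_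
    have hy' : (0 : ℝ) < y := hy
    have e : l ^ α * l * l ^ (-α - 1) = 1 := by
      nth_rewrite 2 [← Real.rpow_one l]
      rw [← Real.rpow_add hl, ← Real.rpow_add hl]; simp
    rw [abs_of_pos hl, one_mul, ← ENNReal.ofReal_mul (by positivity),
      ← ENNReal.ofReal_mul (by positivity), ← ENNReal.ofReal_mul hl.le,
      ← ENNReal.ofReal_mul (by positivity)]
    congr 1
    rw [Real.mul_rpow hl.le hy'.le]
    linear_combination (-(y ^ (-α - 1) * Real.log (1 + l * y))) * e
  · intro y _
    exact (((hasDerivAt_id y).const_mul l).congr_deriv (by simp)).hasDerivWithinAt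
  · intro x _ y _ hxy
    exact mul_left_cancel₀ hl.ne' hxy

/-- The stable law is the GGC law of the power measure, with parameter the inverse of the exponent
at `1`. -/
lemma stableLaw_nonempty {α : ℝ} (h0 : 0 < α) (h1 : α < 1) : (stableLaw α).Nonempty := by
  have htop := logT_powerMeasure_one_ne_top h0 h1
  have hT : IsThorin (powerMeasure α) := by
    refine isThorin_of_logT ?_ fun l hl => ?_
    · exact (withDensity_absolutelyContinuous _ _).ae_le (self_mem_ae_restrict measurableSet_Ioi)
    · rw [logT_powerMeasure hl]
      exact ENNReal.mul_ne_top ENNReal.ofReal_ne_top htop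
  have hc : 0 < (logT (powerMeasure α) 1).toReal :=
    ENNReal.toReal_pos (logT_powerMeasure_one_ne_zero α) htop
  obtain ⟨m, hm⟩ := GGC_nonempty (θ := 1 / (logT (powerMeasure α) 1).toReal) (by positivity) hT
  rw [mem_GGC_iff hT] at hm
  refine ⟨m, mem_stableLaw_iff.2 ⟨hm.1, fun l hl => ?_⟩⟩
  rw [hm.2 l hl, logT_powerMeasure hl, ENNReal.toReal_mul, ENNReal.toReal_ofReal (by positivity)]
  congr 3
  field_simp

/-! ### Stable mixtures and exponential tilting -/

lemma lap_zero {m : Measure ℝ} (hm : IsNonnegLaw m) : lap m 0 = 1 := by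
  have := hm.prob
  simp [lap]

/-- Given `Z`, the stable factor contributes `exp (-(l Z ^ (1 / α)) ^ α) = exp (-l ^ α Z)`. -/
lemma lap_stable_mixture {α : ℝ} (h0 : 0 < α) {Z S : Measure ℝ} (hZ : IsNonnegLaw Z)
    (hS : S ∈ stableLaw α) {l : ℝ} (hl : 0 < l) :
    lap (prodLaw (powLaw (1 / α) Z) S) l = lap Z (l ^ α) := by
  rw [mem_stableLaw_iff] at hS
  have := hS.1.prob
  -- The mixing variable may vanish, so the stable transform is also needed at `0`.
  have hS0 : ∀ t, 0 ≤ t → lap S t = ENNReal.ofReal (Real.exp (-(t ^ α))) := by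
    intro t ht
    rcases ht.eq_or_lt with rfl | ht
    · rw [lap_zero hS.1, Real.zero_rpow h0.ne']; simp
    · exact hS.2 t ht
  have hm : Measurable fun x => ∫⁻ y, ENNReal.ofReal (Real.exp (-(l * (x * y)))) ∂S :=
    Measurable.lintegral_prod_right' (f := fun z : ℝ × ℝ =>
      ENNReal.ofReal (Real.exp (-(l * (z.1 * z.2))))) (by fun_prop)
  rw [lap, lintegral_prodLaw (by fun_prop), powLaw, lintegral_map hm (by fun_prop), lap]
  refine lintegral_congr_ae ?_
  filter_upwards [ae_nonneg_of_Iio hZ.nonneg] with z hz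
  have h2 := hS0 (l * z ^ (1 / α)) (by positivity)
  rw [Real.mul_rpow hl.le (by positivity), ← Real.rpow_mul hz, one_div_mul_cancel h0.ne',
    Real.rpow_one] at h2
  rw [← h2, lap]
  simp_rw [mul_assoc]

lemma expTilt_one_zero {m : Measure ℝ} [IsProbabilityMeasure m] : expTilt 1 0 m = m := by
  unfold expTilt
  simp

lemma lap_ne_zero {m : Measure ℝ} (hm : IsNonnegLaw m) (l : ℝ) : lap m l ≠ 0 := by
  have := hm.prob
  rw [lap, ne_eq, lintegral_eq_zero_iff (by fun_prop)]
  intro h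
  have h2 : ∀ᵐ x ∂m, False := by
    filter_upwards [h] with x hx
    rw [Pi.zero_apply, ENNReal.ofReal_eq_zero] at hx
    exact absurd hx (not_le.2 (Real.exp_pos _))
  simp at h2
  exact IsProbabilityMeasure.ne_zero m h2

lemma isNonnegLaw_expTilt {m : Measure ℝ} (hm : IsNonnegLaw m) : IsNonnegLaw (expTilt 1 1 m) := by
  have := hm.prob
  have hint : Integrable (fun x => Real.exp (-(1 * x))) m := by
    refine Integrable.of_bound (C := 1) (by fun_prop) ?_
    filter_upwards [ae_nonneg_of_Iio hm.nonneg] with x hx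
    rw [Real.norm_of_nonneg (Real.exp_pos _).le]
    simpa using hx
  have := isProbabilityMeasure_tilted hint
  have h1 : expTilt 1 1 m = m.tilted (fun x => -(1 * x)) := by simp [expTilt]
  rw [h1]
  exact ⟨this, tilted_absolutelyContinuous _ _ hm.nonneg⟩

/-- Tilting by `exp (-x)` shifts the argument by one and divides by the normalization. -/
lemma lap_expTilt {m : Measure ℝ} (hm : IsNonnegLaw m) {l : ℝ} :
    lap (expTilt 1 1 m) l = lap m (1 + l) / lap m 1 := by
  have := hm.prob
  have hpos : 0 < lap m 1 := pos_iff_ne_zero.2 (lap_ne_zero hm 1)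
  have hfin : lap m 1 ≠ ∞ :=
    ne_top_of_le_ne_top (measure_ne_top m univ) (lap_le hm.nonneg zero_le_one)
  have hI : ∫ x, Real.exp (-(1 * x)) ∂m = (lap m 1).toReal := by
    rw [integral_exp_eq_iff hm one_pos ENNReal.toReal_nonneg, ENNReal.ofReal_toReal hfin]
  have h1 : expTilt 1 1 m = m.tilted (fun x => -(1 * x)) := by simp [expTilt]
  have h2 : lap m (1 + l) = ∫⁻ x, ENNReal.ofReal (Real.exp (-((1 + l) * x))) ∂m := rfl
  rw [h1, lap, lintegral_tilted, hI, h2, div_eq_mul_inv, ← lintegral_mul_const _ (by fun_prop)]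
  refine lintegral_congr fun x => ?_
  rw [ENNReal.ofReal_div_of_pos (ENNReal.toReal_pos hpos.ne' hfin), ENNReal.ofReal_toReal hfin,
    div_eq_mul_inv, mul_right_comm, ← ENNReal.ofReal_mul (Real.exp_pos _).le, ← Real.exp_add]
  ring_nf

lemma exists_stableGGC {α θ : ℝ} (h0 : 0 < α) (h1 : α < 1) (hθ : 0 < θ) {ν : Measure ℝ}
    (hν : IsThorin ν) : ∃ W, IsNonnegLaw W ∧
      (∀ l, 0 < l → lap W l = ENNReal.ofReal (Real.exp (-(θ * (logT ν (l ^ α)).toReal)))) ∧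
      ∀ b c, stableGGC b c α θ ν = {expTilt b c W} := by
  obtain ⟨Z, hZ⟩ := GGC_nonempty hθ hν
  obtain ⟨S, hS⟩ := stableLaw_nonempty h0 h1
  have hZ' := (mem_GGC_iff hν).1 hZ
  refine ⟨prodLaw (powLaw (1 / α) Z) S, isNonnegLaw_prodLaw (isNonnegLaw_powLaw hZ'.1)
    (mem_stableLaw_iff.1 hS).1, fun l hl => ?_, fun b c => ?_⟩
  · rw [lap_stable_mixture h0 hZ'.1 hS hl, hZ'.2 _ (by positivity)]
  · refine eq_singleton_iff_unique_mem.2 ⟨⟨Z, hZ, S, hS, rfl⟩, ?_⟩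
    rintro m ⟨Z', hZ', S', hS', rfl⟩
    rw [eq_of_mem_GGC hν hZ' hZ, eq_of_mem_stableLaw hS' hS]

lemma exponent_rhoMixed {α θ l : ℝ} (h0 : 0 < α) (h1 : α < 1) (hl : 0 < l) {ν : Measure ℝ}
    (hν : IsThorin ν) : α * θ * (logT (rhoMixed α ν) l).toReal = θ * (logT ν (l ^ α)).toReal := by
  have := hν.sigmaFinite
  rw [logT_rhoMixed h0 h1 hl hν.ae_pos, ENNReal.toReal_mul, ENNReal.toReal_ofReal (by positivity)]
  field_simp

lemma exponent_lampertiMixed {α l : ℝ} (h0 : 0 < α) (h1 : α < 1) (hl : 0 < l) {ν : Measure ℝ}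
    (hν : IsThorin ν) : (logT (lampertiMixed α ν) l).toReal =
      (logT (rhoMixed α ν) (1 + l)).toReal - (logT (rhoMixed α ν) 1).toReal := by
  have := hν.sigmaFinite
  rw [← logT_lampertiMixed_add h0 h1 hl hν.ae_pos, ENNReal.toReal_add
    ((isThorin_lampertiMixed h0 h1 hν).logT_ne_top hl)
    ((isThorin_rhoMixed h0 h1 hν).logT_ne_top one_pos)]
  ring

lemma stableGGC_one_zero {α θ : ℝ} (h0 : 0 < α) (h1 : α < 1) (hθ : 0 < θ) {ν : Measure ℝ}
    (hν : IsThorin ν) : ∃ L, stableGGC 1 0 α θ ν = {L} ∧ GGC (α * θ) (rhoMixed α ν) = {L} := by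
  obtain ⟨W, hW, hlap, hset⟩ := exists_stableGGC h0 h1 hθ hν
  have := hW.prob
  have hT := isThorin_rhoMixed h0 h1 hν
  refine ⟨W, by rw [hset, expTilt_one_zero], GGC_eq_singleton hT ((mem_GGC_iff hT).2
    ⟨hW, fun l hl => ?_⟩)⟩
  rw [hlap l hl, exponent_rhoMixed h0 h1 hl hν]

lemma ofReal_exp_div (x y : ℝ) : ENNReal.ofReal (Real.exp x) / ENNReal.ofReal (Real.exp y) =
    ENNReal.ofReal (Real.exp (x - y)) := by
  rw [Real.exp_sub, ENNReal.ofReal_div_of_pos (Real.exp_pos y)]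

/-- After tilting the exponent is `θ (ϑ_ν((1 + l) ^ α) - ϑ_ν(1))`, which equals `α θ` times the
increment of the exponent of `ϱ_{α,ν}` from `1` to `1 + l`, that is, times the exponent of `Λ_{α,ν}`
at `l`. -/
lemma stableGGC_one_one {α θ : ℝ} (h0 : 0 < α) (h1 : α < 1) (hθ : 0 < θ) {ν : Measure ℝ}
    (hν : IsThorin ν) :
    ∃ L, stableGGC 1 1 α θ ν = {L} ∧ GGC (α * θ) (lampertiMixed α ν) = {L} := by
  obtain ⟨W, hW, hlap, hset⟩ := exists_stableGGC h0 h1 hθ hν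
  have hT := isThorin_lampertiMixed h0 h1 hν
  refine ⟨_, hset 1 1, GGC_eq_singleton hT ((mem_GGC_iff hT).2
    ⟨isNonnegLaw_expTilt hW, fun l hl => ?_⟩)⟩
  have hl1 : 0 < 1 + l := by linarith
  rw [lap_expTilt hW, hlap _ hl1, hlap 1 one_pos, ofReal_exp_div,
    exponent_lampertiMixed h0 h1 hl hν, mul_sub, exponent_rhoMixed h0 h1 hl1 hν,
    exponent_rhoMixed h0 h1 one_pos hν]
  congr 2
  ring

/-! ### Gamma tilting, occupation times and products -/

lemma sti_ne_zero {θ : ℝ} {m : Measure ℝ} (hm : IsNonnegLaw m) {l : ℝ} (hl : 0 < l) :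
    sti θ m l ≠ 0 := by
  have := hm.prob
  rw [sti, ne_eq, lintegral_eq_zero_iff (by fun_prop)]
  intro h
  have h2 : ∀ᵐ x ∂m, False := by
    filter_upwards [h, ae_nonneg_of_Iio hm.nonneg] with x hx hx0
    rw [Pi.zero_apply, ENNReal.ofReal_eq_zero] at hx
    have := mul_nonneg hl.le hx0
    exact absurd hx (not_le.2 (by positivity))
  simp at h2
  exact IsProbabilityMeasure.ne_zero m h2

/-- For `Y = M / (1 + M)` one has `1 - Y = 1 / (1 + M)`, so the weight in terms of `M` is `(1 + M) ^
(-θ)`. -/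
lemma lintegral_gammaTilt {θ : ℝ} (hθ : 0 < θ) {m : Measure ℝ} (hm : IsNonnegLaw m)
    {f : ℝ → ℝ≥0∞} (hf : Measurable f) : ∫⁻ y, f y ∂(gammaTilt θ 1 m) =
      (∫⁻ x, ENNReal.ofReal ((1 + x) ^ (-θ)) * f (x / (1 + x)) ∂m) / sti θ m 1 := by
  have := hm.prob
  have hne := sti_ne_zero (θ := θ) hm one_pos
  have hfin : sti θ m 1 ≠ ∞ :=
    ne_top_of_le_ne_top ENNReal.one_ne_top (sti_le_one hθ.le m hm.nonneg zero_le_one)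
  have hI : ∫ x, (1 + 1 * x) ^ (-θ) ∂m = (sti θ m 1).toReal := by
    rw [integral_rpow_eq_iff hm hθ one_pos ENNReal.toReal_nonneg, ENNReal.ofReal_toReal hfin]
  rw [gammaTilt, hI, lintegral_withDensity_eq_lintegral_mul _ (by fun_prop) hf,
    lintegral_map (by fun_prop) (by fun_prop), div_eq_mul_inv, ← lintegral_mul_const _ (by fun_prop)]
  refine lintegral_congr_ae ?_
  filter_upwards [ae_nonneg_of_Iio hm.nonneg] with x hx
  have hx1 : 0 < 1 + x := by linarith
  have e1 : 1 * x / (1 * x + 1) = x / (1 + x) := by rw [one_mul, add_comm]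
  have e2 : 1 - x / (1 + x) = (1 + x)⁻¹ := by field_simp; ring
  rw [Pi.mul_apply, e1, e2, Real.inv_rpow hx1.le, ← Real.rpow_neg hx1.le,
    ENNReal.ofReal_div_of_pos (ENNReal.toReal_pos hne hfin), ENNReal.ofReal_toReal hfin,
    div_eq_mul_inv, mul_right_comm]

lemma isProbabilityMeasure_gammaTilt {θ : ℝ} (hθ : 0 < θ) {m : Measure ℝ} (hm : IsNonnegLaw m) :
    IsProbabilityMeasure (gammaTilt θ 1 m) := by
  have := hm.prob
  refine ⟨?_⟩
  rw [← lintegral_one, lintegral_gammaTilt hθ hm measurable_const]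
  simp only [mul_one]
  have e : ∫⁻ x, ENNReal.ofReal ((1 + x) ^ (-θ)) ∂m = sti θ m 1 := by simp [sti]
  rw [e, ENNReal.div_self (sti_ne_zero hm one_pos)
    (ne_top_of_le_ne_top ENNReal.one_ne_top (sti_le_one hθ.le m hm.nonneg zero_le_one))]

lemma gammaTilt_ae_mem {θ : ℝ} {m : Measure ℝ} (hm : IsNonnegLaw m) :
    ∀ᵐ y ∂(gammaTilt θ 1 m), y ∈ Icc (0 : ℝ) 1 := by
  refine (withDensity_absolutelyContinuous _ _).ae_le ((ae_map_iff
    (Measurable.aemeasurable (by fun_prop)) measurableSet_Icc).2 ?_)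
  filter_upwards [ae_nonneg_of_Iio hm.nonneg] with x hx
  exact ⟨by positivity, by rw [div_le_one (by positivity)]; linarith⟩

lemma isNonnegLaw_gammaTilt {θ : ℝ} (hθ : 0 < θ) {m : Measure ℝ} (hm : IsNonnegLaw m) :
    IsNonnegLaw (gammaTilt θ 1 m) :=
  ⟨isProbabilityMeasure_gammaTilt hθ hm,
    measure_Iio_of_ae_nonneg ((gammaTilt_ae_mem hm).mono fun _ h => h.1)⟩

/-- By `(1 + x) (1 + l x / (1 + x)) = 1 + (1 + l) x`, gamma tilting shifts Stieltjes transforms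
exactly as exponential tilting shifts Laplace transforms. -/
lemma sti_gammaTilt {θ : ℝ} (hθ : 0 < θ) {m : Measure ℝ} (hm : IsNonnegLaw m) {l : ℝ}
    (hl : 0 < l) : sti θ (gammaTilt θ 1 m) l = sti θ m (1 + l) / sti θ m 1 := by
  rw [sti, lintegral_gammaTilt hθ hm (by fun_prop)]
  congr 1
  refine lintegral_congr_ae ?_
  filter_upwards [ae_nonneg_of_Iio hm.nonneg] with x hx
  have hx1 : 0 < 1 + x := by linarith
  rw [← ENNReal.ofReal_mul (by positivity), ← Real.mul_rpow hx1.le (by positivity)]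
  congr 2
  field_simp
  ring

lemma skewedOccupation_eq (α τ : ℝ) (Q : Measure ℝ) : skewedOccupation α τ Q =
    (Q.prod ((stickFractions α τ).prod
      (Measure.infinitePi fun _ : ℕ => (volume : Measure ℝ).restrict (Icc 0 1)))).map fun ω =>
      (stickSum ω.2.1 fun k => if ω.2.2 k ≤ ω.1 then 1 else 0).toReal := rfl

lemma measurable_stickSum_indicator : Measurable fun ω : ℝ × (ℕ → ℝ) × (ℕ → ℝ) =>
    stickSum ω.2.1 fun k => if ω.2.2 k ≤ ω.1 then 1 else 0 := by
  refine measurable_stickSum.comp (f := fun ω : ℝ × (ℕ → ℝ) × (ℕ → ℝ) =>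
    (ω.2.1, fun k => if ω.2.2 k ≤ ω.1 then (1 : ℝ) else 0))
    (Measurable.prodMk (by fun_prop) (measurable_pi_iff.2 fun k => ?_))
  exact Measurable.ite (measurableSet_le (by fun_prop) (by fun_prop)) measurable_const
    measurable_const

lemma isProbabilityMeasure_uniform :
    IsProbabilityMeasure ((volume : Measure ℝ).restrict (Icc 0 1)) := ⟨by simp⟩

lemma isNonnegLaw_skewedOccupation {α τ : ℝ} (h0 : 0 ≤ α) (h1 : α < 1) (hτ : 0 < τ)
    (Q : Measure ℝ) [IsProbabilityMeasure Q] : IsNonnegLaw (skewedOccupation α τ Q) := by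
  have := isProbabilityMeasure_stickFractions h0 h1 hτ
  have := isProbabilityMeasure_uniform
  rw [skewedOccupation_eq]
  have hm := measurable_stickSum_indicator.ennreal_toReal
  exact ⟨Measure.isProbabilityMeasure_map hm.aemeasurable, measure_Iio_of_ae_nonneg
    ((ae_map_iff hm.aemeasurable measurableSet_Ici).2 (ae_of_all _ fun _ => ENNReal.toReal_nonneg))⟩

/-- Indicators of iid uniforms are iid with the two-point law; this passes from the uniform
variables of `skewedOccupation` to a stick-breaking mean. -/
lemma stickTransform_bernoulliLaw_eq {σ α τ p s : ℝ} (h0 : 0 ≤ α) (h1 : α < 1) (hτ : 0 < τ) :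
    stickTransform σ α τ (bernoulliLaw p) s =
      ∫⁻ ω, (1 + ENNReal.ofReal s * stickSum ω.1 fun k => if ω.2 k ≤ p then 1 else 0) ^ (-σ)
        ∂((stickFractions α τ).prod
          (Measure.infinitePi fun _ : ℕ => (volume : Measure ℝ).restrict (Icc 0 1))) := by
  have := isProbabilityMeasure_stickFractions h0 h1 hτ
  have := isProbabilityMeasure_uniform
  have hm : Measurable fun u : ℝ => if u ≤ p then (1 : ℝ) else 0 :=
    Measurable.ite measurableSet_Iic measurable_const measurable_const
  have hmp : Measurable fun (u : ℕ → ℝ) k => if u k ≤ p then (1 : ℝ) else 0 :=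
    measurable_pi_iff.2 fun k => hm.comp (measurable_pi_apply k)
  have hinf : (Measure.infinitePi fun _ : ℕ => bernoulliLaw p) =
      (Measure.infinitePi fun _ : ℕ => (volume : Measure ℝ).restrict (Icc 0 1)).map
        fun u k => if u k ≤ p then (1 : ℝ) else 0 :=
    (Measure.infinitePi_map_pi (fun _ : ℕ => (volume : Measure ℝ).restrict (Icc 0 1))
      (fun _ => hm)).symm
  have hF : Measurable fun ω : (ℕ → ℝ) × (ℕ → ℝ) =>
      (1 + ENNReal.ofReal s * stickSum ω.1 ω.2) ^ (-σ) :=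
    (continuous_one_add_mul_rpow ENNReal.ofReal_ne_top (-σ)).measurable.comp measurable_stickSum
  have hprod := Measure.map_prod_map (stickFractions α τ)
    (Measure.infinitePi fun _ : ℕ => (volume : Measure ℝ).restrict (Icc 0 1)) measurable_id hmp
  rw [Measure.map_id] at hprod
  rw [stickTransform, hinf, hprod, lintegral_map hF (measurable_id.prodMap hmp)]
  rfl

lemma sti_skewedOccupation {α τ l : ℝ} (h0 : 0 < α) (h1 : α < 1) (hτ : 0 < τ)
    (Q : Measure ℝ) [IsProbabilityMeasure Q] (hQ : ∀ᵐ p ∂Q, p ∈ Icc (0 : ℝ) 1) (hl : 0 < l) :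
    sti τ (skewedOccupation α τ Q) l =
      ∫⁻ p, ENNReal.ofReal ((1 - p + p * (1 + l) ^ α) ^ (-(τ / α))) ∂Q := by
  have := isProbabilityMeasure_stickFractions h0.le h1 hτ
  have := isProbabilityMeasure_uniform
  have hm := measurable_stickSum_indicator.ennreal_toReal
  have hF : Measurable fun x : ℝ => ENNReal.ofReal ((1 + l * x) ^ (-τ)) := by fun_prop
  rw [skewedOccupation_eq, sti, lintegral_map hF hm]
  refine (lintegral_prod _ (hF.comp hm).aemeasurable).trans ?_
  refine lintegral_congr_ae ?_
  filter_upwards [hQ] with p hp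
  rw [← stickTransform_bernoulliLaw h0 h1 hτ hp.1 hp.2 hl, stickTransform_bernoulliLaw_eq h0.le h1 hτ]
  refine lintegral_congr_ae ?_
  filter_upwards [(Measure.quasiMeasurePreserving_fst (μ := stickFractions α τ)
    (ν := Measure.infinitePi fun _ : ℕ => (volume : Measure ℝ).restrict (Icc 0 1))).ae
    (stickFractions_ae h0.le h1 hτ)] with ω hω
  have hle := stickSum_le (w := fun k => if ω.2 k ≤ p then 1 else 0)
    (fun k => Ioo_subset_Icc_self (hω k)) zero_le_one (fun k => by split_ifs <;> norm_num)
  have hne := ne_top_of_le_ne_top ENNReal.ofReal_ne_top hle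
  rw [Function.comp_apply, ← one_add_mul_rpow hl.le ENNReal.toReal_nonneg,
    ENNReal.ofReal_toReal hne]

/-- Given skewness `x / (1 + x)`, the conditional transform is a power `-θ`, and the tilt
contributes `(1 + x) ^ (-θ)`. Their bases multiply to `1 + (1 + l) ^ α x`, leaving the ratio of the
transforms of `M` at `(1 + l) ^ α` and at `1`. -/
lemma skewedOccupation_mem_meanLaw {α θ : ℝ} (h0 : 0 < α) (h1 : α < 1) (hθ : 0 < θ)
    {ν M : Measure ℝ} (hν : IsThorin ν) (hM : M ∈ meanLaw θ ν) :
    skewedOccupation α (α * θ) (gammaTilt θ 1 M) ∈ meanLaw (α * θ) (lampertiMixed α ν) := by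
  have hτ : 0 < α * θ := by positivity
  rw [mem_meanLaw_iff hθ hν] at hM
  have hp := isProbabilityMeasure_gammaTilt hθ hM.1
  refine (mem_meanLaw_iff hτ (isThorin_lampertiMixed h0 h1 hν)).2
    ⟨isNonnegLaw_skewedOccupation h0.le h1 hτ _, fun l hl => ?_⟩
  have hl1 : 0 < 1 + l := by linarith
  rw [sti_skewedOccupation h0 h1 hτ _ (gammaTilt_ae_mem hM.1) hl,
    lintegral_gammaTilt hθ hM.1 (by fun_prop), mul_div_cancel_left₀ _ h0.ne']
  have e : ∫⁻ x, ENNReal.ofReal ((1 + x) ^ (-θ)) *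
      ENNReal.ofReal ((1 - x / (1 + x) + x / (1 + x) * (1 + l) ^ α) ^ (-θ)) ∂M =
      sti θ M ((1 + l) ^ α) := by
    refine lintegral_congr_ae ?_
    filter_upwards [ae_nonneg_of_Iio hM.1.nonneg] with x hx
    have hx1 : 0 < 1 + x := by linarith
    have e2 : 1 - x / (1 + x) + x / (1 + x) * (1 + l) ^ α =
        (1 + (1 + l) ^ α * x) / (1 + x) := by field_simp; ring
    rw [e2, ← ENNReal.ofReal_mul (by positivity), ← Real.mul_rpow hx1.le (by positivity),
      mul_div_cancel₀ _ hx1.ne']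
  rw [e, hM.2 _ (by positivity), hM.2 1 one_pos, ofReal_exp_div,
    exponent_lampertiMixed h0 h1 hl hν, mul_sub, exponent_rhoMixed h0 h1 hl1 hν,
    exponent_rhoMixed h0 h1 one_pos hν, Real.one_rpow]
  congr 2
  ring

lemma gammaTilt_mem_meanLaw {α τ : ℝ} (h0 : 0 < α) (h1 : α < 1) (hτ : 0 < τ)
    {ν N : Measure ℝ} (hν : IsThorin ν) (hN : N ∈ meanLaw τ (rhoMixed α ν)) :
    gammaTilt τ 1 N ∈ meanLaw τ (lampertiMixed α ν) := by
  rw [mem_meanLaw_iff hτ (isThorin_rhoMixed h0 h1 hν)] at hN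
  refine (mem_meanLaw_iff hτ (isThorin_lampertiMixed h0 h1 hν)).2
    ⟨isNonnegLaw_gammaTilt hτ hN.1, fun l hl => ?_⟩
  rw [sti_gammaTilt hτ hN.1 hl, hN.2 _ (by linarith), hN.2 1 one_pos, ofReal_exp_div,
    exponent_lampertiMixed h0 h1 hl hν]
  congr 2
  ring

lemma isThorin_rho {α : ℝ} (h0 : 0 < α) (h1 : α < 1) : IsThorin (rho α) := by
  have := sFinite_rho α
  refine isThorin_of_logT (rho_ae_pos α) fun l hl => ?_
  rw [logT_rho h0 h1 hl]
  exact ENNReal.ofReal_ne_top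

/-- The transform of `M_{αθ}(ϱ_α)` at `t` is `(1 + t ^ α) ^ (-θ)`. At `t = l M ^ (1 / α)` it becomes
`(1 + l ^ α M) ^ (-θ)`, whose mean is the transform of `M` at `l ^ α`. -/
lemma prodLaw_mem_meanLaw {α θ : ℝ} (h0 : 0 < α) (h1 : α < 1) (hθ : 0 < θ)
    {ν M N : Measure ℝ} (hν : IsThorin ν) (hM : M ∈ meanLaw θ ν)
    (hN : N ∈ meanLaw (α * θ) (rho α)) :
    prodLaw N (powLaw (1 / α) M) ∈ meanLaw (α * θ) (rhoMixed α ν) := by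
  have hτ : 0 < α * θ := by positivity
  rw [mem_meanLaw_iff hθ hν] at hM
  rw [mem_meanLaw_iff hτ (isThorin_rho h0 h1)] at hN
  have := hM.1.prob
  have := hN.1.prob
  have hP := isNonnegLaw_powLaw (a := 1 / α) hM.1
  have := hP.prob
  refine (mem_meanLaw_iff hτ (isThorin_rhoMixed h0 h1 hν)).2
    ⟨isNonnegLaw_prodLaw hN.1 hP, fun l hl => ?_⟩
  have hN' : ∀ t, 0 ≤ t → sti (α * θ) N t = ENNReal.ofReal ((1 + t ^ α) ^ (-θ)) := by
    intro t ht
    rcases ht.eq_or_lt with rfl | ht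
    · simp [sti, Real.zero_rpow h0.ne']
    · have hpos : 0 < 1 + t ^ α := by positivity
      rw [hN.2 t ht, logT_rho h0 h1 ht, ENNReal.toReal_ofReal
        (div_nonneg (Real.log_nonneg (by linarith [Real.rpow_pos_of_pos ht α])) h0.le),
        Real.rpow_def_of_pos hpos]
      congr 2
      field_simp
  have hm : Measurable fun y : ℝ =>
      ∫⁻ x : ℝ, ENNReal.ofReal ((1 + l * (x * y)) ^ (-(α * θ))) ∂N :=
    Measurable.lintegral_prod_right' (f := fun z : ℝ × ℝ =>
      ENNReal.ofReal ((1 + l * (z.2 * z.1)) ^ (-(α * θ)))) (by fun_prop)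
  rw [exponent_rhoMixed h0 h1 hl hν, ← hM.2 _ (by positivity), sti,
    lintegral_prodLaw (by fun_prop), lintegral_lintegral_swap (by fun_prop), powLaw,
    lintegral_map hm (by fun_prop), sti]
  refine lintegral_congr_ae ?_
  filter_upwards [ae_nonneg_of_Iio hM.1.nonneg] with x hx
  have h2 := hN' (l * x ^ (1 / α)) (by positivity)
  rw [Real.mul_rpow hl.le (by positivity), ← Real.rpow_mul hx, one_div_mul_cancel h0.ne',
    Real.rpow_one] at h2
  rw [← h2, sti]
  refine lintegral_congr fun y => ?_
  ring_nf

end GGCalculus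

theorem proposition5p7 (α θ : ℝ) (hα0 : 0 < α) (hα1 : α < 1) (hθ : 0 < θ)
    (ν : MeasureTheory.Measure ℝ) (hν : GGCalculus.IsThorin ν) :
    -- both mixed measures are Thorin measures
    GGCalculus.IsThorin (GGCalculus.rhoMixed α ν) ∧
    GGCalculus.IsThorin (GGCalculus.lampertiMixed α ν) ∧
    -- the two equalities of laws (each class consists of exactly one law)
    (∃ L : MeasureTheory.Measure ℝ, GGCalculus.stableGGC 1 0 α θ ν = {L} ∧
      GGCalculus.GGC (α * θ) (GGCalculus.rhoMixed α ν) = {L}) ∧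
    (∃ L : MeasureTheory.Measure ℝ, GGCalculus.stableGGC 1 1 α θ ν = {L} ∧
      GGCalculus.GGC (α * θ) (GGCalculus.lampertiMixed α ν) = {L}) ∧
    -- existence of the mean functional
    ((GGCalculus.meanLaw θ ν).Nonempty ↔ ν Set.univ ≤ 1) ∧
    -- the statements on mean functionals, `M`, `R`, `N`, `K` being the laws of
    -- `M_θ(ν)`, `M_{αθ}(ϱ_α)`, `M_{αθ}(ϱ_{α,ν})`, `M_{αθ}(Λ_{α,ν})`
    (∀ M ∈ GGCalculus.meanLaw θ ν, ∃ R N K : MeasureTheory.Measure ℝ,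
      GGCalculus.meanLaw θ ν = {M} ∧
      GGCalculus.meanLaw (α * θ) (GGCalculus.rho α) = {R} ∧
      GGCalculus.meanLaw (α * θ) (GGCalculus.rhoMixed α ν) = {N} ∧
      GGCalculus.meanLaw (α * θ) (GGCalculus.lampertiMixed α ν) = {K} ∧
      GGCalculus.stableGGC 1 0 α θ ν = {GGCalculus.gammaMixture (α * θ) N} ∧
      GGCalculus.stableGGC 1 1 α θ ν = {GGCalculus.gammaMixture (α * θ) K} ∧
      N = GGCalculus.prodLaw R (GGCalculus.powLaw (1 / α) M) ∧
      GGCalculus.skewedOccupation α (α * θ) (GGCalculus.gammaTilt θ 1 M) = K ∧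
      K = GGCalculus.gammaTilt (α * θ) 1 N) ∧
    -- for a probability measure `ν` these are means of Dirichlet processes
    (MeasureTheory.IsProbabilityMeasure ν →
      MeasureTheory.IsProbabilityMeasure (GGCalculus.rho α) ∧
      MeasureTheory.IsProbabilityMeasure (GGCalculus.rhoMixed α ν) ∧
      MeasureTheory.IsProbabilityMeasure (GGCalculus.lampertiMixed α ν) ∧
      GGCalculus.meanLaw θ ν = {GGCalculus.dirichletMean θ ν} ∧
      GGCalculus.meanLaw (α * θ) (GGCalculus.rho α) =
        {GGCalculus.dirichletMean (α * θ) (GGCalculus.rho α)} ∧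
      GGCalculus.meanLaw (α * θ) (GGCalculus.rhoMixed α ν) =
        {GGCalculus.dirichletMean (α * θ) (GGCalculus.rhoMixed α ν)} ∧
      GGCalculus.meanLaw (α * θ) (GGCalculus.lampertiMixed α ν) =
        {GGCalculus.dirichletMean (α * θ) (GGCalculus.lampertiMixed α ν)}) := by
  open GGCalculus in
  have hτ : 0 < α * θ := by positivity
  have hT0 := isThorin_rho hα0 hα1
  have hT1 := isThorin_rhoMixed hα0 hα1 hν
  have hT2 := isThorin_lampertiMixed hα0 hα1 hν
  have hrho : IsProbabilityMeasure (rho α) := ⟨rho_univ hα0 hα1⟩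
  have hsig := hν.sigmaFinite
  obtain ⟨L, hL⟩ := stableGGC_one_zero hα0 hα1 hθ hν
  obtain ⟨L', hL'⟩ := stableGGC_one_one hα0 hα1 hθ hν
  refine ⟨hT1, hT2, ⟨L, hL⟩, ⟨L', hL'⟩,
    ⟨fun ⟨M, hM⟩ => measure_univ_le_one_of_mem_meanLaw hθ hν hM, meanLaw_nonempty hθ hν⟩, ?_, ?_⟩
  · intro M hM
    -- The witnesses are explicit: `N` is the product law and `K` the gamma tilt of `N`, so those
    -- two identities hold by definition. The occupation law agrees with `K` by uniqueness.
    have hR := dirichletMean_mem_meanLaw hτ hT0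
    have hN := prodLaw_mem_meanLaw hα0 hα1 hθ hν hM hR
    have hK := gammaTilt_mem_meanLaw hα0 hα1 hτ hν hN
    refine ⟨_, _, _, meanLaw_eq_singleton hθ hν hM, meanLaw_eq_singleton hτ hT0 hR,
      meanLaw_eq_singleton hτ hT1 hN, meanLaw_eq_singleton hτ hT2 hK, ?_, ?_, rfl,
      eq_of_mem_meanLaw hτ hT2 (skewedOccupation_mem_meanLaw hα0 hα1 hθ hν hM) hK, rfl⟩
    · rw [hL.1, ← hL.2, GGC_eq_singleton hT1 (gammaMixture_mem_GGC hτ hT1 hN)]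
    · rw [hL'.1, ← hL'.2, GGC_eq_singleton hT2 (gammaMixture_mem_GGC hτ hT2 hK)]
  · intro hp
    have hp1 : IsProbabilityMeasure (rhoMixed α ν) :=
      ⟨by rw [rhoMixed_univ hα0 hα1 hν.ae_pos, measure_univ]⟩
    have hp2 : IsProbabilityMeasure (lampertiMixed α ν) :=
      ⟨by rw [lampertiMixed_univ hα0 hα1 hν.ae_pos, measure_univ]⟩
    exact ⟨hrho, hp1, hp2,
      meanLaw_eq_singleton hθ hν (dirichletMean_mem_meanLaw hθ hν),
      meanLaw_eq_singleton hτ hT0 (dirichletMean_mem_meanLaw hτ hT0),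
      meanLaw_eq_singleton hτ hT1 (dirichletMean_mem_meanLaw hτ hT1),
      meanLaw_eq_singleton hτ hT2 (dirichletMean_mem_meanLaw hτ hT2)⟩
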